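/- Let $\mathfrak{io}(1,3)$ be the complex Poincaré Lie algebra with generators $M_i,N_i,P_0,P_i$ ($i=1,2,3$), brackets $[M_i,M_j]=i\epsilon_{ijk}M_k$, $[M_i,N_j]=i\epsilon_{ijk}N_k$, $[N_i,N_j]=-i\epsilon_{ijk}M_k$, $[M_j,P_k]=i\epsilon_{jkl}P_l$, $[M_j,P_0]=0$, $[N_j,P_k]=-i\delta_{jk}P_0$, $[N_j,P_0]=-iP_j$, $[P_i,P_j]=[P_i,P_0]=0$ (repeated indices are summed over $1,2,3$), and let $\mathcal U=U_{\mathfrak{io}(1,3)}[[h]]$ be the $h$-adic $\mathbb C[[h]]$-algebra of formal power series over its enveloping algebra. Put $\vec P^2=P_1^2+P_2^2+P_3^2$, $P^2=\vec P^2-P_0^2$, $$\Xi=hP_0+\sqrt{1-h^2P^2},\qquad \Xi^{-1}=\frac{\sqrt{1-h^2P^2}-hP_0}{1-h^2\vec P^2},$$ where the square root, the quotient, and the logarithm and exponentials below are given by the usual power series. Tensor products are completed $h$-adically. 1. $\mathcal U$, with its undeformed product, has exactly one structure $(\Delta,\varepsilon,S)$ of a topological Hopf algebra over $\mathbb C[[h]]$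 with $$\Delta(M_i)=M_i\otimes1+1\otimes M_i,\qquad \Delta(N_i)=N_i\otimes 1+\Xi^{-1}\otimes N_i-h\epsilon_{ijm}P_j\Xi^{-1}\otimes M_m,$$ $$\Delta(P_i)=P_i\otimes\Xi+1\otimes P_i,\qquad \Delta(P_0)=P_0\otimes\Xi+\Xi^{-1}\otimes P_0+hP_m\Xi^{-1}\otimes P_m,$$ $$S(M_i)=-M_i,\quad S(N_i)=-\Xi N_i-h\epsilon_{ijm}P_jM_m,\quad S(P_i)=-P_i\Xi^{-1},\quad S(P_0)=-P_0+h\vec P^2\Xi^{-1},$$ and $\varepsilon(X)=0$ for $X\in\mathfrak{io}(1,3)$. 2. Let $\mathcal K$ be the $h$-adic $\mathbb C[[h]]$-algebra with generators $M_i,N_i,\mathcal P_0,\mathcal P_i$ (the power series over the free algebra, modulo the $h$-adically closed two-sided ideal generated by the relations) and the same commutation relations as above with $\mathcal P_\mu$ in place of $P_\mu$, except that $$[N_i,\mathcal P_j]=-\tfrac i2\delta_{ij}\bigl(h^{-1}(1-e^{-2h\mathcal P_0})+h\vec{\mathcal P}^2\bigr)+ih\,\mathcal P_i\mathcal P_j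 .$$ Then $\mathcal K$ has exactly one structure of a topological Hopf algebra with $$\Delta(M_i)=M_i\otimes1+1\otimes M_i,\qquad \Delta(N_i)=N_i\otimes1+e^{-h\mathcal P_0}\otimes N_i-h\epsilon_{ijm}\mathcal P_j\otimes M_m,$$ $$\Delta(\mathcal P_0)=1\otimes\mathcal P_0+\mathcal P_0\otimes1,\qquad \Delta(\mathcal P_k)=e^{-h\mathcal P_0}\otimes\mathcal P_k+\mathcal P_k\otimes 1$$ and counit zero on the generators (the $\kappa$-Poincaré algebra in the Majid–Ruegg bicrossproduct basis). 3. There is an isomorphism of topological Hopf algebras $\mathcal K\to\mathcal U$ with $M_i\mapsto M_i$, $N_i\mapsto N_i$, $\mathcal P_0\mapsto h^{-1}\ln\Xi$, $\mathcal P_i\mapsto P_i\Xi^{-1}$; under it $e^{h\mathcal P_0}$ becomes $\Xi$. 4. In $\mathcal U$, $\Xi\,\Xi^{-1}=\Xi^{-1}\Xi=1$; $\Xi$ and $\Xi^{-1}$ are group-like, $\Delta(\Xi^{\pm1})=\Xi^{\pm1}\otimes\Xi^{\pm1}$ and $\varepsilon(\Xi^{\pm1})=1$; and $S(\Xi)=\Xi^{-1}$.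 5. The square of the antipode is conjugation by the group-like element $\Xi^3$: $S^2(X)=\Xi^3X\,\Xi^{-3}$ for all $X\in\mathcal U$. -/

import Mathlib

open scoped TensorProduct PowerSeries

noncomputable section

namespace KappaPoincare

/-! ## Formal power series with coefficients in a (noncommutative) complex algebra -/

/-- The ring `ℂ[[h]]`; the formal parameter `h` is `PowerSeries.X`. -/
abbrev Ch : Type := PowerSeries ℂ

/-- The formal parameter. -/
abbrev h : Ch := PowerSeries.X

/-- `B[[h]]`, with the Cauchy product, for a complex algebra `B`, commutative or not. -/
def HSeries (B : Type) : Type := PowerSeries B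

namespace HSeries

variable {B : Type} [Ring B]

instance : Ring (HSeries B) := inferInstanceAs (Ring (PowerSeries B))

/-- The coefficient of `h ^ n`. -/
def coeff (n : ℕ) (f : HSeries B) : B := PowerSeries.coeff n f

/-- The series with the given coefficients. -/
def mk (c : ℕ → B) : HSeries B := PowerSeries.mk c

@[ext]
theorem ext {f g : HSeries B} (H : ∀ n, coeff n f = coeff n g) : f = g :=
  PowerSeries.ext H

@[simp]
theorem coeff_mk (c : ℕ → B) (n : ℕ) : coeff n (mk c) = c n :=
  PowerSeries.coeff_mk n c

theorem coeff_sub (n : ℕ) (f g : HSeries B) : coeff n (f - g) = coeff n f - coeff n g :=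
  map_sub (PowerSeries.coeff (R := B) n) f g

theorem coeff_mul (n : ℕ) (f g : HSeries B) :
    coeff n (f * g) = ∑ p ∈ Finset.HasAntidiagonal.antidiagonal n, coeff p.1 f * coeff p.2 g :=
  PowerSeries.coeff_mul n f g

variable [Algebra ℂ B]

/-- Coefficientwise embedding `ℂ[[h]] → B[[h]]`. -/
def scalar : Ch →+* HSeries B := PowerSeries.map (algebraMap ℂ B)

theorem coeff_scalar (n : ℕ) (c : Ch) :
    coeff n (scalar c : HSeries B) = algebraMap ℂ B (PowerSeries.coeff n c) :=
  PowerSeries.coeff_map _ n c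

theorem scalar_commutes (c : Ch) (f : HSeries B) : scalar c * f = f * scalar c := by
  ext n
  rw [coeff_mul, coeff_mul, ← Finset.Nat.sum_antidiagonal_swap]
  refine Finset.sum_congr rfl fun p _ => ?_
  rw [coeff_scalar, coeff_scalar]
  exact Algebra.commutes _ _

/-- `B[[h]]` as an algebra over `ℂ[[h]]`. -/
instance : Algebra Ch (HSeries B) := scalar.toAlgebra' scalar_commutes

theorem smul_def' (c : Ch) (f : HSeries B) : c • f = scalar c * f := rfl

/-- An element of `B`, as a constant series. -/
def C (b : B) : HSeries B := PowerSeries.C b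

/-- The composite `f(a) = ∑ₖ fₖ aᵏ` of a formal power series `f` with an element `a` of `B[[h]]`
whose constant coefficient is zero. As `aᵏ` then starts in degree `k` or later, only the terms
with `k ≤ n` contribute to the coefficient of `hⁿ`. -/
def eval (f : PowerSeries ℂ) (a : HSeries B) : HSeries B :=
  mk fun n => ∑ k ∈ Finset.range (n + 1), PowerSeries.coeff k f • coeff n (a ^ k)

theorem coeff_zero_eval (f : PowerSeries ℂ) (a : HSeries B) :
    coeff 0 (eval f a) = PowerSeries.coeff 0 f • (1 : B) := by
  have h1 : coeff 0 (1 : HSeries B) = 1 := PowerSeries.coeff_zero_one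
  simp [eval, h1]

/-- `h⁻¹ f`, for a series `f` whose constant coefficient is zero. -/
def divH (f : HSeries B) : HSeries B := mk fun n => coeff (n + 1) f

theorem h_smul_divH (f : HSeries B) (hf : coeff 0 f = 0) : h • divH f = f := by
  ext n
  rw [smul_def', coeff_mul]
  cases n with
  | zero => simp [coeff_scalar, hf]
  | succ n =>
    rw [Finset.sum_eq_single (1, n)]
    · simp [coeff_scalar, divH]
    · rintro ⟨i, j⟩ hij hne
      have hi : i ≠ 1 := by
        rintro rfl
        apply hne
        rw [Finset.HasAntidiagonal.mem_antidiagonal] at hij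
        simp only [Prod.mk.injEq, true_and]
        simp only at hij
        omega
      simp [coeff_scalar, PowerSeries.coeff_X, hi]
    · intro hn
      exact absurd (by rw [Finset.HasAntidiagonal.mem_antidiagonal]; simp only; omega) hn

end HSeries

/-- The binomial series `√(1 + t) = ∑ₙ (1/2 choose n) tⁿ`. -/
def sqrtSeries : PowerSeries ℂ :=
  PowerSeries.mk fun n => (∏ i ∈ Finset.range n, ((1 / 2 : ℂ) - (i : ℂ))) / (n.factorial : ℂ)

/-- The geometric series `(1 - t)⁻¹ = ∑ₙ tⁿ`. -/
def geomSeries : PowerSeries ℂ := PowerSeries.mk fun _ => 1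

/-! ## Topological Hopf algebras over `ℂ[[h]]` -/

section Topological

variable (A B : Type) [Ring A] [Algebra Ch A] [Ring B] [Algebra Ch B]

/-- The (two-sided) ideal `hⁿ A`. -/
def hIdeal (n : ℕ) : Ideal A := Ideal.span {algebraMap Ch A (h ^ n)}

variable {A} in
theorem mem_hIdeal {n : ℕ} {a : A} : a ∈ hIdeal A n ↔ ∃ b, a = h ^ n • b := by
  rw [hIdeal, Ideal.mem_span_singleton']
  constructor
  · rintro ⟨b, rfl⟩
    exact ⟨b, by rw [Algebra.smul_def, Algebra.commutes]⟩
  · rintro ⟨b, rfl⟩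
    exact ⟨b, by rw [Algebra.smul_def, Algebra.commutes]⟩

instance (n : ℕ) : (hIdeal A n).IsTwoSided :=
  ⟨fun {a} c ha => by
    obtain ⟨b, rfl⟩ := mem_hIdeal.1 ha
    exact mem_hIdeal.2 ⟨b * c, by rw [smul_mul_assoc]⟩⟩

theorem hIdeal_succ_le (n : ℕ) : hIdeal A (n + 1) ≤ hIdeal A n := fun a ha => by
  obtain ⟨b, rfl⟩ := mem_hIdeal.1 ha
  exact mem_hIdeal.2 ⟨h • b, by rw [smul_smul, pow_succ]⟩

/-- The reduction `A / hⁿ A`. -/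
abbrev Red (n : ℕ) : Type := A ⧸ hIdeal A n

/-- The class of an element in `A / hⁿ A`. -/
abbrev red (n : ℕ) : A →ₐ[Ch] Red A n := Ideal.Quotient.mkₐ Ch (hIdeal A n)

theorem h_pow_smul_red (n : ℕ) (x : Red A n) : h ^ n • x = 0 := by
  obtain ⟨a, rfl⟩ := Ideal.Quotient.mk_surjective x
  change red A n (h ^ n • a) = 0
  exact Ideal.Quotient.eq_zero_iff_mem.2 (mem_hIdeal.2 ⟨a, rfl⟩)

theorem h_pow_smul_tensor (n : ℕ) (x : Red A n ⊗[Ch] Red B n) : h ^ n • x = 0 := by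
  induction x with
  | zero => simp
  | add x y hx hy => rw [smul_add, hx, hy, add_zero]
  | tmul x y => rw [TensorProduct.smul_tmul', h_pow_smul_red, TensorProduct.zero_tmul]

/-- The projection `A / hⁿ⁺¹ A → A / hⁿ A`. -/
def redStep (n : ℕ) : Red A (n + 1) →ₐ[Ch] Red A n :=
  Ideal.Quotient.liftₐ (hIdeal A (n + 1)) (red A n) fun _ ha =>
    Ideal.Quotient.eq_zero_iff_mem.2 (hIdeal_succ_le A n ha)

/-- The completed tensor product `A ⊗̂ B` over `ℂ[[h]]`, as an algebra: the inverse limit of the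
algebras `A / hⁿ A ⊗ B / hⁿ B`. -/
def CTensor : Subalgebra Ch (∀ n : ℕ, Red A n ⊗[Ch] Red B n) where
  carrier := {x | ∀ n, Algebra.TensorProduct.map (redStep A n) (redStep B n) (x (n + 1)) = x n}
  mul_mem' hx hy n := by rw [Pi.mul_apply, map_mul, hx n, hy n, Pi.mul_apply]
  add_mem' hx hy n := by rw [Pi.add_apply, map_add, hx n, hy n, Pi.add_apply]
  algebraMap_mem' r n := by
    rw [Pi.algebraMap_apply, Pi.algebraMap_apply, AlgHom.commutes]

variable {A B}

/-- The element `a ⊗ b` of `A ⊗̂ B`. -/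
def ctmul (a : A) (b : B) : CTensor A B :=
  ⟨fun n => red A n a ⊗ₜ[Ch] red B n b, fun _ => rfl⟩

/-- The image of an element of `A ⊗̂ B` in `A / hⁿ A ⊗ B / hⁿ B`. -/
def CTensor.level (n : ℕ) : CTensor A B →ₐ[Ch] Red A n ⊗[Ch] Red B n :=
  (Pi.evalAlgHom Ch (fun n => Red A n ⊗[Ch] Red B n) n).comp (CTensor A B).val

/-- The linear map `A / hⁿ A → B / hⁿ B` induced by a linear map `A → B`. -/
def redLin (f : A →ₗ[Ch] B) (n : ℕ) : Red A n →ₗ[Ch] Red B n where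
  toFun := Quotient.lift (fun a => red B n (f a)) (by
    intro a b hab
    have hab' : a - b ∈ hIdeal A n := (Submodule.quotientRel_def _).1 hab
    obtain ⟨c, hc⟩ := mem_hIdeal.1 hab'
    refine Ideal.Quotient.eq.2 (mem_hIdeal.2 ⟨f c, ?_⟩)
    rw [← map_sub, hc, map_smul])
  map_add' x y := by
    obtain ⟨a, rfl⟩ := Ideal.Quotient.mk_surjective x
    obtain ⟨b, rfl⟩ := Ideal.Quotient.mk_surjective y
    change red B n (f (a + b)) = red B n (f a) + red B n (f b)
    rw [map_add, map_add]
  map_smul' c x := by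
    obtain ⟨a, rfl⟩ := Ideal.Quotient.mk_surjective x
    change red B n (f (c • a)) = c • red B n (f a)
    rw [map_smul, map_smul]

theorem redLin_red (f : A →ₗ[Ch] B) (n : ℕ) (a : A) :
    redLin f n (red A n a) = red B n (f a) := rfl

/-- The map `A / hⁿ A → B / hⁿ B ⊗ B / hⁿ B` induced by `Δ : A → B ⊗̂ B`. -/
def redComul (Δ : A →ₐ[Ch] CTensor B B) (n : ℕ) : Red A n →ₐ[Ch] Red B n ⊗[Ch] Red B n :=
  Ideal.Quotient.liftₐ (hIdeal A n) ((CTensor.level n).comp Δ) fun a ha => by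
    obtain ⟨b, rfl⟩ := mem_hIdeal.1 ha
    rw [map_smul, h_pow_smul_tensor]

/-- The map `A ⊗̂ A → B ⊗̂ B` induced by an algebra homomorphism `A → B`. -/
def CTensor.map (f : A →ₐ[Ch] B) : CTensor A A →ₗ[Ch] CTensor B B where
  toFun x := ⟨fun n => TensorProduct.map (redLin f.toLinearMap n) (redLin f.toLinearMap n)
      (CTensor.level n x), fun n => by
    beta_reduce
    rw [show CTensor.level n x = Algebra.TensorProduct.map (redStep A n) (redStep A n)
      (CTensor.level (n + 1) x) from (x.2 n).symm]
    generalize CTensor.level (n + 1) x = y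
    induction y with
    | zero => simp only [map_zero]
    | add y z hy hz => simp only [map_add, hy, hz]
    | tmul y z =>
      obtain ⟨a, rfl⟩ := Ideal.Quotient.mk_surjective y
      obtain ⟨b, rfl⟩ := Ideal.Quotient.mk_surjective z
      rfl⟩
  map_add' x y := Subtype.ext (funext fun n => by
    change TensorProduct.map _ _ (CTensor.level n (x + y)) = _
    rw [map_add, map_add]
    rfl)
  map_smul' c x := Subtype.ext (funext fun n => by
    change TensorProduct.map _ _ (CTensor.level n (c • x)) = _
    rw [map_smul, map_smul]
    rfl)

variable (A)

/-- The structure of a topological (`h`-adic) Hopf algebra on a `ℂ[[h]]`-algebra `A`: `A` is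
separated and complete in the `h`-adic topology, the coproduct takes values in the completed
tensor product, and the Hopf algebra axioms hold. (All `ℂ[[h]]`-linear maps are continuous.)
The two sides of each axiom live in a separated complete module such as `A ⊗̂ A ⊗̂ A`, the inverse
limit of `Aₙ ⊗ (Aₙ ⊗ Aₙ)` with `Aₙ = A / hⁿ A`, so that the axiom says that
their images agree modulo `hⁿ` for all `n`. -/
structure HopfStructure where
  complete : IsAdicComplete (Ideal.span {h}) A
  /-- The coproduct `Δ : A → A ⊗̂ A`. -/
  comul : A →ₐ[Ch] CTensor A A
  /-- The counit `ε : A → ℂ[[h]]`. -/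
  counit : A →ₐ[Ch] Ch
  /-- The antipode `S : A → A`. -/
  antipode : A →ₗ[Ch] A
  /-- `(Δ ⊗ id) Δ = (id ⊗ Δ) Δ`. -/
  coassoc : ∀ n : ℕ,
    TensorProduct.assoc Ch (Red A n) (Red A n) (Red A n) ∘ₗ
        (redComul comul n).toLinearMap.rTensor (Red A n) ∘ₗ (redComul comul n).toLinearMap =
      (redComul comul n).toLinearMap.lTensor (Red A n) ∘ₗ (redComul comul n).toLinearMap
  /-- `(ε ⊗ id) Δ (a) = 1 ⊗ a`. -/
  counit_comul : ∀ (n : ℕ) (a : A),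
    (redLin counit.toLinearMap n).rTensor (Red A n) (CTensor.level n (comul a)) =
      1 ⊗ₜ[Ch] red A n a
  /-- `(id ⊗ ε) Δ (a) = a ⊗ 1`. -/
  comul_counit : ∀ (n : ℕ) (a : A),
    (redLin counit.toLinearMap n).lTensor (Red A n) (CTensor.level n (comul a)) =
      red A n a ⊗ₜ[Ch] 1
  /-- `m (S ⊗ id) Δ (a) = ε(a) 1`. -/
  antipode_left : ∀ (n : ℕ) (a : A),
    LinearMap.mul' Ch (Red A n)
        ((redLin antipode n).rTensor (Red A n) (CTensor.level n (comul a))) =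
      algebraMap Ch (Red A n) (counit a)
  /-- `m (id ⊗ S) Δ (a) = ε(a) 1`. -/
  antipode_right : ∀ (n : ℕ) (a : A),
    LinearMap.mul' Ch (Red A n)
        ((redLin antipode n).lTensor (Red A n) (CTensor.level n (comul a))) =
      algebraMap Ch (Red A n) (counit a)

variable {A}

/-- An isomorphism of topological Hopf algebras. -/
structure IsHopfIso (H : HopfStructure A) (K : HopfStructure B) (Φ : A ≃ₐ[Ch] B) : Prop where
  comul : ∀ a, K.comul (Φ a) = CTensor.map (Φ : A →ₐ[Ch] B) (H.comul a)
  counit : ∀ a, K.counit (Φ a) = H.counit a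
  antipode : ∀ a, K.antipode (Φ a) = Φ (H.antipode a)

end Topological

/-! ## The Poincaré Lie algebra -/

/-- The totally antisymmetric symbol with `ε₀₁₂ = 1`. -/
def eps (i j k : Fin 3) : ℂ :=
  if j = i + 1 ∧ k = i + 2 then 1 else if j = i + 2 ∧ k = i + 1 then -1 else 0

/-- The complex Lie algebra `io(1,3)`. The element `⟨m, n, p₀, p⟩` stands for
`∑ᵢ mᵢ Mᵢ + ∑ᵢ nᵢ Nᵢ + p₀ P₀ + ∑ᵢ pᵢ Pᵢ`. -/
@[ext]
structure Poincare : Type where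
  m : Fin 3 → ℂ
  n : Fin 3 → ℂ
  p0 : ℂ
  p : Fin 3 → ℂ

namespace Poincare

instance : Zero Poincare := ⟨⟨0, 0, 0, 0⟩⟩

instance : Add Poincare := ⟨fun x y => ⟨x.m + y.m, x.n + y.n, x.p0 + y.p0, x.p + y.p⟩⟩

instance : Neg Poincare := ⟨fun x => ⟨-x.m, -x.n, -x.p0, -x.p⟩⟩

instance : Sub Poincare := ⟨fun x y => ⟨x.m - y.m, x.n - y.n, x.p0 - y.p0, x.p - y.p⟩⟩

instance {R : Type} [SMul R ℂ] : SMul R Poincare :=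
  ⟨fun c x => ⟨c • x.m, c • x.n, c • x.p0, c • x.p⟩⟩

/-- The coordinates of an element. -/
def coords (x : Poincare) : (Fin 3 → ℂ) × (Fin 3 → ℂ) × ℂ × (Fin 3 → ℂ) := (x.m, x.n, x.p0, x.p)

theorem coords_injective : Function.Injective coords := fun x y hxy => by
  simp only [coords, Prod.mk.injEq] at hxy
  exact Poincare.ext hxy.1 hxy.2.1 hxy.2.2.1 hxy.2.2.2

instance : AddCommGroup Poincare :=
  coords_injective.addCommGroup coords rfl (fun _ _ => rfl) (fun _ => rfl) (fun _ _ => rfl)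
    (fun _ _ => rfl) (fun _ _ => rfl)

/-- The coordinates, as an additive map. -/
def coordsHom : Poincare →+ (Fin 3 → ℂ) × (Fin 3 → ℂ) × ℂ × (Fin 3 → ℂ) where
  toFun := coords
  map_zero' := rfl
  map_add' _ _ := rfl

instance : Module ℂ Poincare :=
  coords_injective.module ℂ coordsHom (fun _ _ => rfl)

/-- Rotation generators. -/
def M (i : Fin 3) : Poincare := ⟨Pi.single i 1, 0, 0, 0⟩

/-- Boost generators. -/
def N (i : Fin 3) : Poincare := ⟨0, Pi.single i 1, 0, 0⟩

/-- The generator of time translations. -/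
def P0 : Poincare := ⟨0, 0, 1, 0⟩

/-- Generators of space translations. -/
def P (i : Fin 3) : Poincare := ⟨0, 0, 0, Pi.single i 1⟩

/-- The bilinear extension of the brackets of the generators, which are spelled out in
`bracket_M_M` and the facts after it. -/
instance : Bracket Poincare Poincare where
  bracket x y :=
    ⟨Complex.I • (crossProduct x.m y.m - crossProduct x.n y.n),
      Complex.I • (crossProduct x.m y.n + crossProduct x.n y.m),
      Complex.I * (x.p ⬝ᵥ y.n - x.n ⬝ᵥ y.p),
      Complex.I • (crossProduct x.m y.p + crossProduct x.p y.m + x.p0 • y.n - y.p0 • x.n)⟩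

theorem bracket_def (x y : Poincare) : ⁅x, y⁆ =
    ⟨Complex.I • (crossProduct x.m y.m - crossProduct x.n y.n),
      Complex.I • (crossProduct x.m y.n + crossProduct x.n y.m),
      Complex.I * (x.p ⬝ᵥ y.n - x.n ⬝ᵥ y.p),
      Complex.I • (crossProduct x.m y.p + crossProduct x.p y.m + x.p0 • y.n - y.p0 • x.n)⟩ :=
  rfl

theorem zero_def : (0 : Poincare) = ⟨0, 0, 0, 0⟩ := rfl

theorem add_def (x y : Poincare) :
    x + y = ⟨x.m + y.m, x.n + y.n, x.p0 + y.p0, x.p + y.p⟩ := rfl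

theorem neg_def (x : Poincare) : -x = ⟨-x.m, -x.n, -x.p0, -x.p⟩ := rfl

theorem smul_def (c : ℂ) (x : Poincare) : c • x = ⟨c • x.m, c • x.n, c * x.p0, c • x.p⟩ := rfl

instance : LieRing Poincare where
  add_lie x y z := by
    simp only [bracket_def, add_def, map_add, LinearMap.add_apply, add_dotProduct,
      add_smul, smul_add, smul_sub, Poincare.mk.injEq]
    refine ⟨?_, ?_, ?_, ?_⟩
    · abel
    · abel
    · ring
    · abel
  lie_add x y z := by
    simp only [bracket_def, add_def, map_add, dotProduct_add, add_smul, smul_add, smul_sub,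
      Poincare.mk.injEq]
    refine ⟨?_, ?_, ?_, ?_⟩
    · abel
    · abel
    · ring
    · abel
  lie_self x := by
    simp only [bracket_def, zero_def, Poincare.mk.injEq]
    refine ⟨?_, ?_, ?_, ?_⟩
    · rw [cross_self, cross_self, sub_self, smul_zero]
    · rw [← cross_anticomm x.m x.n, add_neg_cancel, smul_zero]
    · rw [dotProduct_comm, sub_self, mul_zero]
    · rw [← cross_anticomm x.m x.p, add_neg_cancel, zero_add, sub_self, smul_zero]
  leibniz_lie x y z := by
    obtain ⟨a, b, c, d⟩ := x
    obtain ⟨a', b', c', d'⟩ := y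
    obtain ⟨a'', b'', c'', d''⟩ := z
    simp only [bracket_def, add_def, Poincare.mk.injEq]
    refine ⟨?_, ?_, ?_, ?_⟩
    · ext i
      fin_cases i <;> simp [crossProduct, Matrix.vecHead, Matrix.vecTail] <;> ring
    · ext i
      fin_cases i <;> simp [crossProduct, Matrix.vecHead, Matrix.vecTail] <;> ring
    · simp [crossProduct, dotProduct, Fin.sum_univ_three, Matrix.vecHead, Matrix.vecTail]
      ring
    · ext i
      fin_cases i <;> simp [crossProduct, dotProduct, Fin.sum_univ_three, Matrix.vecHead,
        Matrix.vecTail] <;> ring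

instance : LieAlgebra ℂ Poincare where
  lie_smul c x y := by
    simp only [bracket_def, smul_def, map_smul, dotProduct_smul, Poincare.mk.injEq]
    refine ⟨?_, ?_, ?_, ?_⟩ <;> (try ext i) <;> simp <;> ring

/-! The brackets of the generators. -/

theorem bracket_M_M (i j : Fin 3) : ⁅M i, M j⁆ = ∑ k, (Complex.I * eps i j k) • M k := by
  rw [Fin.sum_univ_three]
  ext l
  all_goals fin_cases i <;> fin_cases j <;> first | fin_cases l | skip
  all_goals simp [bracket_def, zero_def, add_def, neg_def, smul_def, crossProduct, eps, M]

theorem bracket_M_N (i j : Fin 3) : ⁅M i, N j⁆ = ∑ k, (Complex.I * eps i j k) • N k := by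
  rw [Fin.sum_univ_three]
  ext l
  all_goals fin_cases i <;> fin_cases j <;> first | fin_cases l | skip
  all_goals simp [bracket_def, zero_def, add_def, neg_def, smul_def, crossProduct, eps, M, N]

theorem bracket_N_N (i j : Fin 3) : ⁅N i, N j⁆ = ∑ k, (-Complex.I * eps i j k) • M k := by
  rw [Fin.sum_univ_three]
  ext l
  all_goals fin_cases i <;> fin_cases j <;> first | fin_cases l | skip
  all_goals simp [bracket_def, zero_def, add_def, neg_def, smul_def, crossProduct, eps, M, N]

theorem bracket_M_P (j k : Fin 3) : ⁅M j, P k⁆ = ∑ l, (Complex.I * eps j k l) • P l := by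
  rw [Fin.sum_univ_three]
  ext l
  all_goals fin_cases j <;> fin_cases k <;> first | fin_cases l | skip
  all_goals simp [bracket_def, zero_def, add_def, neg_def, smul_def, crossProduct, eps, M, P]

theorem bracket_M_P0 (j : Fin 3) : ⁅M j, P0⁆ = 0 := by
  ext <;> simp [bracket_def, zero_def, M, P0]

theorem bracket_N_P (j k : Fin 3) :
    ⁅N j, P k⁆ = (-Complex.I * if j = k then 1 else 0) • P0 := by
  rw [smul_def, bracket_def]
  ext <;> simp [N, P, P0, Pi.single_apply, eq_comm, apply_ite]

theorem bracket_N_P0 (j : Fin 3) : ⁅N j, P0⁆ = (-Complex.I) • P j := by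
  rw [smul_def, bracket_def]
  ext <;> simp [N, P, P0]

theorem bracket_P_P (j k : Fin 3) : ⁅P j, P k⁆ = 0 := by
  ext <;> simp [bracket_def, zero_def, P]

theorem bracket_P_P0 (j : Fin 3) : ⁅P j, P0⁆ = 0 := by
  ext <;> simp [bracket_def, zero_def, P, P0]

end Poincare

/-- A complex number, as a constant in `ℂ[[h]]`. -/
abbrev cst (z : ℂ) : Ch := PowerSeries.C z

/-! ## The classical basis -/

/-- The algebra `U_io(1,3)[[h]]`. -/
abbrev UP : Type := HSeries (UniversalEnvelopingAlgebra ℂ Poincare)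

namespace Classical

/-- An element of `io(1,3)`, as an element of `U_io(1,3)[[h]]`. -/
def inc (x : Poincare) : UP := HSeries.C (UniversalEnvelopingAlgebra.ι ℂ x)

def M (i : Fin 3) : UP := inc (Poincare.M i)

def N (i : Fin 3) : UP := inc (Poincare.N i)

def P0 : UP := inc Poincare.P0

def P (i : Fin 3) : UP := inc (Poincare.P i)

/-- The square `P₁² + P₂² + P₃²` of the spatial momentum. -/
def vecPSq : UP := ∑ i, P i ^ 2

/-- `P² = P_μ P^μ` for the metric `diag(-,+,+,+)`. -/
def PSq : UP := vecPSq - P0 ^ 2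

/-- `√(1 - h² P²)`. -/
def root : UP := HSeries.eval sqrtSeries (-(h ^ 2 • PSq))

/-- `Ξ = h P₀ + √(1 - h² P²)`. -/
def Xi : UP := h • P0 + root

/-- `Ξ⁻¹ = (√(1 - h² P²) - h P₀) / (1 - h² (P₁² + P₂² + P₃²))`. -/
def XiInv : UP := (root - h • P0) * HSeries.eval geomSeries (h ^ 2 • vecPSq)

/-- `ln Ξ = ∑ₙ (-1)ⁿ⁺¹ (Ξ - 1)ⁿ / n`. -/
def logXi : UP := HSeries.eval (PowerSeries.log ℂ) (Xi - 1)

theorem h_smul_divH_logXi : h • HSeries.divH logXi = logXi :=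
  HSeries.h_smul_divH _ (by simp [logXi, HSeries.coeff_zero_eval])

/-- The deformed coproducts and antipodes of the generators, with undeformed counit. -/
structure IsKappaHopf (H : HopfStructure UP) : Prop where
  comul_M : ∀ i, H.comul (M i) = ctmul (M i) 1 + ctmul 1 (M i)
  comul_N : ∀ i, H.comul (N i) = ctmul (N i) 1 + ctmul XiInv (N i)
    - h • ∑ j, ∑ m, cst (eps i j m) • ctmul (P j * XiInv) (M m)
  comul_P : ∀ i, H.comul (P i) = ctmul (P i) Xi + ctmul 1 (P i)
  comul_P0 : H.comul P0 = ctmul P0 Xi + ctmul XiInv P0 + h • ∑ m, ctmul (P m * XiInv) (P m)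
  counit_inc : ∀ x : Poincare, H.counit (inc x) = 0
  antipode_M : ∀ i, H.antipode (M i) = -M i
  antipode_N : ∀ i, H.antipode (N i) = -(Xi * N i)
    - h • ∑ j, ∑ m, cst (eps i j m) • (P j * M m)
  antipode_P : ∀ i, H.antipode (P i) = -(P i * XiInv)
  antipode_P0 : H.antipode P0 = -P0 + h • (vecPSq * XiInv)

end Classical

/-! ## The bicrossproduct basis -/

namespace Bicross

/-- The generators of the `κ`-Poincaré algebra. -/
inductive Gen : Type
  | M (i : Fin 3)
  | N (i : Fin 3)
  | P0
  | P (i : Fin 3)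

/-- Formal power series with coefficients in the free algebra on the generators. -/
abbrev Free : Type := HSeries (FreeAlgebra ℂ Gen)

/-- A generator, as an element of `Free`. -/
def gen (g : Gen) : Free := HSeries.C (FreeAlgebra.ι ℂ g)

/-- `exp (c h 𝒫₀)` for a complex number `c`. -/
def expFree (c : ℂ) : Free :=
  HSeries.eval (PowerSeries.exp ℂ) ((cst c * h) • gen Gen.P0)

theorem h_smul_divH_one_sub_expFree (c : ℂ) :
    h • HSeries.divH (1 - expFree c) = 1 - expFree c := by
  refine HSeries.h_smul_divH _ ?_
  have h1 : HSeries.coeff 0 (1 : Free) = 1 := PowerSeries.coeff_zero_one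
  have h2 : HSeries.coeff 0 (expFree c) = 1 := by
    simp [expFree, HSeries.coeff_zero_eval]
  rw [HSeries.coeff_sub, h1, h2, sub_self]

/-- The defining relations. Those for the boosts and the spatial momenta read
`[Nᵢ, 𝒫ⱼ] = -(i/2) δᵢⱼ (h⁻¹ (1 - exp (-2 h 𝒫₀)) + h 𝒫²) + i h 𝒫ᵢ 𝒫ⱼ` with
`𝒫² = 𝒫₁² + 𝒫₂² + 𝒫₃²`; the others are those of `io(1,3)`. -/
inductive Rel : Free → Free → Prop
  | M_M (i j : Fin 3) : Rel ⁅gen (.M i), gen (.M j)⁆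
      (∑ k, cst (Complex.I * eps i j k) • gen (.M k))
  | M_N (i j : Fin 3) : Rel ⁅gen (.M i), gen (.N j)⁆
      (∑ k, cst (Complex.I * eps i j k) • gen (.N k))
  | N_N (i j : Fin 3) : Rel ⁅gen (.N i), gen (.N j)⁆
      (∑ k, cst (-Complex.I * eps i j k) • gen (.M k))
  | P_P (i j : Fin 3) : Rel ⁅gen (.P i), gen (.P j)⁆ 0
  | P_P0 (i : Fin 3) : Rel ⁅gen (.P i), gen .P0⁆ 0
  | M_P0 (j : Fin 3) : Rel ⁅gen (.M j), gen .P0⁆ 0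
  | M_P (j k : Fin 3) : Rel ⁅gen (.M j), gen (.P k)⁆
      (∑ l, cst (Complex.I * eps j k l) • gen (.P l))
  | N_P0 (j : Fin 3) : Rel ⁅gen (.N j), gen .P0⁆ (-(cst Complex.I • gen (.P j)))
  | N_P (i j : Fin 3) : Rel ⁅gen (.N i), gen (.P j)⁆
      (-(cst (Complex.I / 2 * if i = j then 1 else 0) •
          (HSeries.divH (1 - expFree (-2)) + h • ∑ k, gen (.P k) ^ 2))
        + (cst Complex.I * h) • (gen (.P i) * gen (.P j)))

/-- The `h`-adic closure of the two-sided ideal `J` generated by the relations, that is, the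
intersection over `n` of the two-sided ideals `J + (hⁿ)`. -/
def ideal : TwoSidedIdeal Free :=
  ⨅ n : ℕ, TwoSidedIdeal.span
    ({x | ∃ a b, Rel a b ∧ x = a - b} ∪ {algebraMap Ch Free (h ^ n)})

/-- The `κ`-Poincaré algebra in the bicrossproduct basis: the `h`-adic `ℂ[[h]]`-algebra with the
above generators and relations. -/
abbrev KP : Type := Free ⧸ TwoSidedIdeal.asIdeal ideal

/-- The quotient map. -/
abbrev proj : Free →ₐ[Ch] KP := Ideal.Quotient.mkₐ Ch (TwoSidedIdeal.asIdeal ideal)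

def M (i : Fin 3) : KP := proj (gen (.M i))

def N (i : Fin 3) : KP := proj (gen (.N i))

def P0 : KP := proj (gen .P0)

def P (i : Fin 3) : KP := proj (gen (.P i))

/-- `exp (-h 𝒫₀)`. -/
def expNeg : KP := proj (expFree (-1))

/-- The coproducts and counits of the generators in the bicrossproduct basis. -/
structure IsKappaHopf (K : HopfStructure KP) : Prop where
  comul_M : ∀ i, K.comul (M i) = ctmul (M i) 1 + ctmul 1 (M i)
  comul_N : ∀ i, K.comul (N i) = ctmul (N i) 1 + ctmul expNeg (N i)
    - h • ∑ j, ∑ m, cst (eps i j m) • ctmul (P j) (M m)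
  comul_P : ∀ i, K.comul (P i) = ctmul expNeg (P i) + ctmul (P i) 1
  comul_P0 : K.comul P0 = ctmul 1 P0 + ctmul P0 1
  counit_M : ∀ i, K.counit (M i) = 0
  counit_N : ∀ i, K.counit (N i) = 0
  counit_P : ∀ i, K.counit (P i) = 0
  counit_P0 : K.counit P0 = 0

end Bicross

end KappaPoincare

end

open scoped TensorProduct PowerSeries

noncomputable section

namespace KappaPoincare

/-! The difficulty is that `Ξ` contains a square root, whose coproduct cannot be read off from the
coproducts of the generators. It is avoided by an algebraic characterization. Squaring `Ξ - hP₀ =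
√(1 - h²P²)` and dividing by `Ξ` gives `2hP₀ = Ξ - Ξ⁻¹ + h² P⃗² Ξ⁻¹`. Together with the commutators
of `Ξ`, of which only `[Nᵢ, Ξ] = -ihPᵢ` is nonzero since `P²` is a Casimir element, this relation is
all that the computations need (`IsKappa`).

Existence in the classical basis. A homomorphism from `U_io(1,3)[[h]]` to a complete algebra is the
same as a family of elements with the Poincaré relations (`IsPoincare.lift`). Normal ordering shows
that the proposed coproducts satisfy these relations in any algebra with two commuting copies of
`U_io(1,3)[[h]]` (`IsKappa.isPoincare_comul`), and that the proposed antipodes satisfy them in the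
opposite algebra (`IsKappa.isPoincare_antipode`). The image of `Ξ` under such a homomorphism follows
from `map_Xi_eq`: a solution of the quadratic equation that commutes with the images of the momenta
and is `1` modulo `h` is unique, because a square root that is `1` modulo `h` is unique among
commuting candidates. This yields `Δ(Ξ) = Ξ ⊗ Ξ`, `ε(Ξ) = 1` and `S(Ξ) = Ξ⁻¹`. The Hopf axioms and
the formula for `S²` are then checked on generators.

Uniqueness. Coproduct and counit are homomorphisms into separated algebras, hence determined by the
generators; the antipode is the convolution inverse of the identity (`HopfStructure.ext_of_comul`).

The bicrossproduct basis. The elements `h⁻¹ ln Ξ` and `PᵢΞ⁻¹` satisfy the deformed relations, the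
quadratic equation being exactly what turns `P₀Ξ⁻¹` into the right-hand side of `[Nᵢ, 𝒫ⱼ]`. The
resulting map `𝒦 → 𝒰` is bijective because it has a left inverse modulo `h`, hits all generators
modulo `h`, `𝒦` is separated and `𝒰` is complete without `h`-torsion; no basis of `𝒦` is needed. The
Hopf structure of `𝒦` is transported along it, and `𝒫₀` is primitive because it is the logarithm of
a group-like element.

Identities between series are proved by contraction: a family of defects, each of which is a
multiple of `h` times another one, vanishes in a separated algebra (`HSep.eq_zero_of_step`). -/

/-! ## Separated and complete algebras -/

/-- A `ℂ[[h]]`-algebra in which only `0` is divisible by every power of `h`. -/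
class HSep (A : Type) [Ring A] [Algebra Ch A] : Prop where
  eq_zero : ∀ x : A, (∀ n, ∃ y, x = h ^ n • y) → x = 0

/-- A separated `ℂ[[h]]`-algebra in which every series `∑ hᵏ aₖ` has a sum. -/
class HComplete (A : Type) [Ring A] [Algebra Ch A] : Prop extends HSep A where
  exists_sum : ∀ a : ℕ → A, ∃ s, ∀ n, ∃ y,
    s = ∑ k ∈ Finset.range n, h ^ k • a k + h ^ n • y

section Complete

variable {A : Type} [Ring A] [Algebra Ch A]

/-- A sequence of tails of a series shows that the first of them is its sum. -/
theorem sum_of_tails {a t : ℕ → A} (H : ∀ m, t m = a m + h • t (m + 1)) (n : ℕ) :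
    ∃ y, t 0 = ∑ k ∈ Finset.range n, h ^ k • a k + h ^ n • y := by
  refine ⟨t n, ?_⟩
  induction n with
  | zero => simp
  | succ n ih =>
    rw [Finset.sum_range_succ, add_assoc, pow_succ, mul_smul, ← smul_add, ← H]
    exact ih

theorem HSep.eq_of_sub [HSep A] {x y : A} (H : ∀ n, ∃ z, x - y = h ^ n • z) : x = y :=
  sub_eq_zero.1 (HSep.eq_zero _ H)

/-- A family of elements each of which is `h` times a multiple of another one vanishes. -/
theorem HSep.eq_zero_of_step [HSep A] {ι : Type} (P : ι → A)
    (H : ∀ i, ∃ j, ∃ c, P i = h • (c * P j)) (i : ι) : P i = 0 := by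
  refine HSep.eq_zero _ fun n => ?_
  -- Each application of the hypothesis gains one factor `h` but changes the member of the family,
  -- so divisibility is proved for all members at once.
  induction n generalizing i with
  | zero => exact ⟨P i, by simp⟩
  | succ n ih =>
    obtain ⟨j, c, hc⟩ := H i
    obtain ⟨y, hy⟩ := ih j
    exact ⟨c * y, by rw [hc, hy, mul_smul_comm, smul_smul, pow_succ']⟩

variable [HComplete A]

/-- The sum `∑ hᵏ aₖ`. -/
def hsum (a : ℕ → A) : A := (HComplete.exists_sum a).choose

theorem hsum_spec (a : ℕ → A) (n : ℕ) :
    ∃ y, hsum a = ∑ k ∈ Finset.range n, h ^ k • a k + h ^ n • y :=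
  (HComplete.exists_sum a).choose_spec n

theorem hsum_unique {a : ℕ → A} {s : A}
    (H : ∀ n, ∃ y, s = ∑ k ∈ Finset.range n, h ^ k • a k + h ^ n • y) : s = hsum a := by
  refine HSep.eq_of_sub fun n => ?_
  obtain ⟨y, hy⟩ := H n
  obtain ⟨z, hz⟩ := hsum_spec a n
  exact ⟨y - z, by rw [hy, hz, smul_sub]; abel⟩

theorem hsum_add (a b : ℕ → A) : hsum (fun k => a k + b k) = hsum a + hsum b := by
  refine (hsum_unique fun n => ?_).symm
  obtain ⟨y, hy⟩ := hsum_spec a n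
  obtain ⟨z, hz⟩ := hsum_spec b n
  refine ⟨y + z, ?_⟩
  simp only [smul_add, Finset.sum_add_distrib]
  rw [hy, hz]
  abel

theorem hsum_mul_left (c : A) (a : ℕ → A) : hsum (fun k => c * a k) = c * hsum a := by
  refine (hsum_unique fun n => ?_).symm
  obtain ⟨y, hy⟩ := hsum_spec a n
  refine ⟨c * y, ?_⟩
  rw [hy, mul_add, Finset.mul_sum]
  simp only [mul_smul_comm]

theorem hsum_succ (a : ℕ → A) : hsum a = a 0 + h • hsum (fun k => a (k + 1)) := by
  refine (hsum_unique fun n => ?_).symm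
  cases n with
  | zero => exact ⟨a 0 + h • hsum (fun k => a (k + 1)), by simp⟩
  | succ n =>
    obtain ⟨y, hy⟩ := hsum_spec (fun k => a (k + 1)) n
    refine ⟨y, ?_⟩
    rw [hy, Finset.sum_range_succ', smul_add, Finset.smul_sum]
    simp only [smul_smul, pow_succ', pow_zero, one_smul]
    abel

end Complete

/-! ### Power series algebras: completeness and extension of homomorphisms -/

namespace HSeries

section Ring

variable {B : Type} [Ring B]

theorem coeff_add (n : ℕ) (f g : HSeries B) : coeff n (f + g) = coeff n f + coeff n g :=
  map_add (PowerSeries.coeff (R := B) n) f g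

theorem coeff_neg (n : ℕ) (f : HSeries B) : coeff n (-f) = -coeff n f :=
  map_neg (PowerSeries.coeff (R := B) n) f

theorem coeff_zero (n : ℕ) : coeff n (0 : HSeries B) = 0 :=
  map_zero (PowerSeries.coeff (R := B) n)

theorem coeff_one (n : ℕ) : coeff n (1 : HSeries B) = if n = 0 then 1 else 0 :=
  PowerSeries.coeff_one n

theorem coeff_C (n : ℕ) (b : B) : coeff n (C b) = if n = 0 then b else 0 :=
  PowerSeries.coeff_C n b

theorem coeff_zero_mul (f g : HSeries B) : coeff 0 (f * g) = coeff 0 f * coeff 0 g := by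
  simp [coeff_mul]

theorem coeff_zero_C (b : B) : coeff 0 (C b) = b := by simp [coeff_C]

theorem coeff_C_mul (n : ℕ) (b : B) (f : HSeries B) : coeff n (C b * f) = b * coeff n f :=
  PowerSeries.coeff_C_mul n f b

/-- Constant series, as a ring homomorphism. -/
def CHom : B →+* HSeries B := PowerSeries.C

theorem CHom_apply (b : B) : CHom b = C b := rfl

theorem coeff_pow_of_lt {a : HSeries B} (ha : coeff 0 a = 0) {n k : ℕ} (hnk : n < k) :
    coeff n (a ^ k) = 0 := by
  induction k generalizing n with
  | zero => omega
  | succ k ih =>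
    rw [pow_succ', coeff_mul]
    refine Finset.sum_eq_zero fun p hp => ?_
    rw [Finset.HasAntidiagonal.mem_antidiagonal] at hp
    rcases Nat.eq_zero_or_pos p.1 with h0 | h0
    · rw [h0, ha, zero_mul]
    · rw [ih (by omega), mul_zero]

end Ring

variable {B : Type} [Ring B] [Algebra ℂ B]

theorem coeff_h_smul_zero (f : HSeries B) : coeff 0 (h • f) = 0 := by
  rw [smul_def', coeff_zero_mul, coeff_scalar]
  simp

theorem coeff_h_smul_succ (n : ℕ) (f : HSeries B) : coeff (n + 1) (h • f) = coeff n f := by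
  rw [smul_def', coeff_mul, Finset.Nat.sum_antidiagonal_succ]
  simp only [coeff_scalar, PowerSeries.coeff_zero_X, map_zero, zero_mul, zero_add]
  rw [Finset.sum_eq_single (0, n)]
  · simp
  · rintro ⟨i, j⟩ hij hne
    rw [Finset.HasAntidiagonal.mem_antidiagonal] at hij
    have hi : i ≠ 0 := by
      rintro rfl
      exact hne (by simpa using hij)
    simp [PowerSeries.coeff_X, hi]
  · simp

theorem coeff_cst_smul (n : ℕ) (z : ℂ) (f : HSeries B) :
    coeff n (cst z • f) = z • coeff n f := by
  have : scalar (cst z) = C (algebraMap ℂ B z) := PowerSeries.map_C _ _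
  rw [smul_def', this, coeff_C_mul, Algebra.smul_def]

theorem h_smul_injective {f g : HSeries B} (H : h • f = h • g) : f = g := by
  ext n
  rw [← coeff_h_smul_succ, H, coeff_h_smul_succ]

theorem coeff_h_pow_smul_of_lt {n k : ℕ} (hnk : n < k) (f : HSeries B) :
    coeff n (h ^ k • f) = 0 := by
  induction k generalizing n with
  | zero => omega
  | succ k ih =>
    rw [pow_succ', mul_smul]
    cases n with
    | zero => exact coeff_h_smul_zero _
    | succ n => rw [coeff_h_smul_succ, ih (by omega)]

theorem eq_C_add_h_smul (f : HSeries B) : f = C (coeff 0 f) + h • divH f := by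
  ext n
  cases n with
  | zero => rw [coeff_add, coeff_zero_C, coeff_h_smul_zero, add_zero]
  | succ n => rw [coeff_add, coeff_h_smul_succ, coeff_C]; simp [divH]

theorem divH_h_smul (f : HSeries B) : divH (h • f) = f := by
  ext n
  rw [divH, coeff_mk, coeff_h_smul_succ]

theorem eq_h_smul {f : HSeries B} (hf : coeff 0 f = 0) : f = h • divH f :=
  (h_smul_divH f hf).symm

/-- Polynomials in `h` with constant coefficients are dense; this reduces equality of
`ℂ[[h]]`-linear maps into separated algebras to constants. -/
theorem eq_sum_add (f : HSeries B) (n : ℕ) :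
    ∃ y, f = ∑ k ∈ Finset.range n, h ^ k • C (coeff k f) + h ^ n • y := by
  refine ⟨mk fun k => coeff (k + n) f, ?_⟩
  induction n with
  | zero => simp [HSeries.ext_iff]
  | succ n ih =>
    rw [Finset.sum_range_succ, add_assoc, pow_succ, mul_smul, ← smul_add]
    conv_lhs => rw [ih]
    congr 2
    rw [eq_C_add_h_smul (mk fun k => coeff (k + n) f)]
    congr 2
    · simp
    · ext k
      simp only [divH, coeff_mk]
      congr 1
      omega

instance : HComplete (HSeries B) where
  eq_zero x H := by
    ext n
    obtain ⟨y, hy⟩ := H (n + 1)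
    rw [hy, coeff_h_pow_smul_of_lt (Nat.lt_succ_self n), coeff_zero]
  exists_sum a := by
    -- `t m` is the tail `∑ hⁱ a (m + i)`; its coefficient of `hᵏ` involves only `i ≤ k`.
    let t : ℕ → HSeries B := fun m =>
      mk fun k => ∑ i ∈ Finset.range (k + 1), coeff (k - i) (a (m + i))
    refine ⟨t 0, sum_of_tails fun m => ?_⟩
    ext k
    cases k with
    | zero => simp [t, coeff_add, coeff_h_smul_zero]
    | succ k =>
      simp only [t, coeff_add, coeff_h_smul_succ, coeff_mk]
      rw [Finset.sum_range_succ', add_comm]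
      simp [add_comm, add_left_comm]

section Lift

variable {A : Type} [Ring A] [Algebra Ch A]

/-- The extension of a homomorphism `B → A` to power series, for complete `A`. -/
def lift [HComplete A] (φ : B →+* A)
    (hφ : ∀ z, φ (algebraMap ℂ B z) = algebraMap Ch A (cst z)) : HSeries B →ₐ[Ch] A :=
  have hadd (f g : HSeries B) : hsum (fun k => φ (coeff k (f + g))) =
      hsum (fun k => φ (coeff k f)) + hsum (fun k => φ (coeff k g)) := by
    simp only [coeff_add, map_add, hsum_add]
  have hstep (f : HSeries B) : hsum (fun k => φ (coeff k f)) =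
      φ (coeff 0 f) + h • hsum (fun k => φ (coeff k (divH f))) := by
    rw [hsum_succ]; simp [divH]
  have hCmul (b : B) (f : HSeries B) : hsum (fun k => φ (coeff k (C b * f))) =
      φ b * hsum (fun k => φ (coeff k f)) := by
    simp only [coeff_C_mul, map_mul, hsum_mul_left]
  have hmul (f g : HSeries B) : hsum (fun k => φ (coeff k (f * g))) =
      hsum (fun k => φ (coeff k f)) * hsum (fun k => φ (coeff k g)) := by
    -- With `g` fixed, the failure of multiplicativity at `f` is `h` times the failure at `divH f`:
    -- constants on the left are handled by `hCmul`, and `e` is the product rule for `divH`.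
    refine sub_eq_zero.1 (HSep.eq_zero_of_step (fun f : HSeries B =>
      hsum (fun k => φ (coeff k (f * g))) -
      hsum (fun k => φ (coeff k f)) * hsum (fun k => φ (coeff k g))) (fun f => ?_) f)
    refine ⟨divH f, 1, ?_⟩
    have e : divH (f * g) = divH f * g + C (coeff 0 f) * divH g := by
      apply h_smul_injective
      have e1 := eq_C_add_h_smul (f * g)
      have e2 : f * g = C (coeff 0 f) * g + h • (divH f * g) := by
        conv_lhs => rw [eq_C_add_h_smul f]
        rw [add_mul, smul_mul_assoc]
      have e3 : C (coeff 0 f) * g =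
          C (coeff 0 (f * g)) + h • (C (coeff 0 f) * divH g) := by
        conv_lhs => rw [eq_C_add_h_smul g]
        rw [mul_add, mul_smul_comm, coeff_zero_mul]
        congr 1
        exact (map_mul CHom _ _).symm
      rw [e3] at e2
      have e4 := e1.symm.trans e2
      rw [add_assoc, add_right_inj] at e4
      rw [e4, smul_add, add_comm]
    rw [hstep (f * g), hstep f, e, hadd, hCmul, coeff_zero_mul, map_mul]
    have hg : φ (coeff 0 f) * hsum (fun k => φ (coeff k g)) = φ (coeff 0 f) * φ (coeff 0 g) +
        h • (φ (coeff 0 f) * hsum fun k => φ (coeff k (divH g))) := by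
      rw [hstep g, mul_add, mul_smul_comm]
    rw [add_mul, hg]
    simp only [smul_add, smul_mul_assoc, one_mul, smul_sub]
    abel
  have hscal (c : Ch) : hsum (fun k => φ (coeff k (scalar c : HSeries B))) =
      algebraMap Ch A c := by
    -- The same contraction, with the series `c` replaced by `(c - c₀) / h`; on the constant `c₀`
    -- the claim is the hypothesis on `φ`.
    refine sub_eq_zero.1 (HSep.eq_zero_of_step (fun c : Ch =>
      hsum (fun k => φ (coeff k (scalar c : HSeries B))) - algebraMap Ch A c) (fun c => ?_) c)
    refine ⟨PowerSeries.mk fun k => PowerSeries.coeff (k + 1) c, 1, ?_⟩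
    have e : divH (scalar c : HSeries B) =
        scalar (PowerSeries.mk fun k => PowerSeries.coeff (k + 1) c) := by
      ext k
      simp [divH, coeff_scalar]
    have hc : algebraMap Ch A c = h • algebraMap Ch A
        (PowerSeries.mk fun k => PowerSeries.coeff (k + 1) c) +
          algebraMap Ch A (cst (PowerSeries.coeff 0 c)) := by
      conv_lhs => rw [PowerSeries.eq_X_mul_shift_add_const c]
      rw [map_add, map_mul, ← Algebra.smul_def, PowerSeries.coeff_zero_eq_constantCoeff_apply]
    rw [hstep, e, one_mul, smul_sub, hc, coeff_scalar, hφ]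
    abel
  { toFun := fun f => hsum fun k => φ (coeff k f)
    map_one' := by simpa using hscal 1
    map_mul' := hmul
    map_zero' := by simpa using hscal 0
    map_add' := hadd
    commutes' := hscal }

theorem lift_C [HComplete A] (φ : B →+* A)
    (hφ : ∀ z, φ (algebraMap ℂ B z) = algebraMap Ch A (cst z)) (b : B) :
    lift φ hφ (C b) = φ b := by
  change hsum (fun k => φ (coeff k (C b))) = φ b
  refine (hsum_unique fun n => ?_).symm
  cases n with
  | zero => exact ⟨φ b, by simp⟩
  | succ n => exact ⟨0, by simp [coeff_C, Finset.sum_range_succ']⟩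

/-- Homomorphisms into a separated algebra are determined by their values on constants. -/
theorem algHom_ext [HSep A] {F G : HSeries B →ₐ[Ch] A} (H : ∀ b, F (C b) = G (C b)) : F = G := by
  refine AlgHom.ext fun f => HSep.eq_of_sub fun n => ?_
  obtain ⟨y, hy⟩ := eq_sum_add f n
  refine ⟨F y - G y, ?_⟩
  conv_lhs => rw [hy]
  simp only [map_add, map_sum, map_smul, H, smul_sub]
  abel

end Lift

end HSeries

/-! ## Scalar power series -/

/-- `(f - f(0)) / t`. -/
def shift (f : PowerSeries ℂ) : PowerSeries ℂ := PowerSeries.mk fun k => PowerSeries.coeff (k + 1) f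

theorem eq_C_add_X_mul_shift (f : PowerSeries ℂ) :
    f = PowerSeries.C (PowerSeries.coeff 0 f) + PowerSeries.X * shift f := by
  conv_lhs => rw [PowerSeries.eq_X_mul_shift_add_const f]
  rw [add_comm, PowerSeries.coeff_zero_eq_constantCoeff_apply]
  rfl

/-- The differential equation is the recursion `(n + 1) fₙ₊₁ = (1 - n) fₙ`, whose factor vanishes at
`n = 1` and ends the series there. Both `exp ∘ log` and the square of the binomial series are
recognized in this way. -/
theorem eq_one_add_X {f : PowerSeries ℂ} (h0 : PowerSeries.coeff 0 f = 1)
    (hf : (1 + PowerSeries.X) * PowerSeries.derivative ℂ f = f) : f = 1 + PowerSeries.X := by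
  have key (n : ℕ) : PowerSeries.coeff (n + 1) f * (n + 1) =
      (1 - n) * PowerSeries.coeff n f := by
    have e := congrArg (PowerSeries.coeff n) hf
    rw [add_mul, one_mul, map_add, PowerSeries.coeff_derivative] at e
    cases n with
    | zero => simpa using e
    | succ n =>
      rw [PowerSeries.coeff_succ_X_mul, PowerSeries.coeff_derivative] at e
      push_cast at e ⊢
      linear_combination e
  have h1 : PowerSeries.coeff 1 f = 1 := by simpa [h0] using key 0
  have h2 (n : ℕ) : PowerSeries.coeff (n + 2) f = 0 := by
    induction n with
    | zero => simpa using key 1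
    | succ n ih =>
      have e := key (n + 2)
      rw [ih, mul_zero] at e
      refine (mul_eq_zero.1 e).resolve_right ?_
      exact_mod_cast Nat.succ_ne_zero (n + 2)
  ext n
  match n with
  | 0 => simp [h0]
  | 1 => simp [h1, PowerSeries.coeff_one]
  | n + 2 => simp [h2, PowerSeries.coeff_one, PowerSeries.coeff_X]

theorem one_add_X_mul_derivative_log :
    (1 + PowerSeries.X) * PowerSeries.derivative ℂ (PowerSeries.log ℂ) = 1 := by
  rw [PowerSeries.deriv_log]
  ext n
  rw [add_mul, one_mul, map_add]
  cases n with
  | zero => simp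
  | succ n => simp [PowerSeries.coeff_one, pow_succ]

/-- By the chain rule, `(1 + X) (exp ∘ log)' = (exp ∘ log) · (1 + X) log' = exp ∘ log`, so
`eq_one_add_X` applies. -/
theorem exp_subst_log : (PowerSeries.exp ℂ).subst (PowerSeries.log ℂ) = 1 + PowerSeries.X := by
  have hs : PowerSeries.HasSubst (PowerSeries.log ℂ) := PowerSeries.HasSubst.log
  apply eq_one_add_X
  · conv_lhs => rw [eq_C_add_X_mul_shift (PowerSeries.exp ℂ)]
    rw [PowerSeries.subst_add hs, PowerSeries.subst_mul hs, PowerSeries.subst_X hs]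
    erw [PowerSeries.subst_C]
    rw [map_add, PowerSeries.coeff_mul]
    erw [PowerSeries.coeff_C]
    simp
  · rw [PowerSeries.derivative_subst hs, PowerSeries.derivative_exp, mul_left_comm,
      one_add_X_mul_derivative_log, mul_one]

/-- The recursion of the binomial coefficients says `(1 + X) s' = s / 2`; hence `(1 + X) (s²)' =
s²`. -/
theorem sqrtSeries_mul_self : sqrtSeries * sqrtSeries = 1 + PowerSeries.X := by
  have hc (n : ℕ) : PowerSeries.coeff (n + 1) sqrtSeries * (n + 1) =
      (1 / 2 - n) * PowerSeries.coeff n sqrtSeries := by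
    have h1 : (n.factorial : ℂ) ≠ 0 := by exact_mod_cast n.factorial_ne_zero
    have h2 : (n + 1 : ℂ) ≠ 0 := by exact_mod_cast n.succ_ne_zero
    simp only [sqrtSeries, PowerSeries.coeff_mk, Finset.prod_range_succ, Nat.factorial_succ]
    push_cast
    field_simp
  have hd : (1 + PowerSeries.X) * PowerSeries.derivative ℂ sqrtSeries =
      PowerSeries.C (1 / 2) * sqrtSeries := by
    ext n
    rw [add_mul, one_mul, map_add, PowerSeries.coeff_derivative, hc, PowerSeries.coeff_C_mul]
    cases n with
    | zero => simp
    | succ n =>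
      rw [PowerSeries.coeff_succ_X_mul, PowerSeries.coeff_derivative]
      push_cast
      ring
  apply eq_one_add_X
  · simp [sqrtSeries]
  · have h2 : (PowerSeries.C (1 / 2 : ℂ) + PowerSeries.C (1 / 2 : ℂ)) = 1 := by
      rw [← map_add]; norm_num
    rw [Derivation.leibniz, smul_eq_mul]
    linear_combination (2 * sqrtSeries) * hd + sqrtSeries * sqrtSeries * h2

theorem one_sub_X_mul_geomSeries : (1 - PowerSeries.X) * geomSeries = 1 := by
  ext n
  rw [sub_mul, one_mul, map_sub]
  cases n with
  | zero => simp [geomSeries]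
  | succ n => simp [geomSeries, PowerSeries.coeff_one, PowerSeries.coeff_succ_X_mul]

/-! ## Evaluation of scalar power series -/

namespace HSeries

variable {B : Type} [Ring B] [Algebra ℂ B] {a : HSeries B}

/-- One truncation `N` serves all coefficients up to `N`, which permits exchanging the sum over
powers with the sum in a Cauchy product. -/
theorem coeff_eval_of_le (f : PowerSeries ℂ) (ha : coeff 0 a = 0) {n N : ℕ} (hn : n ≤ N) :
    coeff n (eval f a) =
      ∑ k ∈ Finset.range (N + 1), PowerSeries.coeff k f • coeff n (a ^ k) := by
  rw [eval, coeff_mk]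
  refine Finset.sum_subset (Finset.range_mono (by omega)) fun k _ hk => ?_
  rw [coeff_pow_of_lt ha (by simpa using hk), smul_zero]

omit [Algebra ℂ B] in
theorem coeff_sum {ι : Type} (s : Finset ι) (F : ι → HSeries B) (n : ℕ) :
    coeff n (∑ i ∈ s, F i) = ∑ i ∈ s, coeff n (F i) :=
  map_sum (PowerSeries.coeff (R := B) n) F s

theorem eval_add (f g : PowerSeries ℂ) (a : HSeries B) :
    eval (f + g) a = eval f a + eval g a := by
  ext n
  simp only [eval, coeff_add, coeff_mk, map_add, add_smul, Finset.sum_add_distrib]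

theorem eval_C_mul (z : ℂ) (f : PowerSeries ℂ) (a : HSeries B) :
    eval (PowerSeries.C z * f) a = cst z • eval f a := by
  ext n
  simp only [eval, coeff_cst_smul, coeff_mk, PowerSeries.coeff_C_mul, mul_smul, Finset.smul_sum]

/-- The Horner step `f(a) = f₀ + a · ((f - f₀)/t)(a)`. As `a` is a multiple of `h`, it makes the
defect of an identity in `f` contract under `shift`, and `eq_zero_of_shift` concludes; the
functional calculus below rests on this. -/
theorem eval_step (f : PowerSeries ℂ) (ha : coeff 0 a = 0) :
    eval f a = cst (PowerSeries.coeff 0 f) • 1 + a * eval (shift f) a := by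
  ext n
  rw [coeff_eval_of_le f ha (Nat.le_succ n), coeff_add, coeff_cst_smul, Finset.sum_range_succ',
    add_comm, pow_zero, coeff_mul]
  congr 1
  have hr (p : ℕ × ℕ) (hp : p ∈ Finset.HasAntidiagonal.antidiagonal n) :
      coeff p.1 a * coeff p.2 (eval (shift f) a) = ∑ k ∈ Finset.range (n + 1),
        coeff p.1 a * (PowerSeries.coeff k (shift f) • coeff p.2 (a ^ k)) := by
    rw [Finset.HasAntidiagonal.mem_antidiagonal] at hp
    rw [coeff_eval_of_le (shift f) ha (show p.2 ≤ n by omega), Finset.mul_sum]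
  rw [Finset.sum_congr rfl hr]
  rw [Finset.sum_comm]
  refine Finset.sum_congr rfl fun k _ => ?_
  rw [pow_succ', coeff_mul, Finset.smul_sum]
  refine Finset.sum_congr rfl fun p _ => ?_
  rw [shift, PowerSeries.coeff_mk, mul_smul_comm]

theorem eval_C (z : ℂ) (ha : coeff 0 a = 0) : eval (PowerSeries.C z) a = cst z • 1 := by
  have e : shift (PowerSeries.C z) = 0 := by
    ext k; simp [shift]
  have e0 : eval 0 a = 0 := by ext n; simp [eval, coeff_zero]
  rw [eval_step _ ha, e, e0, mul_zero, add_zero]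
  simp

theorem eval_one (ha : coeff 0 a = 0) : eval 1 a = 1 := by
  rw [← map_one (PowerSeries.C (R := ℂ)), eval_C _ ha, cst, map_one, one_smul]

theorem eval_X (ha : coeff 0 a = 0) : eval PowerSeries.X a = a := by
  have e : shift PowerSeries.X = 1 := by
    ext k; simp [shift, PowerSeries.coeff_X, PowerSeries.coeff_one]
  rw [eval_step _ ha, e, eval_one ha]
  simp [cst]

/-- A family indexed by power series vanishes if it is compatible with removing the constant
term. -/
theorem eq_zero_of_shift {A : Type} [Ring A] [Algebra Ch A] [HSep A] {x : A} (hx : ∃ y, x = h • y)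
    (P : PowerSeries ℂ → A) (H : ∀ f, P f = x * P (shift f)) (f : PowerSeries ℂ) : P f = 0 := by
  obtain ⟨y, rfl⟩ := hx
  exact HSep.eq_zero_of_step P (fun f => ⟨shift f, y, by rw [H f, smul_mul_assoc]⟩) f

theorem exists_eq_h_smul (ha : coeff 0 a = 0) : ∃ y, a = h • y := ⟨_, eq_h_smul ha⟩

theorem commute_eval {b : HSeries B} (ha : coeff 0 a = 0) (hb : Commute b a)
    (f : PowerSeries ℂ) : Commute b (eval f a) := by
  refine sub_eq_zero.1 (eq_zero_of_shift (exists_eq_h_smul ha)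
    (fun f => b * eval f a - eval f a * b) (fun f => ?_) f)
  rw [eval_step f ha, mul_add, add_mul, smul_mul_assoc, mul_smul_comm, one_mul, mul_one,
    mul_sub, ← mul_assoc, hb.eq, mul_assoc, mul_assoc]
  abel

theorem eval_mul (f g : PowerSeries ℂ) (ha : coeff 0 a = 0) :
    eval (f * g) a = eval f a * eval g a := by
  refine sub_eq_zero.1 (eq_zero_of_shift (exists_eq_h_smul ha)
    (fun f => eval (f * g) a - eval f a * eval g a) (fun f => ?_) f)
  have hX (f : PowerSeries ℂ) : eval (PowerSeries.X * f) a = a * eval f a := by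
    rw [eval_step _ ha]
    have : shift (PowerSeries.X * f) = f := by
      ext k; simp [shift]
    rw [this]
    simp [cst]
  conv_lhs => rw [eq_C_add_X_mul_shift f]
  rw [add_mul, eval_add, eval_C_mul, mul_assoc, hX, eval_add, eval_C _ ha, hX, add_mul,
    smul_mul_assoc, one_mul, mul_assoc, mul_sub]
  abel

/-- Evaluation commutes with homomorphisms. -/
theorem map_eval {B' : Type} [Ring B'] [Algebra ℂ B'] (F : HSeries B →ₐ[Ch] HSeries B')
    (f : PowerSeries ℂ) (ha : coeff 0 a = 0) : F (eval f a) = eval f (F a) := by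
  have ha' : coeff 0 (F a) = 0 := by
    rw [eq_h_smul ha, map_smul, coeff_h_smul_zero]
  refine sub_eq_zero.1 (eq_zero_of_shift (exists_eq_h_smul ha')
    (fun f => F (eval f a) - eval f (F a)) (fun f => ?_) f)
  rw [eval_step f ha, eval_step f ha', map_add, map_smul, map_one, map_mul, mul_sub]
  abel

/-- A derivation acts on `f(a)` by the chain rule as soon as its value `y` on `a` commutes with `a`.
The defect contracts since `f' = shift f + X (shift f)'`. -/
theorem commutator_eval {b y : HSeries B} (ha : coeff 0 a = 0) (hb : b * a - a * b = y)
    (hy : Commute y a) (f : PowerSeries ℂ) :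
    b * eval f a - eval f a * b = y * eval (PowerSeries.derivative ℂ f) a := by
  refine sub_eq_zero.1 (eq_zero_of_shift (exists_eq_h_smul ha)
    (fun f => b * eval f a - eval f a * b - y * eval (PowerSeries.derivative ℂ f) a)
    (fun f => ?_) f)
  have hd : PowerSeries.derivative ℂ f =
      shift f + PowerSeries.X * PowerSeries.derivative ℂ (shift f) := by
    conv_lhs => rw [eq_C_add_X_mul_shift f]
    rw [map_add, PowerSeries.derivative_C, zero_add, Derivation.leibniz, PowerSeries.derivative_X,
      smul_eq_mul, smul_eq_mul, mul_one, add_comm]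
  have hb' : b * a = y + a * b := by rw [← hb]; abel
  rw [hd, eval_add, eval_mul _ _ ha, eval_X ha, eval_step f ha]
  simp only [mul_add, add_mul, mul_sub, smul_mul_assoc, mul_smul_comm, one_mul, mul_one]
  rw [← mul_assoc b, hb', add_mul, ← mul_assoc y a, hy.eq]
  simp only [mul_assoc]
  abel

theorem eval_subst (f : PowerSeries ℂ) {g : PowerSeries ℂ} (hg : PowerSeries.coeff 0 g = 0)
    (ha : coeff 0 a = 0) : eval f (eval g a) = eval (f.subst g) a := by
  have hs : PowerSeries.HasSubst g := PowerSeries.HasSubst.of_constantCoeff_zero' (by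
    rwa [← PowerSeries.coeff_zero_eq_constantCoeff_apply])
  have hga : coeff 0 (eval g a) = 0 := by rw [coeff_zero_eval, hg, zero_smul]
  refine sub_eq_zero.1 (eq_zero_of_shift (exists_eq_h_smul hga)
    (fun f => eval f (eval g a) - eval (f.subst g) a) (fun f => ?_) f)
  have e : f.subst g = PowerSeries.C (PowerSeries.coeff 0 f) + g * (shift f).subst g := by
    conv_lhs => rw [eq_C_add_X_mul_shift f]
    rw [PowerSeries.subst_add hs, PowerSeries.subst_mul hs, PowerSeries.subst_X hs]
    congr 1
    exact PowerSeries.subst_C _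
  rw [e, eval_step f hga, eval_add, eval_C _ ha, eval_mul _ _ ha, mul_sub]
  abel

/-! ### The exponential function -/

omit [Algebra ℂ B] in
theorem coeff_pow_mul_pow_of_lt {b : HSeries B} (ha : coeff 0 a = 0) (hb : coeff 0 b = 0)
    {n i j : ℕ} (hn : n < i + j) : coeff n (a ^ i * b ^ j) = 0 := by
  rw [coeff_mul]
  refine Finset.sum_eq_zero fun p hp => ?_
  rw [Finset.HasAntidiagonal.mem_antidiagonal] at hp
  rcases lt_or_ge p.1 i with hi | hi
  · rw [coeff_pow_of_lt ha hi, zero_mul]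
  · rw [coeff_pow_of_lt hb (by omega), mul_zero]

theorem eval_exp_add {b : HSeries B} (ha : coeff 0 a = 0) (hb : coeff 0 b = 0)
    (hab : Commute a b) : eval (PowerSeries.exp ℂ) (a + b) =
      eval (PowerSeries.exp ℂ) a * eval (PowerSeries.exp ℂ) b := by
  set e : ℕ → ℂ := fun k => PowerSeries.coeff k (PowerSeries.exp ℂ) with he
  have hfac (i j : ℕ) : e (i + j) * ((i + j).choose i : ℂ) = e i * e j := by
    have h1 : (i.factorial : ℂ) ≠ 0 := by exact_mod_cast i.factorial_ne_zero
    have h2 : (j.factorial : ℂ) ≠ 0 := by exact_mod_cast j.factorial_ne_zero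
    have h3 : ((i + j).factorial : ℂ) ≠ 0 := by exact_mod_cast (i + j).factorial_ne_zero
    have h4 : ((i + j).choose i : ℂ) * i.factorial * j.factorial = (i + j).factorial := by
      rw [Nat.choose_symm_add]
      exact_mod_cast Nat.add_choose_mul_factorial_mul_factorial i j
    simp only [he, PowerSeries.coeff_exp, map_div₀, map_one, map_natCast]
    field_simp
    linear_combination h4
  ext n
  have hsum : coeff 0 (a + b) = 0 := by rw [coeff_add, ha, hb, add_zero]
  have lhs : coeff n (eval (PowerSeries.exp ℂ) (a + b)) =
      ∑ k ∈ Finset.range (n + 1), ∑ p ∈ Finset.HasAntidiagonal.antidiagonal k,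
        (e p.1 * e p.2) • coeff n (a ^ p.1 * b ^ p.2) := by
    rw [coeff_eval_of_le _ hsum le_rfl]
    refine Finset.sum_congr rfl fun k _ => ?_
    rw [hab.add_pow', coeff_sum, Finset.smul_sum]
    refine Finset.sum_congr rfl fun p hp => ?_
    rw [Finset.HasAntidiagonal.mem_antidiagonal] at hp
    have hn (x : HSeries B) : coeff n ((p.1 + p.2).choose p.1 • x) =
        ((p.1 + p.2).choose p.1 : ℂ) • coeff n x := by
      rw [Nat.cast_smul_eq_nsmul]
      exact map_nsmul (PowerSeries.coeff (R := B) n) _ _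
    rw [← hp, ← hfac, mul_smul, hn]
  have rhs : coeff n (eval (PowerSeries.exp ℂ) a * eval (PowerSeries.exp ℂ) b) =
      ∑ p ∈ Finset.range (n + 1) ×ˢ Finset.range (n + 1),
        (e p.1 * e p.2) • coeff n (a ^ p.1 * b ^ p.2) := by
    have hr (q : ℕ × ℕ) (hq : q ∈ Finset.HasAntidiagonal.antidiagonal n) :
        coeff q.1 (eval (PowerSeries.exp ℂ) a) * coeff q.2 (eval (PowerSeries.exp ℂ) b) =
        ∑ p ∈ Finset.range (n + 1) ×ˢ Finset.range (n + 1),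
          (e p.1 * e p.2) • (coeff q.1 (a ^ p.1) * coeff q.2 (b ^ p.2)) := by
      rw [Finset.HasAntidiagonal.mem_antidiagonal] at hq
      rw [coeff_eval_of_le _ ha (show q.1 ≤ n by omega),
        coeff_eval_of_le _ hb (show q.2 ≤ n by omega), Finset.sum_mul_sum, ← Finset.sum_product']
      refine Finset.sum_congr rfl fun p _ => ?_
      rw [smul_mul_smul_comm]
    rw [coeff_mul, Finset.sum_congr rfl hr, Finset.sum_comm]
    refine Finset.sum_congr rfl fun p _ => ?_
    rw [coeff_mul, Finset.smul_sum]
  -- The left side runs over the triangle `p₁ + p₂ ≤ n`, the right side over a square. The terms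
  -- outside the triangle vanish, because `a ^ i * b ^ j` starts in degree `i + j`.
  rw [lhs, rhs, ← Finset.sum_filter_of_ne (p := fun p : ℕ × ℕ => p.1 + p.2 < n + 1)
    (s := Finset.range (n + 1) ×ˢ Finset.range (n + 1)) fun p _ hp => ?_,
    ← Finset.sum_fiberwise_of_maps_to (g := fun p : ℕ × ℕ => p.1 + p.2)
      (t := Finset.range (n + 1)) fun p hp => ?_]
  · refine Finset.sum_congr rfl fun k hk => Finset.sum_congr ?_ fun _ _ => rfl
    rw [Finset.mem_range] at hk
    ext p
    simp only [Finset.HasAntidiagonal.mem_antidiagonal, Finset.mem_filter, Finset.mem_product,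
      Finset.mem_range]
    omega
  · simpa using (Finset.mem_filter.1 hp).2
  · by_contra hlt
    exact hp (by rw [coeff_pow_mul_pow_of_lt ha hb (by omega), smul_zero])

theorem eval_exp_cst_smul_mul (c d : ℂ) (ha : coeff 0 a = 0) :
    eval (PowerSeries.exp ℂ) (cst c • a) * eval (PowerSeries.exp ℂ) (cst d • a) =
      eval (PowerSeries.exp ℂ) (cst (c + d) • a) := by
  have h0 (z : ℂ) : coeff 0 (cst z • a) = 0 := by rw [coeff_cst_smul, ha, smul_zero]
  rw [show cst (c + d) = cst c + cst d from map_add _ _ _, add_smul,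
    eval_exp_add (h0 c) (h0 d)]
  exact ((Commute.refl a).smul_left _).smul_right _

theorem eval_zero (f : PowerSeries ℂ) :
    eval f (0 : HSeries B) = cst (PowerSeries.coeff 0 f) • 1 := by
  rw [eval_step f (coeff_zero 0), zero_mul, add_zero]

theorem eval_exp_log (ha : coeff 0 a = 0) :
    eval (PowerSeries.exp ℂ) (eval (PowerSeries.log ℂ) a) = 1 + a := by
  rw [eval_subst _ (by simp) ha, exp_subst_log, eval_add, eval_one ha, eval_X ha]

/-- An element with nonzero scalar constant coefficient is not a zero divisor. -/
theorem eq_zero_of_mul_eq_zero {A : Type} [Ring A] [Algebra Ch A] [HSep A] {x u y : A} {z : ℂ}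
    (hz : z ≠ 0) (hu : u = cst z • 1 + h • y) (hxu : x * u = 0) : x = 0 := by
  -- From `x (z + h y) = 0` one solves `x = -z⁻¹ h x y`; iterating this puts `x` into every `hⁿ A`.
  have key : x = h • (x * (cst (-z⁻¹) • y)) := by
    have e : cst z • x = -(h • (x * y)) := by
      rw [hu, mul_add, mul_smul_comm, mul_one, mul_smul_comm] at hxu
      exact eq_neg_of_add_eq_zero_left hxu
    have e2 : x = cst z⁻¹ • (cst z • x) := by
      rw [smul_smul, ← map_mul, inv_mul_cancel₀ hz, map_one, one_smul]
    conv_lhs => rw [e2, e]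
    rw [mul_smul_comm, show cst (-z⁻¹) = -cst z⁻¹ from map_neg _ _, neg_smul, smul_neg, smul_neg,
      smul_comm]
  have step (n : ℕ) : ∃ w, x = h ^ n • (x * w) := by
    induction n with
    | zero => exact ⟨1, by simp⟩
    | succ n ih =>
      obtain ⟨w, hw⟩ := ih
      refine ⟨(cst (-z⁻¹) • y) * w, ?_⟩
      conv_lhs => rw [hw]
      conv_lhs => rw [key]
      rw [smul_mul_assoc, smul_smul, pow_succ, mul_assoc]
  refine HSep.eq_zero _ fun n => ?_
  obtain ⟨w, hw⟩ := step n
  exact ⟨_, hw⟩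

theorem eq_cst_smul_add {u : HSeries B} {z : ℂ} (hu : coeff 0 u = z • 1) :
    u = cst z • 1 + h • divH u := by
  conv_lhs => rw [eq_C_add_h_smul u, hu]
  congr 1
  ext n
  rw [coeff_cst_smul, coeff_C, coeff_one]
  split_ifs <;> simp

/-- For commuting `a` and `b` the hypothesis gives `exp (a - b) = 1`, that is `(a - b) · u = 0` with
`u = ((exp - 1)/t)(a - b)`. The constant coefficient of `u` is `1`, so `u` is not a zero divisor. -/
theorem eval_exp_injective {b : HSeries B} (ha : coeff 0 a = 0) (hb : coeff 0 b = 0)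
    (hab : Commute a b) (H : eval (PowerSeries.exp ℂ) a = eval (PowerSeries.exp ℂ) b) :
    a = b := by
  have hnb : coeff 0 (-b) = 0 := by rw [coeff_neg, hb, neg_zero]
  have h0 : coeff 0 (a + -b) = 0 := by rw [coeff_add, ha, hnb, add_zero]
  have e : eval (PowerSeries.exp ℂ) (a + -b) = 1 := by
    rw [eval_exp_add ha hnb hab.neg_right, H, ← eval_exp_add hb hnb
      ((Commute.refl b).neg_right), add_neg_cancel, eval_zero]
    simp
  rw [eval_step _ h0] at e
  have e' : (a + -b) * eval (shift (PowerSeries.exp ℂ)) (a + -b) = 0 := by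
    simpa [cst] using e
  have := eq_zero_of_mul_eq_zero one_ne_zero (eq_cst_smul_add (by
    rw [coeff_zero_eval]; simp [shift])) e'
  rwa [← sub_eq_add_neg, sub_eq_zero] at this

end HSeries

/-! ## Completeness of the algebras at hand -/

section

variable {A B : Type} [Ring A] [Algebra Ch A] [Ring B] [Algebra Ch B]

theorem mem_span_h_pow_smul_top {n : ℕ} {x : A} :
    x ∈ (Ideal.span {h} ^ n • ⊤ : Submodule Ch A) ↔ ∃ y, x = h ^ n • y := by
  rw [Ideal.span_singleton_pow, Submodule.ideal_span_singleton_smul,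
    Submodule.mem_smul_pointwise_iff_exists]
  exact ⟨fun ⟨y, _, hy⟩ => ⟨y, hy.symm⟩, fun ⟨y, hy⟩ => ⟨y, trivial, hy.symm⟩⟩

theorem HComplete.isAdicComplete (A : Type) [Ring A] [Algebra Ch A] [HComplete A] :
    IsAdicComplete (Ideal.span {h}) A where
  haus' x H := HSep.eq_zero x fun n => by
    have := H n
    rwa [SModEq.zero, mem_span_h_pow_smul_top] at this
  prec' f H := by
    have H' (m : ℕ) : ∃ y, f (m + 1) - f m = h ^ m • y := by
      have := (H (Nat.le_succ m)).symm
      rwa [SModEq.sub_mem, mem_span_h_pow_smul_top] at this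
    choose a ha using H'
    -- A Cauchy sequence is the sequence of partial sums of its differences, and `f (m + 1) - f m =
    -- hᵐ a m`.
    refine ⟨f 0 + hsum a, fun n => ?_⟩
    rw [SModEq.comm, SModEq.sub_mem, mem_span_h_pow_smul_top]
    obtain ⟨y, hy⟩ := hsum_spec a n
    refine ⟨y, ?_⟩
    have e : ∑ k ∈ Finset.range n, h ^ k • a k = f n - f 0 := by
      rw [← Finset.sum_range_sub]
      exact Finset.sum_congr rfl fun k _ => (ha k).symm
    rw [hy, e]
    abel

theorem HComplete.of_linearEquiv (e : A ≃ₗ[Ch] B) [HComplete A] : HComplete B where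
  eq_zero x H := by
    refine (LinearEquiv.map_eq_zero_iff e.symm).1 (HSep.eq_zero _ fun n => ?_)
    obtain ⟨y, rfl⟩ := H n
    exact ⟨e.symm y, map_smul _ _ _⟩
  exists_sum a := by
    refine ⟨e (hsum fun k => e.symm (a k)), fun n => ?_⟩
    obtain ⟨y, hy⟩ := hsum_spec (fun k => e.symm (a k)) n
    refine ⟨e y, ?_⟩
    rw [hy]
    simp only [map_add, map_sum, map_smul, LinearEquiv.apply_symm_apply]

/-- Needed for the antipode, which is constructed as a homomorphism into the opposite algebra. -/
instance [HComplete A] : HComplete Aᵐᵒᵖ := .of_linearEquiv (MulOpposite.opLinearEquiv Ch)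

instance : HSep Ch where
  eq_zero x H := by
    ext n
    obtain ⟨y, rfl⟩ := H (n + 1)
    rw [smul_eq_mul, PowerSeries.coeff_X_pow_mul']
    simp

/-- When `hⁿ` acts as zero, every series is a finite sum. In this way reductions modulo `hⁿ` and
their tensor products become admissible targets for the extension and uniqueness statements about
power series. -/
theorem HComplete.of_h_pow_smul {n : ℕ} (H : ∀ x : A, h ^ n • x = 0) : HComplete A where
  eq_zero x Hx := by
    obtain ⟨y, rfl⟩ := Hx n
    exact H y
  exists_sum a := by
    let t : ℕ → A := fun m => ∑ k ∈ Finset.range n, h ^ k • a (m + k)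
    refine ⟨t 0, sum_of_tails fun m => ?_⟩
    have e : t m = ∑ k ∈ Finset.range (n + 1), h ^ k • a (m + k) := by
      rw [Finset.sum_range_succ, H, add_zero]
    rw [e, Finset.sum_range_succ', add_comm, Finset.smul_sum]
    simp only [smul_smul, pow_succ', pow_zero, one_smul, add_zero, add_right_comm, add_assoc]

instance (n : ℕ) : HComplete (Red A n) := .of_h_pow_smul (h_pow_smul_red A n)

instance (n : ℕ) : HComplete (Red A n ⊗[Ch] Red B n) := .of_h_pow_smul (h_pow_smul_tensor A B n)

theorem CTensor.ext {x y : CTensor A B} (H : ∀ n, CTensor.level n x = CTensor.level n y) :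
    x = y :=
  Subtype.ext (funext H)

theorem CTensor.map_redStep_level (n : ℕ) (x : CTensor A B) :
    Algebra.TensorProduct.map (redStep A n) (redStep B n) (CTensor.level (n + 1) x) =
      CTensor.level n x :=
  x.2 n

instance : HComplete (CTensor A B) where
  eq_zero x H := CTensor.ext fun n => by
    obtain ⟨y, rfl⟩ := H n
    rw [map_smul, h_pow_smul_tensor, map_zero]
  exists_sum a := by
    -- At level `n` only the terms with `k < n` survive. In passing from level `n + 1` to level `n`
    -- the extra term `k = n` is killed by `hⁿ`, so the truncated sums are compatible.
    let t : ℕ → CTensor A B := fun m =>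
      ⟨fun n => ∑ k ∈ Finset.range n, h ^ k • CTensor.level n (a (m + k)), fun n => by
        simp only [map_sum, map_smul, CTensor.map_redStep_level]
        rw [Finset.sum_range_succ, h_pow_smul_tensor, add_zero]⟩
    have ht (m n : ℕ) : CTensor.level n (t m) =
      ∑ k ∈ Finset.range n, h ^ k • CTensor.level n (a (m + k)) := rfl
    refine ⟨t 0, sum_of_tails fun m => CTensor.ext fun n => ?_⟩
    have e : CTensor.level n (t m) =
        ∑ k ∈ Finset.range (n + 1), h ^ k • CTensor.level n (a (m + k)) := by
      rw [Finset.sum_range_succ, h_pow_smul_tensor, add_zero, ht]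
    rw [e, Finset.sum_range_succ', add_comm, map_add, map_smul, ht, Finset.smul_sum]
    simp only [smul_smul, pow_succ', pow_zero, one_smul, add_zero, add_right_comm, add_assoc]

/-! ## The completed tensor product -/

/-- `a ↦ a ⊗ 1`. -/
def CTensor.inl : A →ₐ[Ch] CTensor A B where
  toFun a := ctmul a 1
  map_one' := rfl
  map_mul' a b := CTensor.ext fun n => by
    change red A n (a * b) ⊗ₜ[Ch] red B n 1 =
      (red A n a ⊗ₜ[Ch] red B n 1) * (red A n b ⊗ₜ[Ch] red B n 1)
    rw [Algebra.TensorProduct.tmul_mul_tmul, map_mul, map_one, mul_one]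
  map_zero' := CTensor.ext fun n => by
    change red A n 0 ⊗ₜ[Ch] red B n 1 = 0
    rw [map_zero, TensorProduct.zero_tmul]
  map_add' a b := CTensor.ext fun n => by
    change red A n (a + b) ⊗ₜ[Ch] red B n 1 = red A n a ⊗ₜ[Ch] red B n 1 + red A n b ⊗ₜ[Ch] red B n 1
    rw [map_add, TensorProduct.add_tmul]
  commutes' c := CTensor.ext fun n => by
    change red A n (algebraMap Ch A c) ⊗ₜ[Ch] red B n 1 = CTensor.level n (algebraMap Ch _ c)
    rw [AlgHom.commutes, AlgHom.commutes, map_one]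
    rfl

/-- `b ↦ 1 ⊗ b`. -/
def CTensor.inr : B →ₐ[Ch] CTensor A B where
  toFun b := ctmul 1 b
  map_one' := rfl
  map_mul' a b := CTensor.ext fun n => by
    change red A n 1 ⊗ₜ[Ch] red B n (a * b) =
      (red A n 1 ⊗ₜ[Ch] red B n a) * (red A n 1 ⊗ₜ[Ch] red B n b)
    rw [Algebra.TensorProduct.tmul_mul_tmul, map_mul, map_one, mul_one]
  map_zero' := CTensor.ext fun n => by
    change red A n 1 ⊗ₜ[Ch] red B n 0 = 0
    rw [map_zero, TensorProduct.tmul_zero]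
  map_add' a b := CTensor.ext fun n => by
    change red A n 1 ⊗ₜ[Ch] red B n (a + b) = red A n 1 ⊗ₜ[Ch] red B n a + red A n 1 ⊗ₜ[Ch] red B n b
    rw [map_add, TensorProduct.tmul_add]
  commutes' c := CTensor.ext fun n => by
    change red A n 1 ⊗ₜ[Ch] red B n (algebraMap Ch B c) = CTensor.level n (algebraMap Ch _ c)
    rw [AlgHom.commutes, AlgHom.commutes, map_one, Algebra.algebraMap_eq_smul_one,
      TensorProduct.tmul_smul, ← Algebra.TensorProduct.one_def, Algebra.algebraMap_eq_smul_one]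

theorem CTensor.inl_apply (a : A) : (CTensor.inl a : CTensor A B) = ctmul a 1 := rfl

theorem CTensor.inr_apply (b : B) : (CTensor.inr b : CTensor A B) = ctmul 1 b := rfl

theorem CTensor.inl_mul_inr (a : A) (b : B) :
    (CTensor.inl a * CTensor.inr b : CTensor A B) = ctmul a b := CTensor.ext fun n => by
  change (red A n a ⊗ₜ[Ch] red B n 1) * (red A n 1 ⊗ₜ[Ch] red B n b) =
    red A n a ⊗ₜ[Ch] red B n b
  rw [Algebra.TensorProduct.tmul_mul_tmul, map_one, map_one, one_mul, mul_one]

theorem CTensor.inr_mul_inl (a : A) (b : B) :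
    (CTensor.inr b * CTensor.inl a : CTensor A B) = ctmul a b := CTensor.ext fun n => by
  change (red A n 1 ⊗ₜ[Ch] red B n b) * (red A n a ⊗ₜ[Ch] red B n 1) =
    red A n a ⊗ₜ[Ch] red B n b
  rw [Algebra.TensorProduct.tmul_mul_tmul, map_one, map_one, one_mul, mul_one]

theorem CTensor.level_ctmul (n : ℕ) (a : A) (b : B) :
    CTensor.level n (ctmul a b) = red A n a ⊗ₜ[Ch] red B n b := rfl

theorem redComul_red (Δ : A →ₐ[Ch] CTensor A A) (n : ℕ) (a : A) :
    redComul Δ n (red A n a) = CTensor.level n (Δ a) := rfl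

/-- The homomorphism `A / hⁿ A → B / hⁿ B` induced by an algebra homomorphism. -/
def redHom (f : A →ₐ[Ch] B) (n : ℕ) : Red A n →ₐ[Ch] Red B n :=
  AlgHom.ofLinearMap (redLin f.toLinearMap n) (by
    change red B n (f 1) = 1
    rw [map_one, map_one]) fun x y => by
    obtain ⟨a, rfl⟩ := Ideal.Quotient.mk_surjective x
    obtain ⟨b, rfl⟩ := Ideal.Quotient.mk_surjective y
    change red B n (f (a * b)) = red B n (f a) * red B n (f b)
    rw [map_mul, map_mul]

theorem redHom_red (f : A →ₐ[Ch] B) (n : ℕ) (a : A) :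
    redHom f n (red A n a) = red B n (f a) := rfl

theorem CTensor.level_map (f : A →ₐ[Ch] B) (n : ℕ) (x : CTensor A A) :
    CTensor.level n (CTensor.map f x) =
      Algebra.TensorProduct.map (redHom f n) (redHom f n) (CTensor.level n x) := rfl

theorem CTensor.map_ctmul (f : A →ₐ[Ch] B) (a b : A) :
    CTensor.map f (ctmul a b) = ctmul (f a) (f b) := rfl

/-- `CTensor.map f`, as an algebra homomorphism. -/
def CTensor.mapHom (f : A →ₐ[Ch] B) : CTensor A A →ₐ[Ch] CTensor B B :=
  AlgHom.ofLinearMap (CTensor.map f) (CTensor.ext fun n => by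
      rw [CTensor.level_map, map_one, map_one, map_one])
    fun x y => CTensor.ext fun n => by
      simp only [CTensor.level_map, map_mul]

theorem CTensor.mapHom_apply (f : A →ₐ[Ch] B) (x : CTensor A A) :
    CTensor.mapHom f x = CTensor.map f x := rfl

end

/-! ## Topological Hopf algebras -/

section

variable {A B : Type} [Ring A] [Algebra Ch A] [Ring B] [Algebra Ch B]

theorem red_surjective (n : ℕ) : Function.Surjective (red A n) := Ideal.Quotient.mk_surjective

/-- The reduction of `a ↦ ε(a) 1`. -/
def HopfStructure.unitCounit (H : HopfStructure A) (n : ℕ) : Red A n →ₗ[Ch] Red A n :=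
  (redHom (Algebra.ofId Ch A) n).toLinearMap ∘ₗ redLin H.counit.toLinearMap n

theorem HopfStructure.unitCounit_red (H : HopfStructure A) (n : ℕ) (a : A) :
    H.unitCounit n (red A n a) = algebraMap Ch (Red A n) (H.counit a) := rfl

/-- `a ↦ ε(a) 1` is a left unit for convolution modulo `hⁿ`. -/
theorem HopfStructure.mul_unitCounit_left (H : HopfStructure A) (n : ℕ)
    (S : Red A n →ₗ[Ch] Red A n) (a : A) :
    LinearMap.mul' Ch (Red A n) (TensorProduct.map (H.unitCounit n) S
      (CTensor.level n (H.comul a))) = S (red A n a) := by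
  have e (t : Red A n ⊗[Ch] Red A n) : TensorProduct.map (H.unitCounit n) S t =
      TensorProduct.map (redHom (Algebra.ofId Ch A) n).toLinearMap S
        ((redLin H.counit.toLinearMap n).rTensor (Red A n) t) := by
    induction t with
    | zero => simp only [map_zero]
    | add x y hx hy => simp only [map_add, hx, hy]
    | tmul x y => rfl
  rw [e, H.counit_comul, TensorProduct.map_tmul, LinearMap.mul'_apply, AlgHom.toLinearMap_apply,
    map_one, one_mul]

theorem HopfStructure.mul_unitCounit_right (H : HopfStructure A) (n : ℕ)
    (S : Red A n →ₗ[Ch] Red A n) (a : A) :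
    LinearMap.mul' Ch (Red A n) (TensorProduct.map S (H.unitCounit n)
      (CTensor.level n (H.comul a))) = S (red A n a) := by
  have e (t : Red A n ⊗[Ch] Red A n) : TensorProduct.map S (H.unitCounit n) t =
      TensorProduct.map S (redHom (Algebra.ofId Ch A) n).toLinearMap
        ((redLin H.counit.toLinearMap n).lTensor (Red A n) t) := by
    induction t with
    | zero => simp only [map_zero]
    | add x y hx hy => simp only [map_add, hx, hy]
    | tmul x y => rfl
  rw [e, H.comul_counit, TensorProduct.map_tmul, LinearMap.mul'_apply, AlgHom.toLinearMap_apply,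
    map_one, mul_one]

/-- A topological Hopf algebra structure is determined by its coproduct and counit. -/
theorem HopfStructure.ext_of_comul {H K : HopfStructure A} (hΔ : H.comul = K.comul)
    (hε : H.counit = K.counit) : H = K := by
  have hS : H.antipode = K.antipode := by
    have hA := H.complete
    refine LinearMap.ext fun a => sub_eq_zero.1 (hA.haus' _ fun n => ?_)
    rw [SModEq.zero, mem_span_h_pow_smul_top, ← mem_hIdeal, ← Ideal.Quotient.eq]
    change redLin H.antipode n (red A n a) = redLin K.antipode n (red A n a)
    -- In the convolution product modulo `hⁿ`, with unit `ε`: `S = S * ε = S * (id * T) = (S * id) *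
    -- T = ε * T = T`. Here `hS` and `hT` are the two inverse laws, and `e1`, `e2` expand both ends
    -- so that they differ only by coassociativity.
    set S := redLin H.antipode n
    set T := redLin K.antipode n
    have hS : LinearMap.mul' Ch (Red A n) ∘ₗ S.rTensor (Red A n) ∘ₗ
        (redComul H.comul n).toLinearMap = H.unitCounit n := by
      refine LinearMap.ext fun x => ?_
      obtain ⟨a, rfl⟩ := red_surjective n x
      exact H.antipode_left n a
    have hT : LinearMap.mul' Ch (Red A n) ∘ₗ T.lTensor (Red A n) ∘ₗ
        (redComul H.comul n).toLinearMap = H.unitCounit n := by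
      refine LinearMap.ext fun x => ?_
      obtain ⟨a, rfl⟩ := red_surjective n x
      rw [hΔ]
      exact (K.antipode_right n a).trans (by rw [H.unitCounit_red, hε])
    set D := redComul H.comul n
    have e1 (t : Red A n ⊗[Ch] Red A n) :
        LinearMap.mul' Ch (Red A n) (TensorProduct.map (H.unitCounit n) T t) =
        LinearMap.mul' Ch (Red A n) (TensorProduct.map S (LinearMap.mul' Ch (Red A n) ∘ₗ
          T.lTensor (Red A n)) (TensorProduct.assoc Ch (Red A n) (Red A n) (Red A n)
            (D.toLinearMap.rTensor (Red A n) t))) := by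
      rw [← hS]
      induction t with
      | zero => simp only [map_zero]
      | add x y hx hy => simp only [map_add, hx, hy]
      | tmul x y =>
        rw [TensorProduct.map_tmul, LinearMap.rTensor_tmul, LinearMap.comp_apply,
          LinearMap.comp_apply]
        generalize D.toLinearMap x = s
        induction s with
        | zero => simp only [map_zero, TensorProduct.zero_tmul]
        | add x y hx hy => simp only [map_add, TensorProduct.add_tmul, hx, hy]
        | tmul x y => simp [mul_assoc]
    have e2 (t : Red A n ⊗[Ch] Red A n) :
        LinearMap.mul' Ch (Red A n) (TensorProduct.map S (H.unitCounit n) t) =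
        LinearMap.mul' Ch (Red A n) (TensorProduct.map S (LinearMap.mul' Ch (Red A n) ∘ₗ
          T.lTensor (Red A n)) (D.toLinearMap.lTensor (Red A n) t)) := by
      rw [← hT]
      induction t with
      | zero => simp only [map_zero]
      | add x y hx hy => simp only [map_add, hx, hy]
      | tmul x y => rfl
    have hco := LinearMap.congr_fun (H.coassoc n) (red A n a)
    simp only [LinearMap.comp_apply, LinearEquiv.coe_coe] at hco
    rw [← H.mul_unitCounit_right n S a, ← H.mul_unitCounit_left n T a, e1, e2]
    exact congrArg _ (congrArg _ hco.symm)
  cases H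
  cases K
  simp_all

/-! ### Transport along an isomorphism -/

theorem redHom_symm_redHom (Φ : A ≃ₐ[Ch] B) (n : ℕ) (x : Red A n) :
    redHom (Φ.symm : B →ₐ[Ch] A) n (redHom (Φ : A →ₐ[Ch] B) n x) = x := by
  obtain ⟨a, rfl⟩ := red_surjective n x
  rw [redHom_red, redHom_red]
  simp

theorem redHom_redHom_symm (Φ : A ≃ₐ[Ch] B) (n : ℕ) (x : Red B n) :
    redHom (Φ : A →ₐ[Ch] B) n (redHom (Φ.symm : B →ₐ[Ch] A) n x) = x := by
  obtain ⟨a, rfl⟩ := red_surjective n x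
  rw [redHom_red, redHom_red]
  simp

/-- The structure on `A` that corresponds to one on `B` under an isomorphism `A ≃ B`. -/
def HopfStructure.transport (H : HopfStructure B) (Φ : A ≃ₐ[Ch] B)
    (hA : IsAdicComplete (Ideal.span {h}) A) : HopfStructure A where
  complete := hA
  comul := (CTensor.mapHom (Φ.symm : B →ₐ[Ch] A)).comp (H.comul.comp (Φ : A →ₐ[Ch] B))
  counit := H.counit.comp (Φ : A →ₐ[Ch] B)
  antipode := Φ.symm.toLinearMap ∘ₗ H.antipode ∘ₗ Φ.toLinearMap
  coassoc n := by
    set D := redComul H.comul n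
    set f := redHom (Φ.symm : B →ₐ[Ch] A) n with hf
    set D' := redComul ((CTensor.mapHom (Φ.symm : B →ₐ[Ch] A)).comp
      (H.comul.comp (Φ : A →ₐ[Ch] B))) n
    -- The reduction `f` of `Φ⁻¹` intertwines the two coproducts. Each axiom is carried over by
    -- checking on pure tensors that its operations commute with `f`.
    have hD (x : Red B n) : D' (f x) = Algebra.TensorProduct.map f f (D x) := by
      obtain ⟨b, rfl⟩ := red_surjective n x
      rw [hf, redHom_red, redComul_red, redComul_red]
      simp only [AlgHom.comp_apply, CTensor.mapHom_apply, CTensor.level_map]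
      simp
    have e1 (t : Red B n ⊗[Ch] Red B n) :
        TensorProduct.assoc Ch (Red A n) (Red A n) (Red A n)
          (D'.toLinearMap.rTensor (Red A n) (Algebra.TensorProduct.map f f t)) =
        Algebra.TensorProduct.map f (Algebra.TensorProduct.map f f)
          (TensorProduct.assoc Ch (Red B n) (Red B n) (Red B n)
            (D.toLinearMap.rTensor (Red B n) t)) := by
      induction t with
      | zero => simp only [map_zero]
      | add x y hx hy => simp only [map_add, hx, hy]
      | tmul x y =>
        rw [Algebra.TensorProduct.map_tmul, LinearMap.rTensor_tmul, LinearMap.rTensor_tmul,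
          AlgHom.toLinearMap_apply, AlgHom.toLinearMap_apply, hD]
        generalize D x = s
        induction s with
        | zero => simp only [map_zero, TensorProduct.zero_tmul]
        | add x y hx hy => simp only [map_add, TensorProduct.add_tmul, hx, hy]
        | tmul x y => rfl
    have e2 (t : Red B n ⊗[Ch] Red B n) :
        D'.toLinearMap.lTensor (Red A n) (Algebra.TensorProduct.map f f t) =
        Algebra.TensorProduct.map f (Algebra.TensorProduct.map f f)
          (D.toLinearMap.lTensor (Red B n) t) := by
      induction t with
      | zero => simp only [map_zero]
      | add x y hx hy => simp only [map_add, hx, hy]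
      | tmul x y =>
        rw [Algebra.TensorProduct.map_tmul, LinearMap.lTensor_tmul, LinearMap.lTensor_tmul,
          AlgHom.toLinearMap_apply, AlgHom.toLinearMap_apply, hD]
        rfl
    refine LinearMap.ext fun x => ?_
    obtain ⟨y, rfl⟩ : ∃ y, f y = x := ⟨_, redHom_symm_redHom Φ n x⟩
    have := LinearMap.congr_fun (H.coassoc n) y
    simp only [LinearMap.comp_apply, AlgHom.toLinearMap_apply, LinearEquiv.coe_coe] at this ⊢
    rw [hD, e1, e2, this]
  counit_comul n a := by
    have e (t : Red B n ⊗[Ch] Red B n) :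
        (redLin (H.counit.comp (Φ : A →ₐ[Ch] B)).toLinearMap n).rTensor (Red A n)
          (Algebra.TensorProduct.map (redHom (Φ.symm : B →ₐ[Ch] A) n)
            (redHom (Φ.symm : B →ₐ[Ch] A) n) t) =
        (redHom (Φ.symm : B →ₐ[Ch] A) n).toLinearMap.lTensor (Red Ch n)
          ((redLin H.counit.toLinearMap n).rTensor (Red B n) t) := by
      induction t with
      | zero => simp only [map_zero]
      | add x y hx hy => simp only [map_add, hx, hy]
      | tmul x y =>
        obtain ⟨b, rfl⟩ := red_surjective n x
        rw [Algebra.TensorProduct.map_tmul, LinearMap.rTensor_tmul, redHom_red, redLin_red]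
        simp only [AlgHom.toLinearMap_apply, LinearMap.rTensor_tmul, LinearMap.lTensor_tmul]
        simp
        rfl
    simp only [AlgHom.comp_apply, CTensor.mapHom_apply, CTensor.level_map]
    rw [e, H.counit_comul, LinearMap.lTensor_tmul, AlgHom.toLinearMap_apply, redHom_red]
    simp
  comul_counit n a := by
    have e (t : Red B n ⊗[Ch] Red B n) :
        (redLin (H.counit.comp (Φ : A →ₐ[Ch] B)).toLinearMap n).lTensor (Red A n)
          (Algebra.TensorProduct.map (redHom (Φ.symm : B →ₐ[Ch] A) n)
            (redHom (Φ.symm : B →ₐ[Ch] A) n) t) =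
        (redHom (Φ.symm : B →ₐ[Ch] A) n).toLinearMap.rTensor (Red Ch n)
          ((redLin H.counit.toLinearMap n).lTensor (Red B n) t) := by
      induction t with
      | zero => simp only [map_zero]
      | add x y hx hy => simp only [map_add, hx, hy]
      | tmul x y =>
        obtain ⟨b, rfl⟩ := red_surjective n y
        rw [Algebra.TensorProduct.map_tmul, LinearMap.lTensor_tmul, redHom_red, redLin_red]
        simp only [AlgHom.toLinearMap_apply, LinearMap.rTensor_tmul, LinearMap.lTensor_tmul]
        simp
        rfl
    simp only [AlgHom.comp_apply, CTensor.mapHom_apply, CTensor.level_map]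
    rw [e, H.comul_counit, LinearMap.rTensor_tmul, AlgHom.toLinearMap_apply, redHom_red]
    simp
  antipode_left n a := by
    have e (t : Red B n ⊗[Ch] Red B n) :
        LinearMap.mul' Ch (Red A n)
          ((redLin (Φ.symm.toLinearMap ∘ₗ H.antipode ∘ₗ Φ.toLinearMap) n).rTensor (Red A n)
          (Algebra.TensorProduct.map (redHom (Φ.symm : B →ₐ[Ch] A) n)
            (redHom (Φ.symm : B →ₐ[Ch] A) n) t)) =
        redHom (Φ.symm : B →ₐ[Ch] A) n (LinearMap.mul' Ch (Red B n)
          ((redLin H.antipode n).rTensor (Red B n) t)) := by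
      induction t with
      | zero => simp only [map_zero]
      | add x y hx hy => simp only [map_add, hx, hy]
      | tmul x y =>
        obtain ⟨b, rfl⟩ := red_surjective n x
        rw [Algebra.TensorProduct.map_tmul, LinearMap.rTensor_tmul, LinearMap.rTensor_tmul,
          LinearMap.mul'_apply, LinearMap.mul'_apply, map_mul, redHom_red, redLin_red, redLin_red,
          redHom_red]
        simp
    simp only [AlgHom.comp_apply, CTensor.mapHom_apply, CTensor.level_map]
    rw [e, H.antipode_left, AlgHom.commutes]
  antipode_right n a := by
    have e (t : Red B n ⊗[Ch] Red B n) :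
        LinearMap.mul' Ch (Red A n)
          ((redLin (Φ.symm.toLinearMap ∘ₗ H.antipode ∘ₗ Φ.toLinearMap) n).lTensor (Red A n)
          (Algebra.TensorProduct.map (redHom (Φ.symm : B →ₐ[Ch] A) n)
            (redHom (Φ.symm : B →ₐ[Ch] A) n) t)) =
        redHom (Φ.symm : B →ₐ[Ch] A) n (LinearMap.mul' Ch (Red B n)
          ((redLin H.antipode n).lTensor (Red B n) t)) := by
      induction t with
      | zero => simp only [map_zero]
      | add x y hx hy => simp only [map_add, hx, hy]
      | tmul x y =>
        obtain ⟨b, rfl⟩ := red_surjective n y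
        rw [Algebra.TensorProduct.map_tmul, LinearMap.lTensor_tmul, LinearMap.lTensor_tmul,
          LinearMap.mul'_apply, LinearMap.mul'_apply, map_mul, redHom_red, redLin_red, redLin_red,
          redHom_red]
        simp
    simp only [AlgHom.comp_apply, CTensor.mapHom_apply, CTensor.level_map]
    rw [e, H.antipode_right, AlgHom.commutes]

theorem HopfStructure.isHopfIso_transport (H : HopfStructure B) (Φ : A ≃ₐ[Ch] B)
    (hA : IsAdicComplete (Ideal.span {h}) A) : IsHopfIso (H.transport Φ hA) H Φ where
  comul a := CTensor.ext fun n => by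
    change _ = CTensor.level n (CTensor.map (Φ : A →ₐ[Ch] B)
      (CTensor.map (Φ.symm : B →ₐ[Ch] A) (H.comul (Φ a))))
    rw [CTensor.level_map, CTensor.level_map]
    generalize CTensor.level n (H.comul (Φ a)) = t
    induction t with
    | zero => simp only [map_zero]
    | add x y hx hy => rw [map_add, map_add, ← hx, ← hy]
    | tmul x y =>
      rw [Algebra.TensorProduct.map_tmul, Algebra.TensorProduct.map_tmul, redHom_redHom_symm,
        redHom_redHom_symm]
  counit a := rfl
  antipode a := (Φ.apply_symm_apply _).symm

end

/-! ## Representations of the Poincaré algebra -/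

/-- The relations of `io(1,3)` for `M = i m`, `N = i n`, `P`, `P₀`; indices are modulo `3`. -/
structure IsPoincare {A : Type} [Ring A] (m n p : Fin 3 → A) (p0 : A) : Prop where
  m_m : ∀ i, m i * m (i + 1) - m (i + 1) * m i = m (i + 2)
  m_n : ∀ i, m i * n i = n i * m i
  m_n_one : ∀ i, m i * n (i + 1) - n (i + 1) * m i = n (i + 2)
  m_n_two : ∀ i, m i * n (i + 2) - n (i + 2) * m i = -n (i + 1)
  n_n : ∀ i, n i * n (i + 1) - n (i + 1) * n i = -m (i + 2)
  m_p : ∀ i, m i * p i = p i * m i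
  m_p_one : ∀ i, m i * p (i + 1) - p (i + 1) * m i = p (i + 2)
  m_p_two : ∀ i, m i * p (i + 2) - p (i + 2) * m i = -p (i + 1)
  m_p0 : ∀ i, m i * p0 = p0 * m i
  n_p : ∀ i, n i * p i - p i * n i = -p0
  n_p_one : ∀ i, n i * p (i + 1) = p (i + 1) * n i
  n_p_two : ∀ i, n i * p (i + 2) = p (i + 2) * n i
  n_p0 : ∀ i, n i * p0 - p0 * n i = -p i
  p_p : ∀ i, p i * p (i + 1) = p (i + 1) * p i
  p_p0 : ∀ i, p i * p0 = p0 * p i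

theorem swap_of_sub {A : Type} [Ring A] {a b c : A} (H : a * b - b * a = c) :
    b * a = a * b - c := by
  rw [← H]
  abel

namespace IsPoincare

variable {R A : Type} [CommRing R] [Ring A] [Algebra R A] {m n p : Fin 3 → A} {p0 : A}

/-- The linear map `io(1,3) → A`, for an algebra `A` over a ring that contains `ℂ`. -/
def toFun (φ : ℂ →+* R) (m n p : Fin 3 → A) (p0 : A) (x : Poincare) : A :=
  ∑ i, φ (Complex.I * x.m i) • m i + ∑ i, φ (Complex.I * x.n i) • n i +
    φ x.p0 • p0 + ∑ i, φ (x.p i) • p i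

theorem toFun_add (φ : ℂ →+* R) (m n p : Fin 3 → A) (p0 : A) (x y : Poincare) :
    toFun φ m n p p0 (x + y) = toFun φ m n p p0 x + toFun φ m n p p0 y := by
  simp only [toFun, Poincare.add_def, Pi.add_apply, mul_add, map_add, add_smul,
    Finset.sum_add_distrib]
  abel

theorem toFun_smul (φ : ℂ →+* R) (m n p : Fin 3 → A) (p0 : A) (c : ℂ) (x : Poincare) :
    toFun φ m n p p0 (c • x) = φ c • toFun φ m n p p0 x := by
  simp only [toFun, Poincare.smul_def, Pi.smul_apply, smul_eq_mul, map_mul, smul_add,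
    Finset.smul_sum, smul_smul]
  congr 4
  all_goals
    ext i
    congr 1
    ring

-- Both sides are bilinear, so only products of two generators occur. The rules `r0`, …, `r44` put
-- them into the order `m`, `n`, `p0`, `p`, with increasing indices in each block; the coefficients
-- of the ordered monomials then agree.
set_option maxHeartbeats 1600000 in
theorem toFun_lie (φ : ℂ →+* R) (H : IsPoincare m n p p0) (x y : Poincare) :
    toFun φ m n p p0 ⁅x, y⁆ =
      toFun φ m n p p0 x * toFun φ m n p p0 y - toFun φ m n p p0 y * toFun φ m n p p0 x := by
  have r0 : m 1 * m 0 = m 0 * m 1 - m 2 := swap_of_sub (H.m_m 0)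
  have r1 : n 1 * n 0 = n 0 * n 1 - -m 2 := swap_of_sub (H.n_n 0)
  have r2 : n 0 * m 0 = m 0 * n 0 := (H.m_n 0).symm
  have r3 : n 1 * m 0 = m 0 * n 1 - n 2 := swap_of_sub (H.m_n_one 0)
  have r4 : n 2 * m 0 = m 0 * n 2 - -n 1 := swap_of_sub (H.m_n_two 0)
  have r5 : p 0 * m 0 = m 0 * p 0 := (H.m_p 0).symm
  have r6 : p 1 * m 0 = m 0 * p 1 - p 2 := swap_of_sub (H.m_p_one 0)
  have r7 : p 2 * m 0 = m 0 * p 2 - -p 1 := swap_of_sub (H.m_p_two 0)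
  have r8 : p0 * m 0 = m 0 * p0 := (H.m_p0 0).symm
  have r9 : p0 * n 0 = n 0 * p0 - -p 0 := swap_of_sub (H.n_p0 0)
  have r10 : p 0 * n 0 = n 0 * p 0 - -p0 := swap_of_sub (H.n_p 0)
  have r11 : p 1 * n 0 = n 0 * p 1 := (H.n_p_one 0).symm
  have r12 : p 2 * n 0 = n 0 * p 2 := (H.n_p_two 0).symm
  have r13 : p 0 * p0 = p0 * p 0 := H.p_p0 0
  have r14 : p 1 * p 0 = p 0 * p 1 := (H.p_p 0).symm
  have r15 : m 2 * m 1 = m 1 * m 2 - m 0 := swap_of_sub (H.m_m 1)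
  have r16 : n 2 * n 1 = n 1 * n 2 - -m 0 := swap_of_sub (H.n_n 1)
  have r17 : n 1 * m 1 = m 1 * n 1 := (H.m_n 1).symm
  have r18 : n 2 * m 1 = m 1 * n 2 - n 0 := swap_of_sub (H.m_n_one 1)
  have r19 : n 0 * m 1 = m 1 * n 0 - -n 2 := swap_of_sub (H.m_n_two 1)
  have r20 : p 1 * m 1 = m 1 * p 1 := (H.m_p 1).symm
  have r21 : p 2 * m 1 = m 1 * p 2 - p 0 := swap_of_sub (H.m_p_one 1)
  have r22 : p 0 * m 1 = m 1 * p 0 - -p 2 := swap_of_sub (H.m_p_two 1)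
  have r23 : p0 * m 1 = m 1 * p0 := (H.m_p0 1).symm
  have r24 : p0 * n 1 = n 1 * p0 - -p 1 := swap_of_sub (H.n_p0 1)
  have r25 : p 1 * n 1 = n 1 * p 1 - -p0 := swap_of_sub (H.n_p 1)
  have r26 : p 2 * n 1 = n 1 * p 2 := (H.n_p_one 1).symm
  have r27 : p 0 * n 1 = n 1 * p 0 := (H.n_p_two 1).symm
  have r28 : p 1 * p0 = p0 * p 1 := H.p_p0 1
  have r29 : p 2 * p 1 = p 1 * p 2 := (H.p_p 1).symm
  have r30 : m 2 * m 0 = m 0 * m 2 + m 1 := eq_add_of_sub_eq' (H.m_m 2)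
  have r31 : n 2 * n 0 = n 0 * n 2 + -m 1 := eq_add_of_sub_eq' (H.n_n 2)
  have r32 : n 2 * m 2 = m 2 * n 2 := (H.m_n 2).symm
  have r33 : n 0 * m 2 = m 2 * n 0 - n 1 := swap_of_sub (H.m_n_one 2)
  have r34 : n 1 * m 2 = m 2 * n 1 - -n 0 := swap_of_sub (H.m_n_two 2)
  have r35 : p 2 * m 2 = m 2 * p 2 := (H.m_p 2).symm
  have r36 : p 0 * m 2 = m 2 * p 0 - p 1 := swap_of_sub (H.m_p_one 2)
  have r37 : p 1 * m 2 = m 2 * p 1 - -p 0 := swap_of_sub (H.m_p_two 2)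
  have r38 : p0 * m 2 = m 2 * p0 := (H.m_p0 2).symm
  have r39 : p0 * n 2 = n 2 * p0 - -p 2 := swap_of_sub (H.n_p0 2)
  have r40 : p 2 * n 2 = n 2 * p 2 - -p0 := swap_of_sub (H.n_p 2)
  have r41 : p 0 * n 2 = n 2 * p 0 := (H.n_p_one 2).symm
  have r42 : p 1 * n 2 = n 2 * p 1 := (H.n_p_two 2).symm
  have r43 : p 2 * p0 = p0 * p 2 := H.p_p0 2
  have r44 : p 2 * p 0 = p 0 * p 2 := H.p_p 2
  simp only [toFun, Fin.sum_univ_three, add_mul, mul_add, smul_mul_smul_comm]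
  simp only [r0, r1, r2, r3, r4, r5, r6, r7, r8, r9, r10, r11, r12, r13, r14, r15, r16, r17, r18,
    r19, r20, r21, r22, r23, r24, r25, r26, r27, r28, r29, r30, r31, r32, r33, r34, r35, r36, r37,
    r38, r39, r40, r41, r42, r43, r44]
  simp only [Poincare.bracket_def, Pi.smul_apply, Pi.sub_apply, Pi.add_apply, cross_apply,
    dotProduct, Fin.sum_univ_three, smul_eq_mul, map_mul, map_add, map_sub, Matrix.cons_val,
    Matrix.cons_val_zero, Matrix.cons_val_one]
  match_scalars <;> ring


theorem toFun_M (φ : ℂ →+* R) (m n p : Fin 3 → A) (p0 : A) (i : Fin 3) :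
    toFun φ m n p p0 (Poincare.M i) = φ Complex.I • m i := by
  simp [toFun, Poincare.M, Pi.single_apply, apply_ite]

theorem toFun_N (φ : ℂ →+* R) (m n p : Fin 3 → A) (p0 : A) (i : Fin 3) :
    toFun φ m n p p0 (Poincare.N i) = φ Complex.I • n i := by
  simp [toFun, Poincare.N, Pi.single_apply, apply_ite]

theorem toFun_P (φ : ℂ →+* R) (m n p : Fin 3 → A) (p0 : A) (i : Fin 3) :
    toFun φ m n p p0 (Poincare.P i) = p i := by
  simp [toFun, Poincare.P, Pi.single_apply, apply_ite]

theorem toFun_P0 (φ : ℂ →+* R) (m n p : Fin 3 → A) (p0 : A) :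
    toFun φ m n p p0 Poincare.P0 = p0 := by
  simp [toFun, Poincare.P0]

end IsPoincare

namespace IsPoincare

variable {A : Type} [Ring A] [Algebra Ch A] {m n p : Fin 3 → A} {p0 : A}

theorem exists_hom (H : IsPoincare m n p p0) :
    ∃ φ : UniversalEnvelopingAlgebra ℂ Poincare →+* A,
      (∀ z, φ (algebraMap ℂ _ z) = algebraMap Ch A (cst z)) ∧
      ∀ x, φ (UniversalEnvelopingAlgebra.ι ℂ x) = toFun PowerSeries.C m n p p0 x := by
  let _ : LieRing A := LieRing.ofAssociativeRing
  -- The complex structure comes from the constants of `ℂ[[h]]` and exists only inside the proof;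
  -- the statement records it through `cst`.
  let _ : Algebra ℂ A := Algebra.compHom A (PowerSeries.C : ℂ →+* Ch)
  have hsmul (z : ℂ) (x : A) : z • x = cst z • x := rfl
  let f : Poincare →ₗ⁅ℂ⁆ A :=
    { toFun := toFun PowerSeries.C m n p p0
      map_add' := toFun_add _ m n p p0
      map_smul' := fun c x => toFun_smul _ m n p p0 c x
      map_lie' := fun {x y} => H.toFun_lie _ x y }
  exact ⟨(UniversalEnvelopingAlgebra.lift ℂ f).toRingHom,
    fun z => (UniversalEnvelopingAlgebra.lift ℂ f).commutes z,
    fun x => UniversalEnvelopingAlgebra.lift_ι_apply ℂ f x⟩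

/-- The homomorphism `U_io(1,3)[[h]] → A` determined by elements with the relations of
`io(1,3)`. -/
def lift [HComplete A] (H : IsPoincare m n p p0) : UP →ₐ[Ch] A :=
  HSeries.lift H.exists_hom.choose H.exists_hom.choose_spec.1

theorem lift_inc [HComplete A] (H : IsPoincare m n p p0) (x : Poincare) :
    H.lift (Classical.inc x) = toFun PowerSeries.C m n p p0 x := by
  rw [lift, Classical.inc, HSeries.lift_C, H.exists_hom.choose_spec.2]

theorem lift_P [HComplete A] (H : IsPoincare m n p p0) (i : Fin 3) :
    H.lift (Classical.P i) = p i := by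
  rw [Classical.P, lift_inc, toFun_P]

theorem lift_P0 [HComplete A] (H : IsPoincare m n p p0) : H.lift Classical.P0 = p0 := by
  rw [Classical.P0, lift_inc, toFun_P0]

theorem lift_M [HComplete A] (H : IsPoincare m n p p0) (i : Fin 3) :
    H.lift (Classical.M i) = cst Complex.I • m i := by
  rw [Classical.M, lift_inc, toFun_M]

theorem lift_N [HComplete A] (H : IsPoincare m n p p0) (i : Fin 3) :
    H.lift (Classical.N i) = cst Complex.I • n i := by
  rw [Classical.N, lift_inc, toFun_N]

end IsPoincare

/-! ### Homomorphisms from the classical basis are determined by the generators -/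

namespace Classical

/-- The enveloping algebra is a quotient of the tensor algebra, which is generated by its vectors.
-/
theorem adjoin_range_ι :
    Algebra.adjoin ℂ (Set.range (UniversalEnvelopingAlgebra.ι ℂ (L := Poincare))) = ⊤ := by
  have hs : Function.Surjective (UniversalEnvelopingAlgebra.mkAlgHom ℂ Poincare) :=
    Quotient.mk_surjective
  rw [← (AlgHom.range_eq_top _).2 hs, ← Algebra.map_top, ← TensorAlgebra.adjoin_range_ι,
    AlgHom.map_adjoin, ← Set.range_comp]
  rfl

theorem eq_sum (x : Poincare) : x = ∑ i, x.m i • Poincare.M i + ∑ i, x.n i • Poincare.N i +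
    x.p0 • Poincare.P0 + ∑ i, x.p i • Poincare.P i := by
  simp only [Fin.sum_univ_three]
  ext i
  · fin_cases i <;> simp [Poincare.M, Poincare.N, Poincare.P0, Poincare.P, Poincare.add_def,
      Poincare.smul_def]
  · fin_cases i <;> simp [Poincare.M, Poincare.N, Poincare.P0, Poincare.P, Poincare.add_def,
      Poincare.smul_def]
  · simp [Poincare.M, Poincare.N, Poincare.P0, Poincare.P, Poincare.add_def, Poincare.smul_def]
  · fin_cases i <;> simp [Poincare.M, Poincare.N, Poincare.P0, Poincare.P, Poincare.add_def,
      Poincare.smul_def]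

theorem inc_add (x y : Poincare) : inc (x + y) = inc x + inc y := by
  simp only [inc, map_add, ← HSeries.CHom_apply]

theorem inc_smul (z : ℂ) (x : Poincare) : inc (z • x) = cst z • inc x := by
  ext n
  rw [HSeries.coeff_cst_smul]
  simp only [inc, map_smul, HSeries.coeff_C]
  split_ifs <;> simp

theorem inc_eq (x : Poincare) : inc x = ∑ i, cst (x.m i) • M i + ∑ i, cst (x.n i) • N i +
    cst x.p0 • P0 + ∑ i, cst (x.p i) • P i := by
  conv_lhs => rw [eq_sum x]
  simp only [Fin.sum_univ_three, inc_add, inc_smul]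
  rfl

/-- Homomorphisms from `U_io(1,3)[[h]]` to separated algebras are determined by their values on
the generators. -/
theorem algHom_ext {A : Type} [Ring A] [Algebra Ch A] [HSep A] {F G : UP →ₐ[Ch] A}
    (hM : ∀ i, F (M i) = G (M i)) (hN : ∀ i, F (N i) = G (N i)) (hP0 : F P0 = G P0)
    (hP : ∀ i, F (P i) = G (P i)) : F = G := by
  have hinc (x : Poincare) : F (inc x) = G (inc x) := by
    rw [inc_eq]
    simp only [map_add, map_sum, map_smul, hM, hN, hP0, hP]
  refine HSeries.algHom_ext fun b => ?_
  have hb : b ∈ Algebra.adjoin ℂ (Set.range (UniversalEnvelopingAlgebra.ι ℂ (L := Poincare))) := by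
    rw [adjoin_range_ι]; trivial
  simp only [← HSeries.CHom_apply]
  induction hb using Algebra.adjoin_induction with
  | mem x hx =>
    obtain ⟨y, rfl⟩ := hx
    exact hinc y
  | algebraMap z =>
    have e : HSeries.CHom (algebraMap ℂ (UniversalEnvelopingAlgebra ℂ Poincare) z) =
        algebraMap Ch UP (cst z) := (PowerSeries.map_C _ _).symm
    rw [e, AlgHom.commutes, AlgHom.commutes]
  | add x y _ _ hx hy => simp only [map_add, hx, hy]
  | mul x y _ _ hx hy => simp only [map_mul, hx, hy]

end Classical

theorem sum_eq_cyclic {A : Type} [AddCommMonoid A] (f : Fin 3 → A) (i : Fin 3) :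
    ∑ j, f j = f i + f (i + 1) + f (i + 2) := by
  rw [Fin.sum_univ_three]
  fin_cases i
  · rfl
  · exact (add_rotate _ _ _)
  · exact (add_rotate _ _ _).trans (add_rotate _ _ _)

theorem sum_eps_smul {A : Type} [AddCommGroup A] [Module Ch A] (f : Fin 3 → Fin 3 → A)
    (i : Fin 3) : ∑ j, ∑ k, cst (eps i j k) • f j k =
      f (i + 1) (i + 2) - f (i + 2) (i + 1) := by
  rw [Fin.sum_univ_three]
  simp only [Fin.sum_univ_three]
  fin_cases i <;> simp [eps, cst, sub_eq_add_neg, add_comm]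

namespace IsPoincare

variable {A : Type} [Ring A] {m n p : Fin 3 → A} {p0 : A} (H : IsPoincare m n p p0)
include H

theorem commute_p (i j : Fin 3) : Commute (p i) (p j) := by
  have h1 := H.p_p i
  have h2 : p i * p (i + 2) = p (i + 2) * p i := by
    have := (H.p_p (i + 2)).symm
    rwa [show i + 2 + 1 = i by simp [add_assoc]] at this
  obtain ⟨k, rfl⟩ : ∃ k, j = i + k := ⟨j - i, by abel⟩
  fin_cases k
  · simp
  · exact h1
  · exact h2

theorem commute_m_sq (i : Fin 3) : Commute (m i) (∑ j, p j ^ 2) := by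
  rw [sum_eq_cyclic _ i, commute_iff_eq]
  have h0 := H.m_p i
  have h1 : m i * p (i + 1) = p (i + 1) * m i + p (i + 2) := by rw [← H.m_p_one i]; abel
  have h2 : m i * p (i + 2) = p (i + 2) * m i - p (i + 1) := by
    rw [sub_eq_add_neg, ← H.m_p_two i]; abel
  have h3 := (H.commute_p (i + 1) (i + 2)).eq
  simp only [mul_add, add_mul, pow_two]
  rw [← mul_assoc, h0, ← mul_assoc, h1, ← mul_assoc, h2, mul_assoc, h0, add_mul, sub_mul,
    mul_assoc (p (i + 1)), h1, mul_assoc (p (i + 2)), h2, mul_add, mul_sub, h3]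
  simp only [mul_assoc]
  abel

theorem commutator_n_sq (i : Fin 3) :
    n i * (∑ j, p j ^ 2) - (∑ j, p j ^ 2) * n i = -(2 • (p0 * p i)) := by
  rw [sum_eq_cyclic _ i]
  have h0 : n i * p i = p i * n i - p0 := by rw [sub_eq_add_neg, ← H.n_p i]; abel
  have h1 := H.n_p_one i
  have h2 := H.n_p_two i
  simp only [mul_add, add_mul, pow_two]
  rw [← mul_assoc, h0, ← mul_assoc, h1, ← mul_assoc, h2, sub_mul, mul_assoc (p i), h0,
    mul_assoc (p (i + 1)), h1, mul_assoc (p (i + 2)), h2, mul_sub, H.p_p0]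
  simp only [mul_assoc]
  abel

/-- Boost invariance of the Casimir element: the commutators of `n i` with `p⃗²` and with `p0²` are
both `-2 p0 pᵢ`. Consequently boosts commute with the square root, and only the term `hP₀`
contributes to their commutator with `Ξ`. -/
theorem commute_n_sq (i : Fin 3) : Commute (n i) (∑ j, p j ^ 2 - p0 ^ 2) := by
  have h0 : n i * p0 = p0 * n i - p i := by rw [sub_eq_add_neg, ← H.n_p0 i]; abel
  have h1 := H.commutator_n_sq i
  have h2 : n i * p0 ^ 2 - p0 ^ 2 * n i = -(2 • (p0 * p i)) := by
    rw [pow_two, ← mul_assoc, h0, sub_mul, mul_assoc, h0, H.p_p0, mul_sub, mul_assoc]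
    abel
  rw [commute_iff_eq, ← sub_eq_zero, mul_sub, sub_mul, sub_sub_sub_comm, h1, h2, sub_self]

omit H in
theorem map {B : Type} [Ring B] (H : IsPoincare m n p p0) (F : A →+* B) :
    IsPoincare (fun i => F (m i)) (fun i => F (n i)) (fun i => F (p i)) (F p0) where
  m_m i := by simp only [← map_mul, ← map_sub, H.m_m]
  m_n i := by simp only [← map_mul, H.m_n]
  m_n_one i := by simp only [← map_mul, ← map_sub, H.m_n_one]
  m_n_two i := by simp only [← map_mul, ← map_sub, ← map_neg, H.m_n_two]
  n_n i := by simp only [← map_mul, ← map_sub, ← map_neg, H.n_n]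
  m_p i := by simp only [← map_mul, H.m_p]
  m_p_one i := by simp only [← map_mul, ← map_sub, H.m_p_one]
  m_p_two i := by simp only [← map_mul, ← map_sub, ← map_neg, H.m_p_two]
  m_p0 i := by simp only [← map_mul, H.m_p0]
  n_p i := by simp only [← map_mul, ← map_sub, ← map_neg, H.n_p]
  n_p_one i := by simp only [← map_mul, H.n_p_one]
  n_p_two i := by simp only [← map_mul, H.n_p_two]
  n_p0 i := by simp only [← map_mul, ← map_sub, ← map_neg, H.n_p0]
  p_p i := by simp only [← map_mul, H.p_p]
  p_p0 i := by simp only [← map_mul, H.p_p0]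

end IsPoincare

/-- The relations between the generators of `io(1,3)` and the series `X = Ξ`, `W = Ξ⁻¹`, for the
value `t` of the deformation parameter. -/
structure IsKappa {R A : Type} [CommRing R] [Ring A] [Algebra R A] (t : R) (m n p : Fin 3 → A)
    (p0 X W : A) : Prop extends IsPoincare m n p p0 where
  X_W : X * W = 1
  W_X : W * X = 1
  m_X : ∀ i, m i * X = X * m i
  p_X : ∀ i, p i * X = X * p i
  p0_X : p0 * X = X * p0
  n_X : ∀ i, n i * X - X * n i = -(t • p i)
  -- The square root in polynomial form: `(X - t p0)² = 1 - t² (p⃗² - p0²)`, solved for `p0` after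
  -- division by `X`.
  p0_eq : (2 * t) • p0 = X - W + t ^ 2 • ((∑ i, p i ^ 2) * W)

/-! ### The elements `Ξ` and `Ξ⁻¹` and their commutation relations -/

namespace Classical

/-- `M = i m`. -/
def m (i : Fin 3) : UP := inc (-Complex.I • Poincare.M i)

/-- `N = i n`. -/
def n (i : Fin 3) : UP := inc (-Complex.I • Poincare.N i)

theorem M_eq (i : Fin 3) : M i = cst Complex.I • m i := by
  rw [m, ← inc_smul, smul_smul]
  simp [M]

theorem N_eq (i : Fin 3) : N i = cst Complex.I • n i := by
  rw [n, ← inc_smul, smul_smul]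
  simp [N]

theorem inc_neg (x : Poincare) : inc (-x) = -inc x := by
  simp only [inc, map_neg, ← HSeries.CHom_apply]

theorem inc_zero : inc 0 = 0 := by
  simp only [inc, map_zero, ← HSeries.CHom_apply]

theorem inc_lie (x y : Poincare) : inc x * inc y - inc y * inc x = inc ⁅x, y⁆ := by
  simp only [inc, ← HSeries.CHom_apply, ← map_mul, ← map_sub, LieHom.map_lie]
  rfl

theorem inc_mul_comm {x y : Poincare} (H : ⁅x, y⁆ = 0) : inc x * inc y = inc y * inc x := by
  rw [← sub_eq_zero, inc_lie, H, inc_zero]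

theorem sum_eps {V : Type} [AddCommGroup V] [Module ℂ V] (z : ℂ) (f : Fin 3 → V) (i : Fin 3) :
    ∑ k, (z * eps i i k) • f k = 0 ∧ ∑ k, (z * eps i (i + 1) k) • f k = z • f (i + 2) ∧
      ∑ k, (z * eps i (i + 2) k) • f k = -(z • f (i + 1)) := by
  simp only [Fin.sum_univ_three]
  fin_cases i <;> simp [eps]

theorem isPoincare : IsPoincare m n P P0 := by
  have hI (x : Poincare) : -Complex.I • -Complex.I • Complex.I • x = -Complex.I • x := by
    simp [smul_smul]
  have hI' (x : Poincare) : -Complex.I • Complex.I • x = x := by simp [smul_smul]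
  have swap {x y z : Poincare} (e : ⁅x, y⁆ = z) : inc x * inc y - inc y * inc x = inc z :=
    (inc_lie x y).trans (congrArg inc e)
  have swap' {x y z : Poincare} (e : ⁅x, y⁆ = -z) : inc x * inc y - inc y * inc x = -inc z :=
    (swap e).trans (inc_neg z)
  constructor <;> intro i
  · refine swap ?_
    rw [smul_lie, lie_smul, Poincare.bracket_M_M, (sum_eps _ _ i).2.1, hI]
  · refine inc_mul_comm ?_
    rw [smul_lie, lie_smul, Poincare.bracket_M_N, (sum_eps _ _ i).1, smul_zero, smul_zero]
  · refine swap ?_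
    rw [smul_lie, lie_smul, Poincare.bracket_M_N, (sum_eps _ _ i).2.1, hI]
  · refine swap' ?_
    rw [smul_lie, lie_smul, Poincare.bracket_M_N, (sum_eps _ _ i).2.2, smul_neg, smul_neg, hI]
  · refine swap' ?_
    rw [smul_lie, lie_smul, Poincare.bracket_N_N, (sum_eps _ _ i).2.1, neg_smul _ (Poincare.M _),
      smul_neg, smul_neg, hI, neg_smul]
  · refine inc_mul_comm ?_
    rw [smul_lie, Poincare.bracket_M_P, (sum_eps _ _ i).1, smul_zero]
  · refine swap ?_
    rw [smul_lie, Poincare.bracket_M_P, (sum_eps _ _ i).2.1, hI']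
  · refine swap' ?_
    rw [smul_lie, Poincare.bracket_M_P, (sum_eps _ _ i).2.2, smul_neg, hI']
  · refine inc_mul_comm ?_
    rw [smul_lie, Poincare.bracket_M_P0, smul_zero]
  · refine swap' ?_
    rw [smul_lie, Poincare.bracket_N_P, if_pos rfl, mul_one, neg_smul _ Poincare.P0, smul_neg, hI']
  · refine inc_mul_comm ?_
    rw [smul_lie, Poincare.bracket_N_P, if_neg (by simp), mul_zero, zero_smul, smul_zero]
  · refine inc_mul_comm ?_
    rw [smul_lie, Poincare.bracket_N_P, if_neg (by simp), mul_zero, zero_smul, smul_zero]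
  · refine swap' ?_
    rw [smul_lie, Poincare.bracket_N_P0, neg_smul _ (Poincare.P _), smul_neg, hI']
  · exact inc_mul_comm (Poincare.bracket_P_P _ _)
  · exact inc_mul_comm (Poincare.bracket_P_P0 _)

theorem coeff_zero_h_sq_smul (x : UP) : HSeries.coeff 0 (h ^ 2 • x) = 0 :=
  HSeries.coeff_h_pow_smul_of_lt two_pos x

theorem coeff_zero_neg_h_sq_smul (x : UP) : HSeries.coeff 0 (-(h ^ 2 • x)) = 0 := by
  rw [HSeries.coeff_neg, coeff_zero_h_sq_smul, neg_zero]

theorem root_mul_root : root * root = 1 - h ^ 2 • PSq := by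
  have h0 := coeff_zero_neg_h_sq_smul PSq
  rw [root, ← HSeries.eval_mul _ _ h0, sqrtSeries_mul_self, HSeries.eval_add,
    HSeries.eval_one h0, HSeries.eval_X h0, sub_eq_add_neg]

theorem commute_root {x : UP} (H : Commute x PSq) : Commute x root :=
  HSeries.commute_eval (coeff_zero_neg_h_sq_smul _) (H.smul_right _).neg_right _

theorem coeff_zero_root : HSeries.coeff 0 root = 1 := by
  rw [root, HSeries.coeff_zero_eval]
  simp [sqrtSeries]

theorem coeff_zero_Xi : HSeries.coeff 0 Xi = 1 := by
  rw [Xi, HSeries.coeff_add, HSeries.coeff_h_smul_zero, zero_add, coeff_zero_root]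

theorem coeff_zero_Xi_sub_one : HSeries.coeff 0 (Xi - 1) = 0 := by
  rw [HSeries.coeff_sub, coeff_zero_Xi, HSeries.coeff_one, if_pos rfl, sub_self]

theorem commute_P0_vecPSq : Commute P0 vecPSq :=
  Commute.sum_right _ _ _ fun i _ => Commute.pow_right (isPoincare.p_p0 i).symm 2

theorem commute_P0_PSq : Commute P0 PSq :=
  commute_P0_vecPSq.sub_right ((Commute.refl P0).pow_right 2)

theorem commute_P_vecPSq (i : Fin 3) : Commute (P i) vecPSq :=
  Commute.sum_right _ _ _ fun j _ => (isPoincare.commute_p i j).pow_right 2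

theorem commute_P_PSq (i : Fin 3) : Commute (P i) PSq :=
  (commute_P_vecPSq i).sub_right (Commute.pow_right (isPoincare.p_p0 i) 2)

theorem commute_m_PSq (i : Fin 3) : Commute (m i) PSq :=
  (isPoincare.commute_m_sq i).sub_right (Commute.pow_right (isPoincare.m_p0 i) 2)

theorem commute_Xi {x : UP} (h0 : Commute x P0) (h1 : Commute x PSq) : Commute x Xi :=
  (h0.smul_right _).add_right (commute_root h1)

/-- A difference of squares, since `P0` commutes with the root: `(1 - h²P²) - h²P₀² = 1 - h²P⃗²`. It
explains the closed formula for `Ξ⁻¹`. -/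
theorem Xi_mul_root_sub : Xi * (root - h • P0) = 1 - h ^ 2 • vecPSq := by
  have e : root * (h • P0) = (h • P0) * root := ((commute_root commute_P0_PSq).smul_left h).eq.symm
  rw [Xi, mul_sub, add_mul, add_mul, root_mul_root, e, smul_mul_smul_comm, PSq, ← pow_two,
    ← pow_two, smul_sub]
  abel

theorem Xi_mul_XiInv : Xi * XiInv = 1 := by
  have h0 := coeff_zero_h_sq_smul vecPSq
  rw [XiInv, ← mul_assoc, Xi_mul_root_sub]
  have e : (1 : UP) - h ^ 2 • vecPSq = HSeries.eval (1 - PowerSeries.X) (h ^ 2 • vecPSq) := by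
    rw [sub_eq_add_neg, sub_eq_add_neg, HSeries.eval_add, HSeries.eval_one h0,
      show (-PowerSeries.X : PowerSeries ℂ) = PowerSeries.C (-1) * PowerSeries.X by simp,
      HSeries.eval_C_mul, HSeries.eval_X h0]
    simp [cst]
  rw [e, ← HSeries.eval_mul _ _ h0, one_sub_X_mul_geomSeries, HSeries.eval_one h0]

/-- Every factor of `XiInv` is built from momenta and so commutes with `Ξ`; the right inverse is
therefore two-sided. -/
theorem isUnit_Xi : IsUnit Xi := by
  have hs : HSeries.coeff 0 (h ^ 2 • vecPSq) = 0 := coeff_zero_h_sq_smul vecPSq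
  have hv : Commute Xi vecPSq := by
    refine (commute_Xi commute_P0_vecPSq.symm ?_).symm
    exact Commute.sum_left _ _ _ fun i _ => (commute_P_PSq i).pow_left 2
  have h1 : Commute Xi (root - h • P0) := by
    refine Commute.sub_right ?_ (Commute.smul_right ?_ _)
    · exact commute_root ((commute_P0_PSq.smul_left _).add_left
        (commute_root (Commute.refl PSq)).symm)
    · exact (commute_Xi (Commute.refl P0) commute_P0_PSq).symm
  have h2 : Commute Xi XiInv := h1.mul_right (HSeries.commute_eval hs (hv.smul_right _) _)
  exact ⟨⟨Xi, XiInv, Xi_mul_XiInv, h2.eq ▸ Xi_mul_XiInv⟩, rfl⟩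

theorem XiInv_mul_Xi : XiInv * Xi = 1 := by
  obtain ⟨u, hu⟩ := isUnit_Xi
  have := Xi_mul_XiInv
  rw [← hu] at this ⊢
  rw [← Units.inv_eq_of_mul_eq_one_right this, Units.inv_mul]

theorem commute_XiInv {x : UP} (H : Commute x Xi) : Commute x XiInv := by
  rw [commute_iff_eq, ← one_mul (x * XiInv), ← XiInv_mul_Xi, mul_assoc, ← mul_assoc Xi,
    ← H.eq, mul_assoc, Xi_mul_XiInv, mul_one]

theorem isKappa : IsKappa h m n P P0 Xi XiInv where
  toIsPoincare := isPoincare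
  X_W := Xi_mul_XiInv
  W_X := XiInv_mul_Xi
  m_X i := (commute_Xi (isPoincare.m_p0 i) (commute_m_PSq i)).eq
  p_X i := (commute_Xi (isPoincare.p_p0 i) (commute_P_PSq i)).eq
  p0_X := (commute_Xi (Commute.refl P0) commute_P0_PSq).eq
  n_X i := by
    have e := (commute_root (isPoincare.commute_n_sq i)).eq
    rw [Xi, mul_add, add_mul, e, mul_smul_comm, smul_mul_assoc, ← smul_neg, ← isPoincare.n_p0 i,
      smul_sub]
    abel
  -- The product formula reads `root - hP₀ = Ξ⁻¹ - h² P⃗² Ξ⁻¹`. Eliminating the root between this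
  -- and `Ξ = hP₀ + root` leaves the claim.
  p0_eq := by
    have hv : Commute Xi vecPSq :=
      (Commute.sum_left _ _ _ fun i _ => (commute_Xi (isPoincare.p_p0 i)
        (commute_P_PSq i)).pow_left 2 : Commute vecPSq Xi).symm
    have e : root - h • P0 = XiInv - h ^ 2 • (vecPSq * XiInv) := by
      rw [← (commute_XiInv hv.symm).eq.symm, ← one_mul (root - h • P0), ← XiInv_mul_Xi, mul_assoc,
        Xi_mul_root_sub, mul_sub, mul_one, mul_smul_comm]
    have e' : root = h • P0 + XiInv - h ^ 2 • (vecPSq * XiInv) := by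
      rw [add_sub_assoc, ← e]
      abel
    rw [Xi, e', two_mul, add_smul, vecPSq]
    abel

end Classical

/-! ## Normal ordering -/

/-- `i, j, k` is a cyclic permutation of the three indices. -/
structure Cyclic (i j k : Fin 3) : Prop where
  snd : j = i + 1
  trd : k = i + 2

theorem Cyclic.mk' (i : Fin 3) : Cyclic i (i + 1) (i + 2) := ⟨rfl, rfl⟩

/-- With three index variables instead of `i`, `i + 1`, `i + 2`, rotating the triple yields all
relations without arithmetic modulo `3` inside large expressions. -/
theorem Cyclic.rot {i j k : Fin 3} (c : Cyclic i j k) : Cyclic j k i := by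
  obtain ⟨rfl, rfl⟩ := c
  constructor <;> simp [add_assoc]

/-- Products are kept associated to the right; a rule for `a * b` then also has to act when further
factors follow. -/
theorem reassoc {A : Type} [Semigroup A] {a b c : A} (e : a * b = c) (x : A) :
    a * (b * x) = c * x := by
  rw [← mul_assoc, e]

theorem reassoc_one {A : Type} [Monoid A] {a b : A} (e : a * b = 1) (x : A) :
    a * (b * x) = x := by
  rw [← mul_assoc, e, one_mul]

section

variable {A : Type} [Ring A] {m n p : Fin 3 → A} {p0 : A} {i j k : Fin 3} (c : Cyclic i j k)
include c

theorem IsPoincare.m_m_cyclic (H : IsPoincare m n p p0) : m i * m j - m j * m i = m k := by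
  obtain ⟨rfl, rfl⟩ := c
  exact H.m_m i

theorem IsPoincare.n_n_cyclic (H : IsPoincare m n p p0) : n i * n j - n j * n i = -m k := by
  obtain ⟨rfl, rfl⟩ := c
  exact H.n_n i

theorem IsPoincare.m_n_one_cyclic (H : IsPoincare m n p p0) : m i * n j - n j * m i = n k := by
  obtain ⟨rfl, rfl⟩ := c
  exact H.m_n_one i

theorem IsPoincare.m_n_two_cyclic (H : IsPoincare m n p p0) : m i * n k - n k * m i = -n j := by
  obtain ⟨rfl, rfl⟩ := c
  exact H.m_n_two i

theorem IsPoincare.m_p_one_cyclic (H : IsPoincare m n p p0) : m i * p j - p j * m i = p k := by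
  obtain ⟨rfl, rfl⟩ := c
  exact H.m_p_one i

theorem IsPoincare.m_p_two_cyclic (H : IsPoincare m n p p0) : m i * p k - p k * m i = -p j := by
  obtain ⟨rfl, rfl⟩ := c
  exact H.m_p_two i

theorem IsPoincare.n_p_one_cyclic (H : IsPoincare m n p p0) : n i * p j = p j * n i := by
  obtain ⟨rfl, rfl⟩ := c
  exact H.n_p_one i

theorem IsPoincare.n_p_two_cyclic (H : IsPoincare m n p p0) : n i * p k = p k * n i := by
  obtain ⟨rfl, rfl⟩ := c
  exact H.n_p_two i

theorem sum_cyclic {B : Type} [AddCommMonoid B] (f : Fin 3 → B) : ∑ l, f l = f i + f j + f k := by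
  obtain ⟨rfl, rfl⟩ := c
  exact sum_eq_cyclic f i

/-- An oriented rewriting system: monomials are sorted into the order `p`, `p0`, `n`, `m`, and by
`i`, `j`, `k` within each block. Each swap costs at most a term with one factor less. -/
theorem IsPoincare.normal (H : IsPoincare m n p p0) :
    m j * m i = m i * m j - m k ∧ n j * n i = n i * n j - -m k ∧ m i * n i = n i * m i ∧
    m i * n j = n j * m i + n k ∧ m i * n k = n k * m i + -n j ∧ m i * p i = p i * m i ∧
    m i * p j = p j * m i + p k ∧ m i * p k = p k * m i + -p j ∧ m i * p0 = p0 * m i ∧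
    n i * p i = p i * n i + -p0 ∧ n i * p j = p j * n i ∧ n i * p k = p k * n i ∧
    n i * p0 = p0 * n i + -p i ∧ p0 * p i = p i * p0 ∧ p j * p i = p i * p j ∧
    m k * m j = m j * m k - m i ∧ n k * n j = n j * n k - -m i ∧ m j * n j = n j * m j ∧
    m j * n k = n k * m j + n i ∧ m j * n i = n i * m j + -n k ∧ m j * p j = p j * m j ∧
    m j * p k = p k * m j + p i ∧ m j * p i = p i * m j + -p k ∧ m j * p0 = p0 * m j ∧
    n j * p j = p j * n j + -p0 ∧ n j * p k = p k * n j ∧ n j * p i = p i * n j ∧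
    n j * p0 = p0 * n j + -p j ∧ p0 * p j = p j * p0 ∧ p k * p j = p j * p k ∧
    m k * m i = m i * m k + m j ∧ n k * n i = n i * n k + -m j ∧ m k * n k = n k * m k ∧
    m k * n i = n i * m k + n j ∧ m k * n j = n j * m k + -n i ∧ m k * p k = p k * m k ∧
    m k * p i = p i * m k + p j ∧ m k * p j = p j * m k + -p i ∧ m k * p0 = p0 * m k ∧
    n k * p k = p k * n k + -p0 ∧ n k * p i = p i * n k ∧ n k * p j = p j * n k ∧
    n k * p0 = p0 * n k + -p k ∧ p0 * p k = p k * p0 ∧ p k * p i = p i * p k :=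
  ⟨
    swap_of_sub (H.m_m_cyclic c), swap_of_sub (H.n_n_cyclic c), H.m_n i,
    eq_add_of_sub_eq' (H.m_n_one_cyclic c), eq_add_of_sub_eq' (H.m_n_two_cyclic c), H.m_p i,
    eq_add_of_sub_eq' (H.m_p_one_cyclic c), eq_add_of_sub_eq' (H.m_p_two_cyclic c), H.m_p0 i,
    eq_add_of_sub_eq' (H.n_p i), H.n_p_one_cyclic c, H.n_p_two_cyclic c,
    eq_add_of_sub_eq' (H.n_p0 i), (H.p_p0 i).symm, H.commute_p j i,
    swap_of_sub (H.m_m_cyclic c.rot), swap_of_sub (H.n_n_cyclic c.rot), H.m_n j,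
    eq_add_of_sub_eq' (H.m_n_one_cyclic c.rot), eq_add_of_sub_eq' (H.m_n_two_cyclic c.rot),
    H.m_p j, eq_add_of_sub_eq' (H.m_p_one_cyclic c.rot),
    eq_add_of_sub_eq' (H.m_p_two_cyclic c.rot), H.m_p0 j, eq_add_of_sub_eq' (H.n_p j),
    H.n_p_one_cyclic c.rot, H.n_p_two_cyclic c.rot, eq_add_of_sub_eq' (H.n_p0 j),
    (H.p_p0 j).symm, H.commute_p k j, eq_add_of_sub_eq' (H.m_m_cyclic c.rot.rot),
    eq_add_of_sub_eq' (H.n_n_cyclic c.rot.rot), H.m_n k,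
    eq_add_of_sub_eq' (H.m_n_one_cyclic c.rot.rot),
    eq_add_of_sub_eq' (H.m_n_two_cyclic c.rot.rot), H.m_p k,
    eq_add_of_sub_eq' (H.m_p_one_cyclic c.rot.rot),
    eq_add_of_sub_eq' (H.m_p_two_cyclic c.rot.rot), H.m_p0 k, eq_add_of_sub_eq' (H.n_p k),
    H.n_p_one_cyclic c.rot.rot, H.n_p_two_cyclic c.rot.rot, eq_add_of_sub_eq' (H.n_p0 k),
    (H.p_p0 k).symm, H.commute_p k i⟩

theorem IsPoincare.normal_assoc (H : IsPoincare m n p p0) :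
    (∀ x, m j * (m i * x) = (m i * m j - m k) * x) ∧
    (∀ x, n j * (n i * x) = (n i * n j - -m k) * x) ∧ (∀ x, m i * (n i * x) = (n i * m i) * x) ∧
    (∀ x, m i * (n j * x) = (n j * m i + n k) * x) ∧
    (∀ x, m i * (n k * x) = (n k * m i + -n j) * x) ∧ (∀ x, m i * (p i * x) = (p i * m i) * x) ∧
    (∀ x, m i * (p j * x) = (p j * m i + p k) * x) ∧
    (∀ x, m i * (p k * x) = (p k * m i + -p j) * x) ∧ (∀ x, m i * (p0 * x) = (p0 * m i) * x) ∧
    (∀ x, n i * (p i * x) = (p i * n i + -p0) * x) ∧ (∀ x, n i * (p j * x) = (p j * n i) * x) ∧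
    (∀ x, n i * (p k * x) = (p k * n i) * x) ∧ (∀ x, n i * (p0 * x) = (p0 * n i + -p i) * x) ∧
    (∀ x, p0 * (p i * x) = (p i * p0) * x) ∧ (∀ x, p j * (p i * x) = (p i * p j) * x) ∧
    (∀ x, m k * (m j * x) = (m j * m k - m i) * x) ∧
    (∀ x, n k * (n j * x) = (n j * n k - -m i) * x) ∧ (∀ x, m j * (n j * x) = (n j * m j) * x) ∧
    (∀ x, m j * (n k * x) = (n k * m j + n i) * x) ∧
    (∀ x, m j * (n i * x) = (n i * m j + -n k) * x) ∧ (∀ x, m j * (p j * x) = (p j * m j) * x) ∧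
    (∀ x, m j * (p k * x) = (p k * m j + p i) * x) ∧
    (∀ x, m j * (p i * x) = (p i * m j + -p k) * x) ∧ (∀ x, m j * (p0 * x) = (p0 * m j) * x) ∧
    (∀ x, n j * (p j * x) = (p j * n j + -p0) * x) ∧ (∀ x, n j * (p k * x) = (p k * n j) * x) ∧
    (∀ x, n j * (p i * x) = (p i * n j) * x) ∧ (∀ x, n j * (p0 * x) = (p0 * n j + -p j) * x) ∧
    (∀ x, p0 * (p j * x) = (p j * p0) * x) ∧ (∀ x, p k * (p j * x) = (p j * p k) * x) ∧
    (∀ x, m k * (m i * x) = (m i * m k + m j) * x) ∧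
    (∀ x, n k * (n i * x) = (n i * n k + -m j) * x) ∧ (∀ x, m k * (n k * x) = (n k * m k) * x) ∧
    (∀ x, m k * (n i * x) = (n i * m k + n j) * x) ∧
    (∀ x, m k * (n j * x) = (n j * m k + -n i) * x) ∧ (∀ x, m k * (p k * x) = (p k * m k) * x) ∧
    (∀ x, m k * (p i * x) = (p i * m k + p j) * x) ∧
    (∀ x, m k * (p j * x) = (p j * m k + -p i) * x) ∧ (∀ x, m k * (p0 * x) = (p0 * m k) * x) ∧
    (∀ x, n k * (p k * x) = (p k * n k + -p0) * x) ∧ (∀ x, n k * (p i * x) = (p i * n k) * x) ∧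
    (∀ x, n k * (p j * x) = (p j * n k) * x) ∧ (∀ x, n k * (p0 * x) = (p0 * n k + -p k) * x) ∧
    (∀ x, p0 * (p k * x) = (p k * p0) * x) ∧ (∀ x, p k * (p i * x) = (p i * p k) * x) := by
  obtain ⟨e0, e1, e2, e3, e4, e5, e6, e7, e8, e9, e10, e11, e12, e13, e14, e15, e16, e17, e18, e19,
    e20, e21, e22, e23, e24, e25, e26, e27, e28, e29, e30, e31, e32, e33, e34, e35, e36, e37,
    e38, e39, e40, e41, e42, e43, e44⟩ := H.normal c
  exact ⟨reassoc e0, reassoc e1, reassoc e2, reassoc e3, reassoc e4, reassoc e5, reassoc e6,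
    reassoc e7, reassoc e8, reassoc e9, reassoc e10, reassoc e11, reassoc e12, reassoc e13,
    reassoc e14, reassoc e15, reassoc e16, reassoc e17, reassoc e18, reassoc e19, reassoc e20,
    reassoc e21, reassoc e22, reassoc e23, reassoc e24, reassoc e25, reassoc e26, reassoc e27,
    reassoc e28, reassoc e29, reassoc e30, reassoc e31, reassoc e32, reassoc e33, reassoc e34,
    reassoc e35, reassoc e36, reassoc e37, reassoc e38, reassoc e39, reassoc e40, reassoc e41,
    reassoc e42, reassoc e43, reassoc e44⟩

end

section

variable {R A : Type} [CommRing R] [Ring A] [Algebra R A] {t : R} {m n p : Fin 3 → A}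
  {p0 X W : A}

theorem IsKappa.commute_W (H : IsKappa t m n p p0 X W) {x : A} (hx : x * X = X * x) :
    x * W = W * x := by
  rw [← one_mul (x * W), ← H.W_X, mul_assoc, ← mul_assoc X, ← hx, mul_assoc, H.X_W, mul_one]

/-- The derivative of an inverse: `[n, W] = -W [n, X] W`, and `p` commutes with `W`. -/
theorem IsKappa.n_W (H : IsKappa t m n p p0 X W) (i : Fin 3) :
    n i * W = W * n i + t • (W * (W * p i)) := by
  have e : n i * X = X * n i + -(t • p i) := eq_add_of_sub_eq' (H.n_X i)
  have e1 : W * p i = p i * W := (H.commute_W (H.p_X i)).symm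
  calc n i * W = W * (X * n i) * W := by rw [← mul_assoc, H.W_X, one_mul]
    _ = W * (n i * X + t • p i) * W := by rw [e, neg_add_cancel_right]
    _ = W * n i + t • (W * (W * p i)) := by
      rw [mul_add, add_mul, ← mul_assoc W (n i), mul_assoc _ X, H.X_W, mul_one, mul_smul_comm,
        smul_mul_assoc, mul_assoc, ← e1]

/-- The rules for `Ξ` and `Ξ⁻¹` move them to the left of all generators and cancel them against each
other. -/
theorem IsKappa.normal (H : IsKappa t m n p p0 X W) (i j k : Fin 3) :
    X * W = 1 ∧ W * X = 1 ∧ p0 * X = X * p0 ∧ p0 * W = W * p0 ∧ m i * X = X * m i ∧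
    p i * X = X * p i ∧ m i * W = W * m i ∧ p i * W = W * p i ∧ n i * X = X * n i + -(t • p i) ∧
    n i * W = W * n i + t • (W * (W * p i)) ∧ m j * X = X * m j ∧ p j * X = X * p j ∧
    m j * W = W * m j ∧ p j * W = W * p j ∧ n j * X = X * n j + -(t • p j) ∧
    n j * W = W * n j + t • (W * (W * p j)) ∧ m k * X = X * m k ∧ p k * X = X * p k ∧
    m k * W = W * m k ∧ p k * W = W * p k ∧ n k * X = X * n k + -(t • p k) ∧
    n k * W = W * n k + t • (W * (W * p k)) :=
  ⟨
    H.X_W, H.W_X, H.p0_X, H.commute_W H.p0_X, H.m_X i, H.p_X i, H.commute_W (H.m_X i),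
    H.commute_W (H.p_X i), eq_add_of_sub_eq' (H.n_X i), H.n_W i, H.m_X j, H.p_X j,
    H.commute_W (H.m_X j), H.commute_W (H.p_X j), eq_add_of_sub_eq' (H.n_X j), H.n_W j, H.m_X k,
    H.p_X k, H.commute_W (H.m_X k), H.commute_W (H.p_X k), eq_add_of_sub_eq' (H.n_X k), H.n_W k⟩

theorem IsKappa.normal_assoc (H : IsKappa t m n p p0 X W) (i j k : Fin 3) :
    (∀ x, X * (W * x) = x) ∧ (∀ x, W * (X * x) = x) ∧ (∀ x, p0 * (X * x) = (X * p0) * x) ∧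
    (∀ x, p0 * (W * x) = (W * p0) * x) ∧ (∀ x, m i * (X * x) = (X * m i) * x) ∧
    (∀ x, p i * (X * x) = (X * p i) * x) ∧ (∀ x, m i * (W * x) = (W * m i) * x) ∧
    (∀ x, p i * (W * x) = (W * p i) * x) ∧ (∀ x, n i * (X * x) = (X * n i + -(t • p i)) * x) ∧
    (∀ x, n i * (W * x) = (W * n i + t • (W * (W * p i))) * x) ∧
    (∀ x, m j * (X * x) = (X * m j) * x) ∧ (∀ x, p j * (X * x) = (X * p j) * x) ∧
    (∀ x, m j * (W * x) = (W * m j) * x) ∧ (∀ x, p j * (W * x) = (W * p j) * x) ∧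
    (∀ x, n j * (X * x) = (X * n j + -(t • p j)) * x) ∧
    (∀ x, n j * (W * x) = (W * n j + t • (W * (W * p j))) * x) ∧
    (∀ x, m k * (X * x) = (X * m k) * x) ∧ (∀ x, p k * (X * x) = (X * p k) * x) ∧
    (∀ x, m k * (W * x) = (W * m k) * x) ∧ (∀ x, p k * (W * x) = (W * p k) * x) ∧
    (∀ x, n k * (X * x) = (X * n k + -(t • p k)) * x) ∧
    (∀ x, n k * (W * x) = (W * n k + t • (W * (W * p k))) * x) := by
  obtain ⟨e0, e1, e2, e3, e4, e5, e6, e7, e8, e9, e10, e11, e12, e13, e14, e15, e16, e17, e18, e19,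
    e20, e21⟩ := H.normal i j k
  exact ⟨reassoc_one e0, reassoc_one e1, reassoc e2, reassoc e3, reassoc e4, reassoc e5, reassoc e6,
    reassoc e7, reassoc e8, reassoc e9, reassoc e10, reassoc e11, reassoc e12, reassoc e13,
    reassoc e14, reassoc e15, reassoc e16, reassoc e17, reassoc e18, reassoc e19, reassoc e20,
    reassoc e21⟩


theorem IsKappa.map {B : Type} [Ring B] [Algebra R B] (H : IsKappa t m n p p0 X W)
    (F : A →ₐ[R] B) : IsKappa t (fun i => F (m i)) (fun i => F (n i)) (fun i => F (p i)) (F p0)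
      (F X) (F W) where
  toIsPoincare := H.toIsPoincare.map F.toRingHom
  X_W := by rw [← map_mul, H.X_W, map_one]
  W_X := by rw [← map_mul, H.W_X, map_one]
  m_X i := by rw [← map_mul, H.m_X, map_mul]
  p_X i := by rw [← map_mul, H.p_X, map_mul]
  p0_X := by rw [← map_mul, H.p0_X, map_mul]
  n_X i := by rw [← map_mul, ← map_mul, ← map_sub, H.n_X, map_neg, map_smul]
  p0_eq := by
    rw [← map_smul, H.p0_eq]
    simp only [map_add, map_sub, map_smul, map_mul, map_sum, map_pow]

end

/-! ## The deformed coproduct -/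

section

variable {R U A : Type} [CommRing R] [Ring U] [Algebra R U] [Ring A] [Algebra R A]

/-- The coproduct of the boost `nᵢ`. -/
def comulN (t : R) (m n p : Fin 3 → U) (W : U) (F G : U →ₐ[R] A) (i : Fin 3) : A :=
  F (n i) + F W * G (n i) - t • (F (p (i + 1)) * F W * G (m (i + 2)) -
    F (p (i + 2)) * F W * G (m (i + 1)))

/-- The coproduct of the energy. -/
def comulP0 (t : R) (p : Fin 3 → U) (p0 X W : U) (F G : U →ₐ[R] A) : A :=
  F p0 * G X + F W * G p0 + t • ∑ l, F (p l) * F W * G (p l)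

theorem comulN_eq {i j k : Fin 3} (c : Cyclic i j k) (t : R) (m n p : Fin 3 → U) (W : U)
    (F G : U →ₐ[R] A) : comulN t m n p W F G i = F (n i) + F W * G (n i) -
      t • (F (p j) * F W * G (m k) - F (p k) * F W * G (m j)) := by
  obtain ⟨rfl, rfl⟩ := c
  rfl

variable {t : R} {m n p : Fin 3 → U} {p0 X W : U}

-- `F` and `G` play the roles of `x ↦ x ⊗ 1` and `x ↦ 1 ⊗ x`; only the commutation of their images
-- matters. Factors from `F` are moved to the left and each leg is put into normal order. All
-- relations then become linear identities between monomials, except `[N, N]` and `[N, P₀]`, which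
-- also use the quadratic relation for `Ξ` in the first leg.
set_option linter.unusedSimpArgs false in
set_option maxHeartbeats 2000000 in
theorem IsKappa.isPoincare_comul (H : IsKappa t m n p p0 X W) (F G : U →ₐ[R] A)
    (hc : ∀ a b, G b * F a = F a * G b) :
    IsPoincare (fun i => F (m i) + G (m i)) (comulN t m n p W F G)
      (fun i => F (p i) * G X + G (p i)) (comulP0 t p p0 X W F G) := by
  set N := comulN t m n p W F G with hN
  set M : Fin 3 → A := fun i => F (m i) + G (m i) with hM
  set P : Fin 3 → A := fun i => F (p i) * G X + G (p i) with hP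
  set E := comulP0 t p p0 X W F G with hE
  have main (i j k : Fin 3) (c : Cyclic i j k) : (M i * M j - M j * M i = M k) ∧
      (M i * N i = N i * M i) ∧ (M i * N j - N j * M i = N k) ∧ (M i * N k - N k * M i = -N j) ∧
      (N i * N j - N j * N i = -M k) ∧ (M i * P i = P i * M i) ∧
      (M i * P j - P j * M i = P k) ∧ (M i * P k - P k * M i = -P j) ∧ (M i * E = E * M i) ∧
      (N i * P i - P i * N i = -E) ∧ (N i * P j = P j * N i) ∧ (N i * P k = P k * N i) ∧
      (N i * E - E * N i = -P i) ∧ (P i * P j = P j * P i) ∧ (P i * E = E * P i) := by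
    have hc' (a b : U) (x : A) : G b * (F a * x) = F a * (G b * x) := by
      rw [← mul_assoc, hc, mul_assoc]
    -- The quadratic relation in the first leg, multiplied by the factors with which it occurs: `q1`
    -- in `[Nᵢ, Nⱼ]`, where the second leg is `mₖ`, and `q2` in `[Nᵢ, P₀]`, where it is `pᵢ`.
    have q0 := (H.map F).p0_eq
    have q1 := congrArg (fun y => F W * y * G (m k)) q0
    have q2 := congrArg (fun y => F W * y * G (p i)) q0
    have rF := (H.map F).toIsPoincare.normal c
    have rF' := (H.map F).toIsPoincare.normal_assoc c
    have rG := (H.map G).toIsPoincare.normal c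
    have rG' := (H.map G).toIsPoincare.normal_assoc c
    have sF := IsKappa.normal (H.map F) i j k
    have sF' := IsKappa.normal_assoc (H.map F) i j k
    have sG := IsKappa.normal (H.map G) i j k
    have sG' := IsKappa.normal_assoc (H.map G) i j k
    beta_reduce at rF rF' rG rG' sF sF' sG sG' q1 q2
    rw [sum_cyclic c] at q1 q2
    simp only [hN, hM, hP, hE, comulN_eq c, comulN_eq c.rot, comulN_eq c.rot.rot, comulP0,
      sum_cyclic c]
    simp only [mul_add, add_mul, mul_sub, sub_mul, mul_neg, neg_mul, smul_mul_assoc,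
      mul_smul_comm, smul_add, smul_sub, smul_neg, mul_assoc, hc, hc', rF, rF', sF, sF', rG, rG',
      sG, sG', pow_two, mul_one, one_mul] at q1 q2 ⊢
    refine ⟨?_, ?_, ?_, ?_, ?_, ?_, ?_, ?_, ?_, ?_, ?_, ?_, ?_, ?_, ?_⟩
    · module
    · module
    · module
    · module
    · linear_combination (norm := module) -q1
    · module
    · module
    · module
    · module
    · module
    · module
    · module
    · linear_combination (norm := module) -q2
    · module
    · module
  constructor <;> intro i
  · exact (main _ _ _ (.mk' i)).1
  · exact (main _ _ _ (.mk' i)).2.1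
  · exact (main _ _ _ (.mk' i)).2.2.1
  · exact (main _ _ _ (.mk' i)).2.2.2.1
  · exact (main _ _ _ (.mk' i)).2.2.2.2.1
  · exact (main _ _ _ (.mk' i)).2.2.2.2.2.1
  · exact (main _ _ _ (.mk' i)).2.2.2.2.2.2.1
  · exact (main _ _ _ (.mk' i)).2.2.2.2.2.2.2.1
  · exact (main _ _ _ (.mk' i)).2.2.2.2.2.2.2.2.1
  · exact (main _ _ _ (.mk' i)).2.2.2.2.2.2.2.2.2.1
  · exact (main _ _ _ (.mk' i)).2.2.2.2.2.2.2.2.2.2.1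
  · exact (main _ _ _ (.mk' i)).2.2.2.2.2.2.2.2.2.2.2.1
  · exact (main _ _ _ (.mk' i)).2.2.2.2.2.2.2.2.2.2.2.2.1
  · exact (main _ _ _ (.mk' i)).2.2.2.2.2.2.2.2.2.2.2.2.2.1
  · exact (main _ _ _ (.mk' i)).2.2.2.2.2.2.2.2.2.2.2.2.2.2

set_option linter.unusedSimpArgs false in
/-- The coproduct of `Ξ` satisfies the quadratic equation that determines it. -/
theorem IsKappa.comul_quadratic (H : IsKappa t m n p p0 X W) (F G : U →ₐ[R] A)
    (hc : ∀ a b, G b * F a = F a * G b) :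
    (2 * t) • comulP0 t p p0 X W F G = F X * G X - F W * G W +
      t ^ 2 • ((∑ i, (F (p i) * G X + G (p i)) ^ 2) * (F W * G W)) := by
  have c := Cyclic.mk' 0
  have hc' (a b : U) (x : A) : G b * (F a * x) = F a * (G b * x) := by
    rw [← mul_assoc, hc, mul_assoc]
  -- The quadratic relation of the first leg times `G X` plus that of the second leg times `F W`:
  -- the mixed terms `F W * G X` cancel.
  have q1 := congrArg (fun y => y * G X) (H.map F).p0_eq
  have q2 := congrArg (fun y => F W * y) (H.map G).p0_eq
  have rF := (H.map F).toIsPoincare.normal c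
  have rF' := (H.map F).toIsPoincare.normal_assoc c
  have rG := (H.map G).toIsPoincare.normal c
  have rG' := (H.map G).toIsPoincare.normal_assoc c
  have sF := IsKappa.normal (H.map F) 0 (0 + 1) (0 + 2)
  have sF' := IsKappa.normal_assoc (H.map F) 0 (0 + 1) (0 + 2)
  have sG := IsKappa.normal (H.map G) 0 (0 + 1) (0 + 2)
  have sG' := IsKappa.normal_assoc (H.map G) 0 (0 + 1) (0 + 2)
  beta_reduce at rF rF' rG rG' sF sF' sG sG' q1 q2
  rw [sum_cyclic c] at q1 q2
  simp only [comulP0, sum_cyclic c]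
  simp only [mul_add, add_mul, mul_sub, sub_mul, mul_neg, neg_mul, smul_mul_assoc,
    mul_smul_comm, smul_add, smul_sub, smul_neg, mul_assoc, hc, hc', rF, rF', sF, sF', rG, rG',
    sG, sG', pow_two, mul_one, one_mul] at q1 q2 ⊢
  linear_combination (norm := module) q1 + q2

/-! ## The deformed antipode -/

/-- The antipode of the boost `nᵢ`. -/
def antipodeN (t : R) (m n p : Fin 3 → U) (X : U) (i : Fin 3) : U :=
  -(X * n i) - t • (p (i + 1) * m (i + 2) - p (i + 2) * m (i + 1))

theorem antipodeN_eq {i j k : Fin 3} (c : Cyclic i j k) (t : R) (m n p : Fin 3 → U) (X : U) :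
    antipodeN t m n p X i = -(X * n i) - t • (p j * m k - p k * m j) := by
  obtain ⟨rfl, rfl⟩ := c
  rfl

/-- The antipode of the energy. -/
def antipodeP0 (t : R) (p : Fin 3 → U) (p0 W : U) : U := -p0 + t • ((∑ i, p i ^ 2) * W)

-- An anti-homomorphism is a homomorphism to the opposite algebra. As for the coproduct, normal
-- ordering settles every relation except `[N, N]` and `[N, P₀]`, for which the quadratic relation
-- is added.
set_option linter.unusedSimpArgs false in
set_option maxHeartbeats 2000000 in
theorem IsKappa.isPoincare_antipode (H : IsKappa t m n p p0 X W) :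
    IsPoincare (fun i => MulOpposite.op (-m i))
      (fun i => MulOpposite.op (antipodeN t m n p X i)) (fun i => MulOpposite.op (-(p i * W)))
      (MulOpposite.op (antipodeP0 t p p0 W)) := by
  set N := antipodeN t m n p X with hN
  set M : Fin 3 → U := fun i => -m i with hM
  set P : Fin 3 → U := fun i => -(p i * W) with hP
  set E := antipodeP0 t p p0 W with hE
  -- The relations of the opposite algebra, read in `U`: all products are reversed.
  have main (i j k : Fin 3) (c : Cyclic i j k) : (M j * M i - M i * M j = M k) ∧
      (N i * M i = M i * N i) ∧ (N j * M i - M i * N j = N k) ∧ (N k * M i - M i * N k = -N j) ∧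
      (N j * N i - N i * N j = -M k) ∧ (P i * M i = M i * P i) ∧
      (P j * M i - M i * P j = P k) ∧ (P k * M i - M i * P k = -P j) ∧ (E * M i = M i * E) ∧
      (P i * N i - N i * P i = -E) ∧ (P j * N i = N i * P j) ∧ (P k * N i = N i * P k) ∧
      (E * N i - N i * E = -P i) ∧ (P j * P i = P i * P j) ∧ (E * P i = P i * E) := by
    have q0 := H.p0_eq
    rw [sum_cyclic c] at q0
    have q1 := congrArg (fun y => X * y * m k) q0
    have q2 := congrArg (fun y => p i * y) q0
    have rF := H.toIsPoincare.normal c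
    have rF' := H.toIsPoincare.normal_assoc c
    have sF := IsKappa.normal H i j k
    have sF' := IsKappa.normal_assoc H i j k
    beta_reduce at q1 q2
    simp only [hN, hM, hP, hE, antipodeN_eq c, antipodeN_eq c.rot, antipodeN_eq c.rot.rot,
      antipodeP0, sum_cyclic c]
    simp only [mul_add, add_mul, mul_sub, sub_mul, mul_neg, neg_mul, smul_mul_assoc,
      mul_smul_comm, smul_add, smul_sub, smul_neg, mul_assoc, rF, rF', sF, sF', pow_two, mul_one,
      one_mul] at q1 q2 ⊢
    refine ⟨?_, ?_, ?_, ?_, ?_, ?_, ?_, ?_, ?_, ?_, ?_, ?_, ?_, ?_, ?_⟩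
    · module
    · module
    · module
    · module
    · linear_combination (norm := module) -q1
    · trivial
    · module
    · module
    · module
    · module
    · module
    · module
    · linear_combination (norm := module) -q2
    · trivial
    · module
  constructor <;> intro i
  all_goals
    obtain ⟨h1, h2, h3, h4, h5, h6, h7, h8, h9, h10, h11, h12, h13, h14, h15⟩ :=
      main _ _ _ (.mk' i)
    rw [← MulOpposite.unop_inj]
    assumption

end

/-! ## Structure maps in the classical basis -/

namespace HSeries

variable {B : Type} [Ring B] [Algebra ℂ B] {A : Type} [Ring A] [Algebra Ch A]

/-- Linear maps into a separated module are determined by their values on constants. -/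
theorem linearMap_ext [HSep A] {F G : HSeries B →ₗ[Ch] A} (H : ∀ b, F (C b) = G (C b)) :
    F = G := by
  refine LinearMap.ext fun f => HSep.eq_of_sub fun n => ?_
  obtain ⟨y, hy⟩ := eq_sum_add f n
  refine ⟨F y - G y, ?_⟩
  conv_lhs => rw [hy]
  simp only [map_add, map_sum, map_smul, H, smul_sub]
  abel

/-- Density in one variable at a time: first `g` is arbitrary and `f` constant, then both are
arbitrary. -/
theorem commute_map {B' : Type} [Ring B'] [Algebra ℂ B'] [HSep A] {F : HSeries B →ₐ[Ch] A}
    {G : HSeries B' →ₐ[Ch] A} (H : ∀ b b', F (C b) * G (C b') = G (C b') * F (C b))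
    (f : HSeries B) (g : HSeries B') : F f * G g = G g * F f := by
  have e1 (b : B) : (LinearMap.mulLeft Ch (F (C b))).comp G.toLinearMap =
      (LinearMap.mulRight Ch (F (C b))).comp G.toLinearMap := linearMap_ext fun b' => H b b'
  have e2 : (LinearMap.mulRight Ch (G g)).comp F.toLinearMap =
      (LinearMap.mulLeft Ch (G g)).comp F.toLinearMap :=
    linearMap_ext fun b => LinearMap.congr_fun (e1 b) g
  exact LinearMap.congr_fun e2 f

theorem algebraMap_cst (z : ℂ) : algebraMap Ch (HSeries B) (cst z) = C (algebraMap ℂ B z) :=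
  PowerSeries.map_C _ _

/-- The coefficientwise extension of an algebra homomorphism. -/
def mapHom {B' : Type} [Ring B'] [Algebra ℂ B'] (φ : B →ₐ[ℂ] B') : HSeries B →ₐ[Ch] HSeries B' :=
  lift ((CHom (B := B')).comp φ.toRingHom) fun z => by
    rw [algebraMap_cst]
    exact congrArg C (φ.commutes z)

theorem mapHom_C {B' : Type} [Ring B'] [Algebra ℂ B'] (φ : B →ₐ[ℂ] B') (b : B) :
    mapHom φ (C b) = C (φ b) :=
  lift_C _ _ b

variable (B) in
/-- `f ↦ f ⊗ 1`. -/
def inl : HSeries B →ₐ[Ch] HSeries (B ⊗[ℂ] B) := mapHom Algebra.TensorProduct.includeLeft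

variable (B) in
/-- `f ↦ 1 ⊗ f`. -/
def inr : HSeries B →ₐ[Ch] HSeries (B ⊗[ℂ] B) := mapHom Algebra.TensorProduct.includeRight

theorem inr_mul_inl (f g : HSeries B) : inr B g * inl B f = inl B f * inr B g :=
  commute_map (fun b b' => by
    rw [inr, inl, mapHom_C, mapHom_C, ← CHom_apply, ← CHom_apply, ← map_mul, ← map_mul]
    simp) g f

theorem exists_tensorHom : ∃ φ : B ⊗[ℂ] B →+* CTensor (HSeries B) (HSeries B),
    (∀ z, φ (algebraMap ℂ _ z) = algebraMap Ch _ (cst z)) ∧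
      (∀ a, φ (a ⊗ₜ 1) = CTensor.inl (C a)) ∧ ∀ b, φ (1 ⊗ₜ b) = CTensor.inr (C b) := by
  let _ : Algebra ℂ (CTensor (HSeries B) (HSeries B)) :=
    Algebra.compHom _ (PowerSeries.C : ℂ →+* Ch)
  let F (G : HSeries B →ₐ[Ch] CTensor (HSeries B) (HSeries B)) :
      B →ₐ[ℂ] CTensor (HSeries B) (HSeries B) :=
    { (G.toRingHom.comp CHom) with
      commutes' := fun z => by
        change G (C (algebraMap ℂ B z)) = algebraMap Ch _ (cst z)
        rw [← algebraMap_cst, AlgHom.commutes] }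
  let φ := Algebra.TensorProduct.lift (F CTensor.inl) (F CTensor.inr) fun a b =>
    (CTensor.inl_mul_inr (C a) (C b)).trans (CTensor.inr_mul_inl (C a) (C b)).symm
  refine ⟨φ.toRingHom, fun z => φ.commutes z, fun a => ?_, fun b => ?_⟩
  · exact (Algebra.TensorProduct.lift_tmul ..).trans (by rw [map_one, mul_one]; rfl)
  · exact (Algebra.TensorProduct.lift_tmul ..).trans (by rw [map_one, one_mul]; rfl)

variable (B) in
/-- The canonical map from `(B ⊗ B)[[h]]` to the completed tensor product. -/
def toCTensor : HSeries (B ⊗[ℂ] B) →ₐ[Ch] CTensor (HSeries B) (HSeries B) :=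
  lift (A := CTensor (HSeries B) (HSeries B)) exists_tensorHom.choose exists_tensorHom.choose_spec.1

theorem toCTensor_inl (f : HSeries B) : toCTensor B (inl B f) = ctmul f 1 := by
  have e : (toCTensor B).comp (inl B) = CTensor.inl :=
    algHom_ext (A := CTensor (HSeries B) (HSeries B)) fun b => by
    rw [AlgHom.comp_apply, inl, mapHom_C, toCTensor, lift_C]
    exact exists_tensorHom.choose_spec.2.1 b
  exact DFunLike.congr_fun e f

theorem toCTensor_inr (f : HSeries B) : toCTensor B (inr B f) = ctmul 1 f := by
  have e : (toCTensor B).comp (inr B) = CTensor.inr :=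
    algHom_ext (A := CTensor (HSeries B) (HSeries B)) fun b => by
    rw [AlgHom.comp_apply, inr, mapHom_C, toCTensor, lift_C]
    exact exists_tensorHom.choose_spec.2.2 b
  exact DFunLike.congr_fun e f

theorem toCTensor_inl_mul_inr (f g : HSeries B) :
    toCTensor B (inl B f * inr B g) = ctmul f g := by
  rw [map_mul, toCTensor_inl, toCTensor_inr, ← CTensor.inl_apply, ← CTensor.inr_apply,
    CTensor.inl_mul_inr]

/-- In a general target no evaluation of power series is available, so the contraction is applied to
the image of the evaluated series. -/
theorem commute_map_eval [HSep A] (F : HSeries B →ₐ[Ch] A) {a : HSeries B} (ha : coeff 0 a = 0)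
    {x : A} (hx : Commute x (F a)) (f : PowerSeries ℂ) : Commute x (F (eval f a)) := by
  have hF : ∃ y, F a = h • y := ⟨F (divH a), by rw [← map_smul, h_smul_divH a ha]⟩
  refine sub_eq_zero.1 (eq_zero_of_shift hF
    (fun f => x * F (eval f a) - F (eval f a) * x) (fun f => ?_) f)
  rw [eval_step f ha, map_add, map_smul, map_one, map_mul, mul_add, add_mul, smul_mul_assoc,
    mul_smul_comm, one_mul, mul_one, mul_sub, ← mul_assoc, hx.eq, mul_assoc, mul_assoc]
  abel

end HSeries

/-- Uniqueness of the square root: `(a - b)(a + b) = 0`, and `a + b` is `2` modulo `h`, hence not a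
zero divisor. -/
theorem eq_of_mul_self_eq {A : Type} [Ring A] [Algebra Ch A] [HSep A] {a b : A}
    (ha : ∃ y, a = 1 + h • y) (hb : ∃ y, b = 1 + h • y) (hab : Commute a b)
    (H : a * a = b * b) : a = b := by
  have e : (a - b) * (a + b) = 0 := by
    rw [sub_mul, mul_add, mul_add, H, hab.eq]
    abel
  obtain ⟨y, hy⟩ := ha
  obtain ⟨z, hz⟩ := hb
  refine sub_eq_zero.1 (HSeries.eq_zero_of_mul_eq_zero two_ne_zero (y := y + z) ?_ e)
  rw [hy, hz, smul_add, show cst 2 = 1 + 1 by rw [cst, map_ofNat]; norm_num, add_smul, one_smul]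
  abel

namespace HSeries

theorem exists_eq_one_add {B : Type} [Ring B] [Algebra ℂ B] {a : HSeries B}
    (ha : coeff 0 a = 1) : ∃ y, a = 1 + h • y :=
  ⟨divH a, by
    conv_lhs => rw [eq_C_add_h_smul a, ha]
    rfl⟩

end HSeries

namespace Classical

open HSeries

theorem coeff_zero_XiInv : coeff 0 XiInv = 1 := by
  have := congrArg (coeff 0) Xi_mul_XiInv
  rwa [coeff_zero_mul, coeff_zero_Xi, one_mul, coeff_one, if_pos rfl] at this

/-- A homomorphism maps `Ξ` to any solution of the same quadratic equation that is `1` modulo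
`h`. -/
theorem map_Xi_eq {A : Type} [Ring A] [Algebra Ch A] [HSep A] (F : UP →ₐ[Ch] A) {x w : A}
    (hwx : w * x = 1) (hx : ∃ y, x = 1 + h • y) (hP : ∀ i, Commute x (F (P i)))
    (hP0 : Commute x (F P0))
    (q : (2 * h) • F P0 = x - w + h ^ 2 • ((∑ i, F (P i) ^ 2) * w)) : F Xi = x := by
  have hroot : F root = x - h • F P0 := by
    have hPSq : F PSq = ∑ i, F (P i) ^ 2 - F P0 ^ 2 := by
      simp only [PSq, vecPSq, map_sub, map_sum, map_pow]
    have hc : Commute x (F PSq) := by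
      rw [hPSq]
      exact (Commute.sum_right _ _ _ fun i _ => (hP i).pow_right 2).sub_right (hP0.pow_right 2)
    have hc0 : Commute (F P0) (F PSq) := commute_P0_PSq.map F
    have hneg {y : A} (hy : Commute y (F PSq)) : Commute y (F (-(h ^ 2 • PSq))) := by
      rw [map_neg, map_smul]
      exact (hy.smul_right _).neg_right
    have hxr : Commute x (F root) :=
      commute_map_eval F (coeff_zero_neg_h_sq_smul PSq) (hneg hc) sqrtSeries
    have h0r : Commute (F P0) (F root) :=
      commute_map_eval F (coeff_zero_neg_h_sq_smul PSq) (hneg hc0) sqrtSeries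
    obtain ⟨y, hy⟩ := hx
    obtain ⟨z, hz⟩ := exists_eq_one_add coeff_zero_root
    refine eq_of_mul_self_eq ⟨F z, by rw [hz, map_add, map_one, map_smul]⟩
      ⟨y - F P0, by rw [hy, smul_sub]; abel⟩ ?_ ?_
    · exact hxr.symm.sub_right (h0r.symm.smul_right _)
    -- Multiplication by `x` removes `w`: `x² = 2h F(P₀) x + 1 - h² ∑ F(Pᵢ)²`. Completing the square
    -- gives `(x - h F(P₀))² = F(1 - h²P²)`.
    · have q' := congrArg (· * x) q
      simp only [add_mul, sub_mul, smul_mul_assoc, mul_assoc, hwx, mul_one] at q'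
      rw [← map_mul, root_mul_root, map_sub, map_one, map_smul, hPSq, sub_mul, mul_sub, mul_sub,
        mul_smul_comm, smul_mul_assoc, hP0.eq, smul_mul_smul_comm, ← pow_two, ← pow_two h,
        smul_sub]
      have e : x ^ 2 = (2 * h) • (F P0 * x) + 1 - h ^ 2 • ∑ i, F (P i) ^ 2 := by
        rw [q', pow_two]
        abel
      rw [e, two_mul, add_smul, ← pow_two (F P0)]
      abel
  rw [Xi, map_add, map_smul, hroot]
  abel

theorem map_XiInv_eq {A : Type} [Ring A] [Algebra Ch A] {F : UP →ₐ[Ch] A} {x w : A}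
    (hxw : x * w = 1) (hF : F Xi = x) : F XiInv = w := by
  rw [← mul_one (F XiInv), ← hxw, ← hF, ← mul_assoc, ← map_mul, XiInv_mul_Xi, map_one, one_mul]

/-! ### The coproduct -/

/-- The enveloping algebra of `io(1,3)`. -/
abbrev U : Type := UniversalEnvelopingAlgebra ℂ Poincare

/-- The target is `(U ⊗ U)[[h]]` rather than the completed tensor product, so that exponentials and
logarithms can be evaluated in it. -/
theorem isPoincare_comul : IsPoincare (fun i => inl U (m i) + inr U (m i))
    (comulN h m n P XiInv (inl U) (inr U)) (fun i => inl U (P i) * inr U Xi + inr U (P i))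
    (comulP0 h P P0 Xi XiInv (inl U) (inr U)) :=
  isKappa.isPoincare_comul (inl U) (inr U) fun f g => inr_mul_inl f g

/-- The coproduct, with values in `(U ⊗ U)[[h]]`. -/
def comulSeries : UP →ₐ[Ch] HSeries (U ⊗[ℂ] U) := isPoincare_comul.lift

theorem comulSeries_M (i : Fin 3) : comulSeries (M i) = inl U (M i) + inr U (M i) := by
  rw [comulSeries, IsPoincare.lift_M, M_eq, map_smul, map_smul, smul_add]

theorem comulSeries_P (i : Fin 3) :
    comulSeries (P i) = inl U (P i) * inr U Xi + inr U (P i) := by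
  rw [comulSeries, IsPoincare.lift_P]

theorem comulSeries_P0 : comulSeries P0 = inl U P0 * inr U Xi + inl U XiInv * inr U P0 +
    h • ∑ l, inl U (P l * XiInv) * inr U (P l) := by
  rw [comulSeries, IsPoincare.lift_P0, comulP0]
  simp only [map_mul]

theorem comulSeries_N (i : Fin 3) :
    comulSeries (N i) = inl U (N i) + inl U XiInv * inr U (N i) -
      h • (inl U (P (i + 1) * XiInv) * inr U (M (i + 2)) -
        inl U (P (i + 2) * XiInv) * inr U (M (i + 1))) := by
  rw [comulSeries, IsPoincare.lift_N, comulN]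
  simp only [N_eq, M_eq, map_smul, map_mul, mul_smul_comm, smul_sub, smul_add,
    smul_comm h (cst Complex.I)]

/-- `Ξ ⊗ Ξ` is `1` modulo `h`, commutes with the coproducts of the momenta and solves the quadratic
equation for them (`IsKappa.comul_quadratic`), so `map_Xi_eq` identifies it as the coproduct of `Ξ`.
-/
theorem comulSeries_Xi : comulSeries Xi = inl U Xi * inr U Xi := by
  have hc (f g : UP) : Commute (inl U f) (inr U g) := (inr_mul_inl f g).symm
  have hl {f g : UP} (e : f * g = g * f) : Commute (inl U f) (inl U g) := Commute.map e _
  have hr {f g : UP} (e : f * g = g * f) : Commute (inr U f) (inr U g) := Commute.map e _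
  have K := isKappa
  have hX {f : UP} (e : f * Xi = Xi * f) : Commute (inl U Xi * inr U Xi) (inl U f) :=
    (hl e.symm).mul_left (hc _ _).symm
  have hX' {f : UP} (e : f * Xi = Xi * f) : Commute (inl U Xi * inr U Xi) (inr U f) :=
    (hc _ _).mul_left (hr e.symm)
  have hW : XiInv * Xi = Xi * XiInv := by rw [XiInv_mul_Xi, Xi_mul_XiInv]
  have hPW (i : Fin 3) : P i * XiInv * Xi = Xi * (P i * XiInv) := by
    rw [mul_assoc, hW, ← mul_assoc, K.p_X, mul_assoc]
  refine map_Xi_eq comulSeries (w := inl U XiInv * inr U XiInv) ?_ ?_ (fun i => ?_) ?_ ?_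
  · rw [mul_assoc, ← mul_assoc (inr U XiInv), inr_mul_inl, mul_assoc, ← map_mul (inr U),
      XiInv_mul_Xi, map_one, mul_one, ← map_mul, XiInv_mul_Xi, map_one]
  · obtain ⟨y, hy⟩ := exists_eq_one_add coeff_zero_Xi
    refine ⟨inl U y * inr U Xi + inr U y, ?_⟩
    conv_lhs => rw [hy, map_add, map_smul, add_mul, map_one, one_mul, smul_mul_assoc, ← hy]
    conv_lhs => enter [1]; rw [hy, map_add, map_smul, map_one]
    rw [smul_add]
    abel
  · rw [comulSeries_P]
    exact ((hX (K.p_X i)).mul_right (hX' rfl)).add_right (hX' (K.p_X i))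
  · rw [comulSeries_P0]
    refine (((hX K.p0_X).mul_right (hX' rfl)).add_right ((hX hW).mul_right (hX' K.p0_X))).add_right
      ((Commute.sum_right _ _ _ fun i _ => ?_).smul_right _)
    exact (hX (hPW i)).mul_right (hX' (K.p_X i))
  · have q := isKappa.comul_quadratic (inl U) (inr U) fun f g => inr_mul_inl f g
    simp only [comulSeries_P]
    rw [comulSeries, IsPoincare.lift_P0, q]

theorem comulSeries_XiInv : comulSeries XiInv = inl U XiInv * inr U XiInv := by
  refine map_XiInv_eq ?_ comulSeries_Xi
  rw [mul_assoc, ← mul_assoc (inr U Xi), inr_mul_inl, mul_assoc, ← map_mul (inr U),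
    Xi_mul_XiInv, map_one, mul_one, ← map_mul, Xi_mul_XiInv, map_one]

/-- The coproduct. -/
def comul : UP →ₐ[Ch] CTensor UP UP := (toCTensor U).comp comulSeries

theorem comul_M (i : Fin 3) : comul (M i) = ctmul (M i) 1 + ctmul 1 (M i) := by
  rw [comul, AlgHom.comp_apply, comulSeries_M, map_add, toCTensor_inl, toCTensor_inr]

theorem comul_P (i : Fin 3) : comul (P i) = ctmul (P i) Xi + ctmul 1 (P i) := by
  rw [comul, AlgHom.comp_apply, comulSeries_P, map_add, toCTensor_inl_mul_inr, toCTensor_inr]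

theorem comul_P0 : comul P0 = ctmul P0 Xi + ctmul XiInv P0 +
    h • ∑ l, ctmul (P l * XiInv) (P l) := by
  rw [comul, AlgHom.comp_apply, comulSeries_P0]
  simp only [map_add, map_smul, map_sum, toCTensor_inl_mul_inr]

theorem comul_N (i : Fin 3) : comul (N i) = ctmul (N i) 1 + ctmul XiInv (N i) -
    h • (ctmul (P (i + 1) * XiInv) (M (i + 2)) - ctmul (P (i + 2) * XiInv) (M (i + 1))) := by
  rw [comul, AlgHom.comp_apply, comulSeries_N]
  simp only [map_add, map_sub, map_smul, toCTensor_inl_mul_inr, toCTensor_inl]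

theorem comul_Xi : comul Xi = ctmul Xi Xi := by
  rw [comul, AlgHom.comp_apply, comulSeries_Xi, toCTensor_inl_mul_inr]

theorem comul_XiInv : comul XiInv = ctmul XiInv XiInv := by
  rw [comul, AlgHom.comp_apply, comulSeries_XiInv, toCTensor_inl_mul_inr]

end Classical

/-- `ℂ[[h]]`, as power series with coefficients in the algebra `ℂ`. -/
def seriesEquiv : HSeries ℂ ≃ₗ[Ch] Ch where
  toFun f := f
  invFun f := f
  map_add' _ _ := rfl
  map_smul' c f := by
    have e : (HSeries.scalar c : HSeries ℂ) = c := HSeries.ext fun n => HSeries.coeff_scalar n c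
    rw [HSeries.smul_def', e]
    rfl
  left_inv _ := rfl
  right_inv _ := rfl

instance : HComplete Ch := .of_linearEquiv seriesEquiv

namespace Classical

/-! ### The counit and the antipode -/

/-- The counit. -/
def counit : UP →ₐ[Ch] Ch :=
  IsPoincare.lift (m := 0) (n := 0) (p := 0) (p0 := 0) (by constructor <;> simp)

theorem counit_inc (x : Poincare) : counit (inc x) = 0 := by
  rw [counit, IsPoincare.lift_inc]
  simp [IsPoincare.toFun]

theorem counit_Xi : counit Xi = 1 := by
  have hP0 : counit P0 = 0 := counit_inc _
  have hP (i : Fin 3) : counit (P i) = 0 := counit_inc _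
  refine map_Xi_eq counit (w := 1) (one_mul 1) ⟨0, by simp⟩ (fun i => Commute.all _ _)
    (Commute.all _ _) ?_
  simp [hP0, hP]

theorem counit_XiInv : counit XiInv = 1 := map_XiInv_eq (one_mul 1) counit_Xi

/-- The antipode, as a homomorphism to the opposite algebra. -/
def antipodeHom : UP →ₐ[Ch] UPᵐᵒᵖ := isKappa.isPoincare_antipode.lift

/-- The antipode. -/
def antipode : UP →ₗ[Ch] UP :=
  (MulOpposite.opLinearEquiv Ch).symm.toLinearMap ∘ₗ antipodeHom.toLinearMap

theorem antipode_apply (x : UP) : antipode x = (antipodeHom x).unop := rfl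

theorem antipode_mul (x y : UP) : antipode (x * y) = antipode y * antipode x := by
  rw [antipode_apply, map_mul, MulOpposite.unop_mul]
  rfl

theorem antipode_one : antipode 1 = 1 := by
  rw [antipode_apply, map_one, MulOpposite.unop_one]

theorem antipode_M (i : Fin 3) : antipode (M i) = -M i := by
  rw [antipode_apply, antipodeHom, IsPoincare.lift_M, M_eq]
  simp

theorem antipode_P (i : Fin 3) : antipode (P i) = -(P i * XiInv) := by
  rw [antipode_apply, antipodeHom, IsPoincare.lift_P, MulOpposite.unop_op]

theorem antipode_P0 : antipode P0 = -P0 + h • (vecPSq * XiInv) := by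
  rw [antipode_apply, antipodeHom, IsPoincare.lift_P0, MulOpposite.unop_op]
  rfl

theorem antipode_N (i : Fin 3) : antipode (N i) = -(Xi * N i) -
    h • (P (i + 1) * M (i + 2) - P (i + 2) * M (i + 1)) := by
  rw [antipode_apply, antipodeHom, IsPoincare.lift_N, MulOpposite.unop_smul, MulOpposite.unop_op,
    antipodeN]
  simp only [N_eq, M_eq, mul_smul_comm, smul_sub, smul_neg, smul_comm h (cst Complex.I)]

/-- `Ξ⁻¹` solves the quadratic equation with `S(Pᵢ)`, `S(P₀)` in place of `Pᵢ`, `P₀` and the roles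
of `Ξ` and `Ξ⁻¹` exchanged. -/
theorem antipode_Xi : antipode Xi = XiInv := by
  have K := isKappa
  have hW {x : UP} (e : x * Xi = Xi * x) : x * XiInv = XiInv * x := K.commute_W e
  have hop {x : UP} (e : x * XiInv = XiInv * x) :
      Commute (MulOpposite.op XiInv) (MulOpposite.op x) := congrArg MulOpposite.op e
  have hv : vecPSq * XiInv = XiInv * vecPSq := by
    refine (Commute.sum_left _ _ _ fun i _ => ?_ : Commute vecPSq XiInv)
    exact Commute.pow_left (hW (K.p_X i)) 2
  have e : antipodeHom Xi = MulOpposite.op XiInv := by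
    refine map_Xi_eq antipodeHom (w := MulOpposite.op Xi) ?_ ?_ (fun i => ?_) ?_ ?_
    · rw [← MulOpposite.op_mul, XiInv_mul_Xi, MulOpposite.op_one]
    · obtain ⟨y, hy⟩ := HSeries.exists_eq_one_add coeff_zero_XiInv
      exact ⟨MulOpposite.op y, by rw [hy]; rfl⟩
    · rw [antipodeHom, IsPoincare.lift_P]
      refine hop ?_
      rw [neg_mul, mul_neg, mul_assoc, ← mul_assoc XiInv, ← hW (K.p_X i), mul_assoc]
    · rw [antipodeHom, IsPoincare.lift_P0]
      refine hop ?_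
      rw [antipodeP0, add_mul, mul_add, neg_mul, mul_neg, hW K.p0_X, smul_mul_assoc,
        mul_smul_comm, ← vecPSq, hv, mul_assoc, hv]
    · rw [antipodeHom, IsPoincare.lift_P0]
      simp only [IsPoincare.lift_P]
      apply MulOpposite.unop_injective
      have hs : ∑ i, (P i * XiInv) * (P i * XiInv) = vecPSq * (XiInv * XiInv) := by
        rw [vecPSq, Finset.sum_mul]
        refine Finset.sum_congr rfl fun i _ => ?_
        rw [pow_two, mul_assoc, ← mul_assoc XiInv, ← hW (K.p_X i)]
        simp only [mul_assoc]
      have e2 : Xi * (vecPSq * (XiInv * XiInv)) = vecPSq * XiInv := by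
        rw [← mul_assoc vecPSq, hv, ← mul_assoc, ← mul_assoc, Xi_mul_XiInv, one_mul, hv]
      simp only [MulOpposite.unop_smul, MulOpposite.unop_add, MulOpposite.unop_sub,
        MulOpposite.unop_mul, MulOpposite.unop_op, Finset.unop_sum, MulOpposite.unop_pow,
        neg_sq]
      simp only [pow_two (P _ * XiInv)]
      -- Since `∑ S(Pᵢ)² Ξ = P⃗² Ξ⁻¹`, the equation is the original quadratic relation with the sign
      -- of `2hP₀` reversed by `S(P₀) = -P₀ + h P⃗² Ξ⁻¹`.
      rw [hs, e2, antipodeP0, ← vecPSq, smul_add, smul_neg, K.p0_eq, ← vecPSq, smul_smul, two_mul,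
        add_mul, ← pow_two, add_smul]
      abel
  rw [antipode_apply, e, MulOpposite.unop_op]

theorem antipode_XiInv : antipode XiInv = Xi := by
  rw [← mul_one (antipode XiInv), ← XiInv_mul_Xi, ← mul_assoc, ← antipode_Xi, ← antipode_mul,
    antipode_Xi, Xi_mul_XiInv, antipode_one, one_mul]

/-! ### The Hopf algebra axioms -/

theorem red_Xi_mul_red_XiInv (n : ℕ) : red UP n Xi * red UP n XiInv = 1 := by
  rw [← map_mul, Xi_mul_XiInv, map_one]

theorem redComul_M (n : ℕ) (i : Fin 3) : redComul comul n (red UP n (M i)) =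
    red UP n (M i) ⊗ₜ[Ch] 1 + 1 ⊗ₜ[Ch] red UP n (M i) := by
  rw [redComul_red, comul_M, map_add]
  simp only [CTensor.level_ctmul, map_one]

theorem redComul_P (n : ℕ) (i : Fin 3) : redComul comul n (red UP n (P i)) =
    red UP n (P i) ⊗ₜ[Ch] red UP n Xi + 1 ⊗ₜ[Ch] red UP n (P i) := by
  rw [redComul_red, comul_P, map_add]
  simp only [CTensor.level_ctmul, map_one]

theorem redComul_Xi (n : ℕ) :
    redComul comul n (red UP n Xi) = red UP n Xi ⊗ₜ[Ch] red UP n Xi := by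
  rw [redComul_red, comul_Xi, CTensor.level_ctmul]

theorem redComul_XiInv (n : ℕ) :
    redComul comul n (red UP n XiInv) = red UP n XiInv ⊗ₜ[Ch] red UP n XiInv := by
  rw [redComul_red, comul_XiInv, CTensor.level_ctmul]

theorem redComul_N (n : ℕ) (i : Fin 3) : redComul comul n (red UP n (N i)) =
    red UP n (N i) ⊗ₜ[Ch] 1 + red UP n XiInv ⊗ₜ[Ch] red UP n (N i) -
      h • (red UP n (P (i + 1) * XiInv) ⊗ₜ[Ch] red UP n (M (i + 2)) -
        red UP n (P (i + 2) * XiInv) ⊗ₜ[Ch] red UP n (M (i + 1))) := by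
  rw [redComul_red, comul_N, map_sub (CTensor.level (A := UP) (B := UP) n), map_add,
    map_smul, map_sub (CTensor.level (A := UP) (B := UP) n)]
  simp only [CTensor.level_ctmul, map_one]

theorem redComul_P0 (n : ℕ) : redComul comul n (red UP n P0) =
    red UP n P0 ⊗ₜ[Ch] red UP n Xi + red UP n XiInv ⊗ₜ[Ch] red UP n P0 +
      h • ∑ l, red UP n (P l * XiInv) ⊗ₜ[Ch] red UP n (P l) := by
  rw [redComul_red, comul_P0]
  simp only [map_add, map_smul, map_sum, CTensor.level_ctmul]

/-- `PᵢΞ⁻¹` is skew-primitive. It is the combination in the coproducts of `N` and `P₀`, which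
reduces their coassociativity to a comparison of tensors. -/
theorem redComul_P_mul_XiInv (n : ℕ) (i : Fin 3) : redComul comul n (red UP n (P i * XiInv)) =
    red UP n (P i * XiInv) ⊗ₜ[Ch] 1 + red UP n XiInv ⊗ₜ[Ch] red UP n (P i * XiInv) := by
  rw [redComul_red, map_mul, comul_P, comul_XiInv, map_mul, map_add]
  simp only [CTensor.level_ctmul, add_mul, Algebra.TensorProduct.tmul_mul_tmul, map_one, one_mul,
    red_Xi_mul_red_XiInv]
  rw [← map_mul]

theorem h_pow_smul_tensor_tensor (n : ℕ) (x : Red UP n ⊗[Ch] (Red UP n ⊗[Ch] Red UP n)) :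
    h ^ n • x = 0 := by
  induction x with
  | zero => simp
  | add x y hx hy => rw [smul_add, hx, hy, add_zero]
  | tmul x y => rw [TensorProduct.smul_tmul', h_pow_smul_red, TensorProduct.zero_tmul]

theorem comul_coassoc (n : ℕ) :
    (((Algebra.TensorProduct.assoc Ch Ch Ch (Red UP n) (Red UP n) (Red UP n)).toAlgHom.comp
      (Algebra.TensorProduct.map (redComul comul n) (AlgHom.id Ch (Red UP n)))).comp
        (redComul comul n)).comp (red UP n) =
    ((Algebra.TensorProduct.map (AlgHom.id Ch (Red UP n)) (redComul comul n)).comp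
      (redComul comul n)).comp (red UP n) := by
  have : HComplete (Red UP n ⊗[Ch] (Red UP n ⊗[Ch] Red UP n)) :=
    .of_h_pow_smul (n := n) (h_pow_smul_tensor_tensor n)
  have h1 : redComul comul n 1 = 1 ⊗ₜ[Ch] 1 := map_one _
  let α := (Algebra.TensorProduct.assoc Ch Ch Ch (Red UP n) (Red UP n) (Red UP n)).toAlgHom
  have hα (x y z : Red UP n) : α (x ⊗ₜ y ⊗ₜ z) = x ⊗ₜ (y ⊗ₜ z) := rfl
  change ((α.comp _).comp _).comp _ = _
  -- Both sides are algebra homomorphisms into an algebra killed by `hⁿ`, so the generators suffice.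
  refine algHom_ext (fun i => ?_) (fun i => ?_) ?_ fun i => ?_ <;>
    simp only [AlgHom.comp_apply]
  · simp only [redComul_M, h1, map_add, Algebra.TensorProduct.map_tmul, AlgHom.id_apply,
      TensorProduct.add_tmul, TensorProduct.tmul_add, hα]
    abel
  · simp only [redComul_N, redComul_M, redComul_XiInv, redComul_P_mul_XiInv, h1, map_add, map_sub,
      map_smul, Algebra.TensorProduct.map_tmul, AlgHom.id_apply, TensorProduct.add_tmul,
      TensorProduct.sub_tmul, TensorProduct.tmul_add, TensorProduct.tmul_sub, hα,
      TensorProduct.tmul_smul, ← TensorProduct.smul_tmul', smul_add, smul_sub]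
    abel
  · simp only [redComul_P0, redComul_P, redComul_Xi, redComul_XiInv, redComul_P_mul_XiInv, map_add,
      map_smul, map_sum, Algebra.TensorProduct.map_tmul, AlgHom.id_apply, TensorProduct.add_tmul,
      TensorProduct.tmul_add, hα, TensorProduct.tmul_smul, TensorProduct.tmul_sum,
      TensorProduct.sum_tmul, ← TensorProduct.smul_tmul', smul_add, Finset.sum_add_distrib]
    abel
  · simp only [redComul_P, redComul_Xi, h1, map_add, Algebra.TensorProduct.map_tmul,
      AlgHom.id_apply, TensorProduct.add_tmul, TensorProduct.tmul_add, hα]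
    abel

end Classical

theorem CTensor.sum_eps_smul {A B : Type} [Ring A] [Algebra Ch A] [Ring B] [Algebra Ch B]
    (f : Fin 3 → Fin 3 → CTensor A B) (i : Fin 3) :
    ∑ j, ∑ k, cst (eps i j k) • f j k = f (i + 1) (i + 2) - f (i + 2) (i + 1) := by
  let _ : AddCommGroup (CTensor A B) := (CTensor A B).toRing.toAddCommGroup
  exact KappaPoincare.sum_eps_smul f i

namespace Classical

open HSeries

/-- Linear maps whose equalizer is closed under products agree as soon as they agree on the
generators. -/
theorem linearMap_ext {A : Type} [Ring A] [Algebra Ch A] [HSep A] {F G : UP →ₗ[Ch] A}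
    (h1 : F 1 = G 1) (hmul : ∀ x y, F x = G x → F y = G y → F (x * y) = G (x * y))
    (hM : ∀ i, F (M i) = G (M i)) (hN : ∀ i, F (N i) = G (N i)) (hP0 : F P0 = G P0)
    (hP : ∀ i, F (P i) = G (P i)) : F = G := by
  have hinc (x : Poincare) : F (inc x) = G (inc x) := by
    rw [inc_eq]
    simp only [map_add, map_sum, map_smul, hM, hN, hP0, hP]
  refine HSeries.linearMap_ext fun b => ?_
  have hb : b ∈ Algebra.adjoin ℂ (Set.range (UniversalEnvelopingAlgebra.ι ℂ (L := Poincare))) := by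
    rw [adjoin_range_ι]; trivial
  induction hb using Algebra.adjoin_induction with
  | mem x hx =>
    obtain ⟨y, rfl⟩ := hx
    exact hinc y
  | algebraMap z =>
    rw [← algebraMap_cst, Algebra.algebraMap_eq_smul_one, map_smul, map_smul, h1]
  | add x y _ _ hx hy =>
    simp only [← CHom_apply] at hx hy ⊢
    rw [map_add, map_add, map_add, hx, hy]
  | mul x y _ _ hx hy =>
    simp only [← CHom_apply] at hx hy ⊢
    rw [map_mul]
    exact hmul _ _ hx hy

theorem counit_M (i : Fin 3) : counit (M i) = 0 := counit_inc _

theorem counit_N (i : Fin 3) : counit (N i) = 0 := counit_inc _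

theorem counit_P0 : counit P0 = 0 := counit_inc _

theorem counit_P (i : Fin 3) : counit (P i) = 0 := counit_inc _

theorem counit_comul (n : ℕ) (a : UP) :
    (redLin counit.toLinearMap n).rTensor (Red UP n) (CTensor.level n (comul a)) =
      1 ⊗ₜ[Ch] red UP n a := by
  let F : UP →ₐ[Ch] Red Ch n ⊗[Ch] Red UP n :=
    (Algebra.TensorProduct.map (redHom counit n) (AlgHom.id Ch (Red UP n))).comp
      ((CTensor.level n).comp comul)
  let G : UP →ₐ[Ch] Red Ch n ⊗[Ch] Red UP n :=
    Algebra.TensorProduct.includeRight.comp (red UP n)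
  suffices e : F = G from DFunLike.congr_fun e a
  have hF (x : UP) : F x = Algebra.TensorProduct.map (redHom counit n) (AlgHom.id Ch (Red UP n))
      (redComul comul n (red UP n x)) := rfl
  have hG (x : UP) : G x = 1 ⊗ₜ[Ch] red UP n x := rfl
  refine algHom_ext (fun i => ?_) (fun i => ?_) ?_ fun i => ?_
  · rw [hF, hG, redComul_M]
    simp only [map_add, Algebra.TensorProduct.map_tmul, redHom_red, counit_M, map_zero,
      TensorProduct.zero_tmul, zero_add, map_one, AlgHom.id_apply]
  · rw [hF, hG, redComul_N]
    simp only [map_add, map_sub, map_smul, Algebra.TensorProduct.map_tmul, redHom_red, counit_N,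
      map_mul, counit_P, counit_XiInv, zero_mul, map_zero, TensorProduct.zero_tmul, zero_add,
      map_one, AlgHom.id_apply, sub_zero, smul_zero]
  · rw [hF, hG, redComul_P0]
    simp only [map_add, map_sum, map_smul, Algebra.TensorProduct.map_tmul, redHom_red, counit_P0,
      map_mul, counit_P, counit_XiInv, zero_mul, map_zero, TensorProduct.zero_tmul, zero_add,
      map_one, AlgHom.id_apply, Finset.sum_const_zero, smul_zero, add_zero]
  · rw [hF, hG, redComul_P]
    simp only [map_add, Algebra.TensorProduct.map_tmul, redHom_red, counit_P, map_zero,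
      TensorProduct.zero_tmul, zero_add, map_one, AlgHom.id_apply]

theorem comul_counit (n : ℕ) (a : UP) :
    (redLin counit.toLinearMap n).lTensor (Red UP n) (CTensor.level n (comul a)) =
      red UP n a ⊗ₜ[Ch] 1 := by
  let F : UP →ₐ[Ch] Red UP n ⊗[Ch] Red Ch n :=
    (Algebra.TensorProduct.map (AlgHom.id Ch (Red UP n)) (redHom counit n)).comp
      ((CTensor.level n).comp comul)
  let G : UP →ₐ[Ch] Red UP n ⊗[Ch] Red Ch n :=
    Algebra.TensorProduct.includeLeft.comp (red UP n)
  suffices e : F = G from DFunLike.congr_fun e a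
  have hF (x : UP) : F x = Algebra.TensorProduct.map (AlgHom.id Ch (Red UP n)) (redHom counit n)
      (redComul comul n (red UP n x)) := rfl
  have hG (x : UP) : G x = red UP n x ⊗ₜ[Ch] 1 := rfl
  refine algHom_ext (fun i => ?_) (fun i => ?_) ?_ fun i => ?_
  · rw [hF, hG, redComul_M]
    simp only [map_add, Algebra.TensorProduct.map_tmul, redHom_red, counit_M, map_zero,
      TensorProduct.tmul_zero, add_zero, map_one, AlgHom.id_apply]
  · rw [hF, hG, redComul_N]
    simp only [map_add, map_sub, map_smul, Algebra.TensorProduct.map_tmul, redHom_red, counit_N,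
      counit_M, map_zero, TensorProduct.tmul_zero, add_zero, map_one, AlgHom.id_apply, sub_zero,
      smul_zero]
  · rw [hF, hG, redComul_P0]
    simp only [map_add, map_sum, map_smul, Algebra.TensorProduct.map_tmul, redHom_red, counit_P0,
      counit_P, counit_Xi, map_zero, TensorProduct.tmul_zero, add_zero, map_one,
      AlgHom.id_apply, Finset.sum_const_zero, smul_zero]
  · rw [hF, hG, redComul_P]
    simp only [map_add, Algebra.TensorProduct.map_tmul, redHom_red, counit_P, counit_Xi, map_zero,
      TensorProduct.tmul_zero, add_zero, map_one, AlgHom.id_apply]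

theorem redLin_antipode_mul (n : ℕ) (x y : Red UP n) :
    redLin antipode n (x * y) = redLin antipode n y * redLin antipode n x := by
  obtain ⟨a, rfl⟩ := red_surjective n x
  obtain ⟨b, rfl⟩ := red_surjective n y
  rw [← map_mul, redLin_red, redLin_red, redLin_red, antipode_mul, map_mul]

theorem commute_P_XiInv (i : Fin 3) : P i * XiInv = XiInv * P i :=
  isKappa.commute_W (isKappa.p_X i)

theorem antipode_P_mul_XiInv (i : Fin 3) : antipode (P i * XiInv) = -P i := by
  rw [antipode_mul, antipode_XiInv, antipode_P, mul_neg, ← mul_assoc, ← isKappa.p_X, mul_assoc,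
    Xi_mul_XiInv, mul_one]

theorem commute_vecPSq_XiInv : vecPSq * XiInv = XiInv * vecPSq :=
  (Commute.sum_left _ _ _ fun i _ => Commute.pow_left (commute_P_XiInv i) 2 :
    Commute vecPSq XiInv)

/-- `m (S ⊗ id)` is not multiplicative, so generators do not suffice at once. But `S` reverses
products: if the first factor is sent to a scalar, this scalar appears in the middle of `S(u) · z ·
v` and can be pulled out. Hence the axiom holds on a product whenever it holds on the factors. -/
theorem antipode_left (n : ℕ) (a : UP) :
    LinearMap.mul' Ch (Red UP n)
        ((redLin antipode n).rTensor (Red UP n) (CTensor.level n (comul a))) =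
      algebraMap Ch (Red UP n) (counit a) := by
  let L : Red UP n ⊗[Ch] Red UP n →ₗ[Ch] Red UP n :=
    LinearMap.mul' Ch (Red UP n) ∘ₗ (redLin antipode n).rTensor (Red UP n)
  have hL (x y : UP) : L (red UP n x ⊗ₜ red UP n y) = red UP n (antipode x * y) :=
    (map_mul (red UP n) _ _).symm
  have hL1 (x : UP) : L (red UP n x ⊗ₜ 1) = red UP n (antipode x) :=
    (hL x 1).trans (by rw [mul_one])
  have hL2 (x : UP) : L (1 ⊗ₜ red UP n x) = red UP n x :=
    (hL 1 x).trans (by rw [antipode_one, one_mul])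
  have hmul (s t : Red UP n ⊗[Ch] Red UP n) (z : Ch) (hs : L s = algebraMap Ch _ z) :
      L (s * t) = algebraMap Ch _ z * L t := by
    rw [← hs]
    have e (u v : Red UP n) :
        L (s * u ⊗ₜ v) = redLin antipode n u * L s * v := by
      clear hs
      induction s with
      | zero => simp only [zero_mul, map_zero, mul_zero]
      | add x y hx hy => rw [add_mul, map_add, map_add, mul_add, add_mul, hx, hy]
      | tmul x y =>
        rw [Algebra.TensorProduct.tmul_mul_tmul]
        change redLin antipode n (x * u) * (y * v) = _ * (redLin antipode n x * y) * v
        rw [redLin_antipode_mul]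
        simp only [mul_assoc]
    induction t with
    | zero => simp only [mul_zero, map_zero]
    | add x y hx hy => rw [mul_add, map_add, map_add, mul_add, hx, hy]
    | tmul u v =>
      rw [e, hs, ← Algebra.commutes, mul_assoc]
      rfl
  let F : UP →ₗ[Ch] Red UP n := L ∘ₗ ((CTensor.level n).comp comul).toLinearMap
  let G : UP →ₗ[Ch] Red UP n := ((Algebra.ofId Ch (Red UP n)).comp counit).toLinearMap
  have hF (x : UP) : F x = L (redComul comul n (red UP n x)) := rfl
  have hG (x : UP) : G x = algebraMap Ch (Red UP n) (counit x) := rfl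
  suffices e : F = G from LinearMap.congr_fun e a
  refine linearMap_ext ?_ (fun x y hx hy => ?_) (fun i => ?_) (fun i => ?_) ?_ fun i => ?_
  · rw [hF, hG, map_one (red UP n), map_one (redComul comul n), map_one counit,
      map_one (algebraMap Ch (Red UP n))]
    exact (hL 1 1).trans (by rw [antipode_one, one_mul, map_one])
  · rw [hF, hG] at hx hy ⊢
    rw [map_mul, map_mul, hmul _ _ _ hx, hy, map_mul, map_mul]
  · rw [hF, hG, redComul_M, counit_M, map_zero, map_add, hL1, hL2, ← map_add, antipode_M,
      neg_add_cancel, map_zero]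
  · rw [hF, hG, redComul_N, counit_N, map_zero, map_sub, map_add, map_smul, map_sub, hL1, hL, hL,
      hL, antipode_P_mul_XiInv, antipode_P_mul_XiInv, antipode_N, antipode_XiInv]
    rw [← map_add, ← map_sub, ← map_smul, ← map_sub, ← map_zero (red UP n)]
    congr 1
    rw [neg_mul, neg_mul, ← neg_sub', smul_neg]
    abel
  · rw [hF, hG, redComul_P0, counit_P0, map_zero, map_add, map_add, map_smul, map_sum, hL, hL]
    simp only [hL, antipode_P_mul_XiInv]
    rw [← map_add, ← map_sum, ← map_smul, ← map_add, ← map_zero (red UP n)]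
    congr 1
    simp only [neg_mul, Finset.sum_neg_distrib, ← pow_two]
    rw [← vecPSq, antipode_P0, antipode_XiInv, add_mul, smul_mul_assoc, mul_assoc, XiInv_mul_Xi,
      mul_one, neg_mul, isKappa.p0_X, smul_neg]
    abel
  · rw [hF, hG, redComul_P, counit_P, map_zero, map_add, hL, hL2, ← map_add, antipode_P, neg_mul,
      mul_assoc, XiInv_mul_Xi, mul_one, neg_add_cancel, map_zero]

theorem antipode_right (n : ℕ) (a : UP) :
    LinearMap.mul' Ch (Red UP n)
        ((redLin antipode n).lTensor (Red UP n) (CTensor.level n (comul a))) =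
      algebraMap Ch (Red UP n) (counit a) := by
  let L : Red UP n ⊗[Ch] Red UP n →ₗ[Ch] Red UP n :=
    LinearMap.mul' Ch (Red UP n) ∘ₗ (redLin antipode n).lTensor (Red UP n)
  have hL (x y : UP) : L (red UP n x ⊗ₜ red UP n y) = red UP n (x * antipode y) :=
    (map_mul (red UP n) _ _).symm
  have hL1 (x : UP) : L (red UP n x ⊗ₜ 1) = red UP n x :=
    (hL x 1).trans (by rw [antipode_one, mul_one])
  have hL2 (x : UP) : L (1 ⊗ₜ red UP n x) = red UP n (antipode x) :=
    (hL 1 x).trans (by rw [one_mul])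
  -- Mirror image of the other antipode axiom: now the second factor has to be sent to a scalar,
  -- since its image ends up inside `u · z · S(v)`.
  have hmul (s t : Red UP n ⊗[Ch] Red UP n) (z : Ch) (ht : L t = algebraMap Ch _ z) :
      L (s * t) = L s * algebraMap Ch _ z := by
    rw [← ht]
    have e (u v : Red UP n) :
        L (u ⊗ₜ v * t) = u * L t * redLin antipode n v := by
      clear ht
      induction t with
      | zero => simp only [mul_zero, map_zero, zero_mul]
      | add x y hx hy => rw [mul_add, map_add, map_add, mul_add, add_mul, hx, hy]
      | tmul x y =>
        rw [Algebra.TensorProduct.tmul_mul_tmul]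
        change u * x * redLin antipode n (v * y) = u * (x * redLin antipode n y) * _
        rw [redLin_antipode_mul]
        simp only [mul_assoc]
    induction s with
    | zero => simp only [zero_mul, map_zero]
    | add x y hx hy => rw [add_mul, map_add, map_add, add_mul, hx, hy]
    | tmul u v =>
      rw [e, ht, mul_assoc, Algebra.commutes, ← mul_assoc]
      rfl
  let F : UP →ₗ[Ch] Red UP n := L ∘ₗ ((CTensor.level n).comp comul).toLinearMap
  let G : UP →ₗ[Ch] Red UP n := ((Algebra.ofId Ch (Red UP n)).comp counit).toLinearMap
  have hF (x : UP) : F x = L (redComul comul n (red UP n x)) := rfl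
  have hG (x : UP) : G x = algebraMap Ch (Red UP n) (counit x) := rfl
  suffices e : F = G from LinearMap.congr_fun e a
  refine linearMap_ext ?_ (fun x y hx hy => ?_) (fun i => ?_) (fun i => ?_) ?_ fun i => ?_
  · rw [hF, hG, map_one (red UP n), map_one (redComul comul n), map_one counit,
      map_one (algebraMap Ch (Red UP n))]
    exact (hL 1 1).trans (by rw [antipode_one, one_mul, map_one])
  · rw [hF, hG] at hx hy ⊢
    rw [map_mul, map_mul, hmul _ _ _ hy, hx, map_mul, map_mul]
  · rw [hF, hG, redComul_M, counit_M, map_zero, map_add, hL1, hL2, ← map_add, antipode_M,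
      add_neg_cancel, map_zero]
  · rw [hF, hG, redComul_N, counit_N, map_zero, map_sub, map_add, map_smul, map_sub, hL1, hL, hL,
      hL, antipode_M, antipode_M, antipode_N]
    rw [← map_add, ← map_sub, ← map_smul, ← map_sub, ← map_zero (red UP n)]
    congr 1
    rw [mul_neg, mul_neg, mul_sub, mul_neg, ← mul_assoc, XiInv_mul_Xi, one_mul, mul_smul_comm,
      mul_sub, commute_P_XiInv, commute_P_XiInv, mul_assoc, mul_assoc, ← neg_sub', smul_neg]
    abel
  · rw [hF, hG, redComul_P0, counit_P0, map_zero, map_add, map_add, map_smul, map_sum, hL, hL]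
    simp only [hL, antipode_P]
    rw [← map_add, ← map_sum, ← map_smul, ← map_add, ← map_zero (red UP n)]
    congr 1
    have e (i : Fin 3) : P i * XiInv * -(P i * XiInv) = -(XiInv * (P i ^ 2 * XiInv)) := by
      rw [mul_neg, commute_P_XiInv, pow_two]
      simp only [mul_assoc]
      rw [commute_P_XiInv]
    simp only [e, Finset.sum_neg_distrib, ← Finset.mul_sum, ← Finset.sum_mul]
    rw [← vecPSq, antipode_P0, antipode_Xi, mul_add, mul_smul_comm, mul_neg, smul_neg,
      isKappa.commute_W isKappa.p0_X]
    abel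
  · rw [hF, hG, redComul_P, counit_P, map_zero, map_add, hL, hL2, ← map_add, antipode_P,
      antipode_Xi, add_neg_cancel, map_zero]

/-- The `κ`-Poincaré algebra in the classical basis. -/
def hopf : HopfStructure UP where
  complete := HComplete.isAdicComplete UP
  comul := comul
  counit := counit
  antipode := antipode
  coassoc n := by
    refine LinearMap.ext fun x => ?_
    obtain ⟨a, rfl⟩ := red_surjective n x
    exact DFunLike.congr_fun (comul_coassoc n) a
  counit_comul := counit_comul
  comul_counit := comul_counit
  antipode_left := antipode_left
  antipode_right := antipode_right

theorem isKappaHopf_hopf : IsKappaHopf hopf where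
  comul_M := comul_M
  comul_N i := by rw [CTensor.sum_eps_smul]; exact comul_N i
  comul_P := comul_P
  comul_P0 := comul_P0
  counit_inc := counit_inc
  antipode_M := antipode_M
  antipode_N i := by rw [sum_eps_smul]; exact antipode_N i
  antipode_P := antipode_P
  antipode_P0 := antipode_P0

theorem IsKappaHopf.eq {H K : HopfStructure UP} (hH : IsKappaHopf H) (hK : IsKappaHopf K) :
    H = K := by
  refine HopfStructure.ext_of_comul
    (algHom_ext (A := CTensor UP UP) (fun i => ?_) (fun i => ?_) ?_ fun i => ?_)
    (algHom_ext (fun i => ?_) (fun i => ?_) ?_ fun i => ?_)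
  · rw [hH.comul_M, hK.comul_M]
  · rw [hH.comul_N, hK.comul_N]
  · rw [hH.comul_P0, hK.comul_P0]
  · rw [hH.comul_P, hK.comul_P]
  · exact (hH.counit_inc _).trans (hK.counit_inc _).symm
  · exact (hH.counit_inc _).trans (hK.counit_inc _).symm
  · exact (hH.counit_inc _).trans (hK.counit_inc _).symm
  · exact (hH.counit_inc _).trans (hK.counit_inc _).symm

/-! ### The square of the antipode -/

theorem Xi_pow_mul_XiInv_pow (k : ℕ) : Xi ^ k * XiInv ^ k = 1 := by
  induction k with
  | zero => rw [pow_zero, pow_zero, one_mul]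
  | succ k ih =>
    rw [pow_succ, pow_succ', mul_assoc, ← mul_assoc Xi, Xi_mul_XiInv, one_mul, ih]

theorem XiInv_pow_mul_Xi_pow (k : ℕ) : XiInv ^ k * Xi ^ k = 1 := by
  induction k with
  | zero => rw [pow_zero, pow_zero, one_mul]
  | succ k ih =>
    rw [pow_succ, pow_succ', mul_assoc, ← mul_assoc XiInv, XiInv_mul_Xi, one_mul, ih]

theorem Xi_conj_of_commute {x : UP} (hx : x * Xi = Xi * x) (k : ℕ) :
    Xi ^ k * x * XiInv ^ k = x := by
  have e : Commute x (Xi ^ k) := Commute.pow_right hx k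
  rw [← e.eq, mul_assoc, Xi_pow_mul_XiInv_pow, mul_one]

theorem Xi_conj_n (i : Fin 3) : Xi * n i * XiInv = n i + h • (P i * XiInv) := by
  have e : Xi * n i = n i * Xi + h • P i := by
    rw [← neg_eq_iff_eq_neg.2 (isKappa.n_X i)]
    abel
  rw [e, add_mul, mul_assoc, Xi_mul_XiInv, mul_one, smul_mul_assoc]

theorem Xi_conj_P_mul_XiInv (i : Fin 3) : Xi * (P i * XiInv) * XiInv = P i * XiInv := by
  rw [← mul_assoc, ← isKappa.p_X, mul_assoc (P i), Xi_mul_XiInv, mul_one]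

/-- Each conjugation by `Ξ` adds `ih PᵢΞ⁻¹`, which is itself fixed by conjugation; three of them add
three times this term. -/
theorem Xi_conj_N (i : Fin 3) :
    Xi ^ 3 * N i * XiInv ^ 3 = N i + (3 * cst Complex.I * h) • (P i * XiInv) := by
  have e (x : UP) : Xi ^ 3 * x * XiInv ^ 3 = Xi * (Xi * (Xi * x * XiInv) * XiInv) * XiInv := by
    simp only [pow_succ, pow_zero, one_mul, mul_assoc]
  rw [e, N_eq]
  simp only [mul_smul_comm, smul_mul_assoc, Xi_conj_n, mul_add, add_mul, Xi_conj_P_mul_XiInv,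
    smul_add, smul_smul]
  rw [mul_assoc, ← Nat.cast_ofNat (R := Ch), ← nsmul_eq_mul, smul_assoc, succ_nsmul, two_nsmul]
  abel

/-- The exponent `3` originates here. One copy of `ih PᵢΞ⁻¹` comes from `Ξ Nᵢ Ξ⁻¹`; the other two
come from restoring the order of the products `Pⱼ Mₖ`, which the antipode reverses, once for each of
the two terms of the cross product. -/
theorem antipode_antipode_N (i : Fin 3) :
    antipode (antipode (N i)) = N i + (3 * cst Complex.I * h) • (P i * XiInv) := by
  have h1 : m (i + 2) * P (i + 1) = P (i + 1) * m (i + 2) - P i := by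
    have := isPoincare.m_p_two (i + 2)
    rw [show i + 2 + 2 = i + 1 by simp [add_assoc], show i + 2 + 1 = i by simp [add_assoc]] at this
    rw [sub_eq_add_neg, ← this]
    abel
  have h2 : m (i + 1) * P (i + 2) = P (i + 2) * m (i + 1) + P i := by
    have := isPoincare.m_p_one (i + 1)
    rw [show i + 1 + 2 = i by simp [add_assoc], show i + 1 + 1 = i + 2 by simp [add_assoc]] at this
    rw [← this]
    abel
  have hM1 : M (i + 2) * P (i + 1) = P (i + 1) * M (i + 2) - cst Complex.I • P i := by
    rw [M_eq, smul_mul_assoc, h1, mul_smul_comm, smul_sub]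
  have hM2 : M (i + 1) * P (i + 2) = P (i + 2) * M (i + 1) + cst Complex.I • P i := by
    rw [M_eq, smul_mul_assoc, h2, mul_smul_comm, smul_add]
  have hN : Xi * N i * XiInv = N i + (cst Complex.I * h) • (P i * XiInv) := by
    rw [N_eq, mul_smul_comm, smul_mul_assoc, Xi_conj_n, smul_add, smul_smul]
  rw [antipode_N, map_sub, map_neg, map_smul, map_sub, antipode_mul, antipode_mul, antipode_mul,
    antipode_Xi, antipode_N, antipode_M, antipode_M, antipode_P, antipode_P, neg_mul_neg,
    neg_mul_neg, ← mul_assoc, ← mul_assoc, hM1, hM2, sub_mul, neg_mul, hN, smul_mul_assoc, sub_mul,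
    sub_mul, add_mul, smul_mul_assoc, mul_assoc 3]
  have e3 : ((3 : Ch) * (cst Complex.I * h)) • (P i * XiInv) =
      h • cst Complex.I • (P i * XiInv) + h • cst Complex.I • (P i * XiInv) +
        (cst Complex.I * h) • (P i * XiInv) := by
    rw [smul_smul, ← add_smul, ← add_smul]
    congr 1
    ring
  rw [e3]
  simp only [smul_sub, smul_add]
  abel

/-- Both sides are multiplicative in `x`. On generators only the boosts fail to commute with `Ξ`. -/
theorem antipode_antipode (x : UP) : antipode (antipode x) = Xi ^ 3 * x * XiInv ^ 3 := by
  let G : UP →ₗ[Ch] UP := LinearMap.mulRight Ch (XiInv ^ 3) ∘ₗ LinearMap.mulLeft Ch (Xi ^ 3)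
  suffices e : antipode ∘ₗ antipode = G from LinearMap.congr_fun e x
  have hF (x : UP) : (antipode ∘ₗ antipode) x = antipode (antipode x) := rfl
  have hG (x : UP) : G x = Xi ^ 3 * x * XiInv ^ 3 := rfl
  have hMX (i : Fin 3) : M i * Xi = Xi * M i := by
    rw [M_eq, smul_mul_assoc, isKappa.m_X, mul_smul_comm]
  refine linearMap_ext ?_ (fun x y hx hy => ?_) (fun i => ?_) (fun i => ?_) ?_ fun i => ?_
  · rw [hF, hG, antipode_one, antipode_one, mul_one, Xi_pow_mul_XiInv_pow]
  · rw [hF, hG] at hx hy ⊢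
    rw [antipode_mul, antipode_mul, hx, hy, mul_assoc _ (XiInv ^ 3), mul_assoc (Xi ^ 3) y,
      ← mul_assoc (XiInv ^ 3), XiInv_pow_mul_Xi_pow, one_mul]
    simp only [mul_assoc]
  · rw [hF, hG, antipode_M, map_neg, antipode_M, neg_neg, Xi_conj_of_commute (hMX i)]
  · rw [hF, hG, antipode_antipode_N, Xi_conj_N]
  · rw [hF, hG, Xi_conj_of_commute isKappa.p0_X, antipode_P0, map_add, map_neg, antipode_P0,
      map_smul, antipode_mul, antipode_XiInv, vecPSq, map_sum]
    have e (i : Fin 3) : antipode (P i ^ 2) = P i ^ 2 * (XiInv * XiInv) := by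
      rw [pow_two, antipode_mul, antipode_P, neg_mul_neg, mul_assoc, ← mul_assoc XiInv,
        ← commute_P_XiInv]
      simp only [mul_assoc]
    simp only [e]
    rw [← Finset.sum_mul, ← vecPSq, ← mul_assoc vecPSq, commute_vecPSq_XiInv, mul_assoc,
      commute_vecPSq_XiInv, ← mul_assoc Xi, Xi_mul_XiInv, one_mul]
    abel
  · rw [hF, hG, Xi_conj_of_commute (isKappa.p_X i), antipode_P, map_neg, antipode_P_mul_XiInv,
      neg_neg]

end Classical

/-! ## The algebra in the bicrossproduct basis -/

theorem sum_cst_eps {V : Type} [AddCommGroup V] [Module Ch V] (z : ℂ) (f : Fin 3 → V)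
    (i : Fin 3) :
    ∑ k, cst (z * eps i i k) • f k = 0 ∧ ∑ k, cst (z * eps i (i + 1) k) • f k = cst z • f (i + 2) ∧
      ∑ k, cst (z * eps i (i + 2) k) • f k = -(cst z • f (i + 1)) := by
  simp only [Fin.sum_univ_three]
  fin_cases i <;> simp [eps, cst]

/-- Passing to `-iM` and `-iN` removes the imaginary units: brackets of two such elements are scaled
twice, brackets with momenta once. -/
theorem IsPoincare.of_commutators {A : Type} [Ring A] [Algebra Ch A] {m n p : Fin 3 → A} {p0 : A}
    (m_m : ∀ i j, m i * m j - m j * m i = ∑ k, cst (Complex.I * eps i j k) • m k)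
    (m_n : ∀ i j, m i * n j - n j * m i = ∑ k, cst (Complex.I * eps i j k) • n k)
    (n_n : ∀ i j, n i * n j - n j * n i = ∑ k, cst (-Complex.I * eps i j k) • m k)
    (p_p : ∀ i j, p i * p j - p j * p i = 0) (p_p0 : ∀ i, p i * p0 - p0 * p i = 0)
    (m_p0 : ∀ i, m i * p0 - p0 * m i = 0)
    (m_p : ∀ i j, m i * p j - p j * m i = ∑ k, cst (Complex.I * eps i j k) • p k)
    (n_p0 : ∀ i, n i * p0 - p0 * n i = -(cst Complex.I • p i))
    (n_p : ∀ i j, n i * p j - p j * n i = -(cst (Complex.I * if i = j then 1 else 0) • p0)) :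
    IsPoincare (fun i => cst (-Complex.I) • m i) (fun i => cst (-Complex.I) • n i) p p0 := by
  have hI (x : A) : cst (-Complex.I) • cst Complex.I • x = x := by
    rw [smul_smul, ← map_mul]
    simp
  have hI' (x : A) : cst (-Complex.I) • cst (-Complex.I) • x = -x := by
    rw [smul_smul, ← map_mul]
    simp
  have two (x y : A) : cst (-Complex.I) • x * cst (-Complex.I) • y -
      cst (-Complex.I) • y * cst (-Complex.I) • x =
        cst (-Complex.I) • cst (-Complex.I) • (x * y - y * x) := by
    simp only [smul_mul_assoc, mul_smul_comm, smul_sub]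
  have one (x y : A) : cst (-Complex.I) • x * y - y * cst (-Complex.I) • x =
      cst (-Complex.I) • (x * y - y * x) := by
    simp only [smul_mul_assoc, mul_smul_comm, smul_sub]
  constructor <;> intro i
  · rw [two, m_m, (sum_cst_eps _ _ i).2.1, hI]
  · rw [← sub_eq_zero, two, m_n, (sum_cst_eps _ _ i).1, smul_zero, smul_zero]
  · rw [two, m_n, (sum_cst_eps _ _ i).2.1, hI]
  · rw [two, m_n, (sum_cst_eps _ _ i).2.2, smul_neg, hI, smul_neg]
  · rw [two, n_n, (sum_cst_eps _ _ i).2.1, hI']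
  · rw [← sub_eq_zero, one, m_p, (sum_cst_eps _ _ i).1, smul_zero]
  · rw [one, m_p, (sum_cst_eps _ _ i).2.1, hI]
  · rw [one, m_p, (sum_cst_eps _ _ i).2.2, smul_neg, hI]
  · rw [← sub_eq_zero, one, m_p0, smul_zero]
  · rw [one, n_p, if_pos rfl, mul_one, smul_neg, hI]
  · rw [← sub_eq_zero, one, n_p, if_neg (by simp), mul_zero]
    simp [cst]
  · rw [← sub_eq_zero, one, n_p, if_neg (by simp), mul_zero]
    simp [cst]
  · rw [one, n_p0, smul_neg, hI]
  · exact sub_eq_zero.1 (p_p _ _)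
  · exact sub_eq_zero.1 (p_p0 _)

namespace Bicross

open HSeries

section

variable {A : Type} [Ring A] [Algebra Ch A]

theorem exists_freeHom (g : Gen → A) : ∃ φ : FreeAlgebra ℂ Gen →+* A,
    (∀ z, φ (algebraMap ℂ _ z) = algebraMap Ch A (cst z)) ∧ ∀ x, φ (FreeAlgebra.ι ℂ x) = g x := by
  let _ : Algebra ℂ A := Algebra.compHom A (PowerSeries.C : ℂ →+* Ch)
  exact ⟨(FreeAlgebra.lift ℂ g).toRingHom, fun z => (FreeAlgebra.lift ℂ g).commutes z,
    fun x => FreeAlgebra.lift_ι_apply g x⟩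

/-- The homomorphism with given values on the generators. -/
def freeLift [HComplete A] (g : Gen → A) : Free →ₐ[Ch] A :=
  HSeries.lift (exists_freeHom g).choose (exists_freeHom g).choose_spec.1

theorem freeLift_gen [HComplete A] (g : Gen → A) (x : Gen) : freeLift g (gen x) = g x := by
  rw [freeLift, gen, lift_C, (exists_freeHom g).choose_spec.2]

theorem freeHom_ext [HSep A] {F G : Free →ₐ[Ch] A} (H : ∀ x, F (gen x) = G (gen x)) : F = G := by
  refine HSeries.algHom_ext fun b => ?_
  simp only [← CHom_apply]
  induction b using FreeAlgebra.induction with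
  | grade0 z =>
    rw [CHom_apply, ← algebraMap_cst, AlgHom.commutes, AlgHom.commutes]
  | grade1 x => exact H x
  | add x y hx hy => simp only [map_add, hx, hy]
  | mul x y hx hy => simp only [map_mul, hx, hy]

/-- For each `n`, the kernel of `F` modulo `hⁿ` contains the relations and `hⁿ`; so `F x` is
divisible by every `hⁿ`. -/
theorem map_eq_zero_of_mem_ideal [HSep A] {F : Free →ₐ[Ch] A} (H : ∀ a b, Rel a b → F a = F b)
    {x : Free} (hx : x ∈ ideal) : F x = 0 := by
  refine HSep.eq_zero _ fun n => ?_
  rw [← mem_hIdeal, ← Ideal.Quotient.eq_zero_iff_mem]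
  have hle : TwoSidedIdeal.span
      ({x | ∃ a b, Rel a b ∧ x = a - b} ∪ {algebraMap Ch Free (h ^ n)}) ≤
        TwoSidedIdeal.ker ((red A n).comp F) := by
    rw [TwoSidedIdeal.span_le]
    rintro y (⟨a, b, hab, rfl⟩ | rfl)
    · refine (TwoSidedIdeal.mem_ker _).2 ?_
      rw [map_sub, sub_eq_zero, AlgHom.comp_apply, AlgHom.comp_apply, H a b hab]
    · refine (TwoSidedIdeal.mem_ker _).2 ?_
      rw [Algebra.algebraMap_eq_smul_one, map_smul, h_pow_smul_red]
  exact (TwoSidedIdeal.mem_ker ((red A n).comp F)).1 (hle (((TwoSidedIdeal.mem_iInf Free).1 hx) n))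

/-- The homomorphism with given values on the generators, if these satisfy the relations. -/
def lift [HSep A] (F : Free →ₐ[Ch] A) (H : ∀ a b, Rel a b → F a = F b) : KP →ₐ[Ch] A :=
  Ideal.Quotient.liftₐ (TwoSidedIdeal.asIdeal ideal) F fun _ hx => map_eq_zero_of_mem_ideal H hx

theorem proj_surjective : Function.Surjective proj := Ideal.Quotient.mk_surjective

theorem proj_eq {a b : Free} (H : Rel a b) : proj a = proj b := by
  refine Ideal.Quotient.eq.2 ((TwoSidedIdeal.mem_iInf Free).2 fun n => ?_)
  exact TwoSidedIdeal.subset_span (Or.inl ⟨a, b, H, rfl⟩)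

/-- This is the effect of closing the ideal: a class divisible by every `hⁿ` is represented by an
element of every `J + (hⁿ)`. -/
instance : HSep KP where
  eq_zero x H := by
    obtain ⟨f, rfl⟩ := proj_surjective x
    refine Ideal.Quotient.eq_zero_iff_mem.2 ((TwoSidedIdeal.mem_iInf Free).2 fun n => ?_)
    obtain ⟨y, hy⟩ := H n
    obtain ⟨g, rfl⟩ := proj_surjective y
    rw [← map_smul] at hy
    have h1 := ((TwoSidedIdeal.mem_iInf Free).1 (Ideal.Quotient.eq.1 hy :)) n
    have h2 : h ^ n • g ∈ TwoSidedIdeal.span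
        ({x | ∃ a b, Rel a b ∧ x = a - b} ∪ {algebraMap Ch Free (h ^ n)}) := by
      rw [Algebra.smul_def]
      exact TwoSidedIdeal.mul_mem_right _ _ _ (TwoSidedIdeal.subset_span (Or.inr rfl))
    have := TwoSidedIdeal.add_mem _ h1 h2
    rwa [sub_add_cancel] at this

theorem algHom_ext [HSep A] {F G : KP →ₐ[Ch] A} (hM : ∀ i, F (M i) = G (M i))
    (hN : ∀ i, F (N i) = G (N i)) (hP0 : F P0 = G P0) (hP : ∀ i, F (P i) = G (P i)) : F = G := by
  have e : F.comp proj = G.comp proj := freeHom_ext fun x => by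
    cases x with
    | M i => exact hM i
    | N i => exact hN i
    | P0 => exact hP0
    | P i => exact hP i
  refine AlgHom.ext fun x => ?_
  obtain ⟨f, rfl⟩ := proj_surjective x
  exact DFunLike.congr_fun e f

end

/-! ### The map to the classical basis -/

/-- The images of the generators. -/
def genImage : Gen → UP
  | .M i => Classical.M i
  | .N i => Classical.N i
  | .P0 => divH Classical.logXi
  | .P i => Classical.P i * Classical.XiInv

/-- The homomorphism from the free algebra to the classical basis. -/
def freeHom : Free →ₐ[Ch] UP := freeLift genImage

theorem freeHom_M (i : Fin 3) : freeHom (gen (.M i)) = Classical.M i := freeLift_gen _ _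

theorem freeHom_N (i : Fin 3) : freeHom (gen (.N i)) = Classical.N i := freeLift_gen _ _

theorem freeHom_P0 : freeHom (gen .P0) = divH Classical.logXi := freeLift_gen _ _

theorem freeHom_P (i : Fin 3) : freeHom (gen (.P i)) = Classical.P i * Classical.XiInv :=
  freeLift_gen _ _

end Bicross

/-! ### The logarithm of `Ξ` and its commutators -/

namespace Classical

open HSeries

theorem coeff_zero_logXi : coeff 0 logXi = 0 := by simp [logXi, coeff_zero_eval]

theorem eval_exp_logXi : eval (PowerSeries.exp ℂ) logXi = Xi := by
  rw [logXi, eval_exp_log coeff_zero_Xi_sub_one, add_sub_cancel]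

theorem eval_exp_neg_logXi : eval (PowerSeries.exp ℂ) (cst (-1) • logXi) = XiInv := by
  have e := eval_exp_cst_smul_mul (-1) 1 coeff_zero_logXi
  have h1 : cst 1 • logXi = logXi := by rw [cst, map_one, one_smul]
  rw [h1, eval_exp_logXi, neg_add_cancel, show cst 0 = 0 from map_zero _, zero_smul,
    eval_zero] at e
  have e' : eval (PowerSeries.exp ℂ) (cst (-1) • logXi) * Xi = 1 := by simpa [cst] using e
  rw [← mul_one (eval _ _), ← Xi_mul_XiInv, ← mul_assoc, e', one_mul]

theorem eval_exp_neg_two_logXi :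
    eval (PowerSeries.exp ℂ) (cst (-2) • logXi) = XiInv * XiInv := by
  rw [← eval_exp_neg_logXi, eval_exp_cst_smul_mul _ _ coeff_zero_logXi]
  norm_num

theorem commute_logXi {x : UP} (H : x * Xi = Xi * x) :
    x * divH logXi = divH logXi * x := by
  refine h_smul_injective ?_
  rw [← mul_smul_comm, ← smul_mul_assoc, h_smul_divH_logXi]
  exact commute_eval coeff_zero_Xi_sub_one ((show Commute x Xi from H).sub_right
    (Commute.one_right x)) _

theorem eval_derivative_log :
    eval (PowerSeries.derivative ℂ (PowerSeries.log ℂ)) (Xi - 1) = XiInv := by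
  have h0 := coeff_zero_Xi_sub_one
  have e := congrArg (fun f => eval f (Xi - 1)) one_add_X_mul_derivative_log
  beta_reduce at e
  rw [eval_mul _ _ h0, eval_add, eval_one h0, eval_X h0, add_sub_cancel] at e
  rw [← one_mul (eval (PowerSeries.derivative ℂ _) _)]
  nth_rw 1 [← XiInv_mul_Xi]
  rw [mul_assoc, e, mul_one]

theorem N_Xi (i : Fin 3) : N i * Xi - Xi * N i = -((cst Complex.I * h) • P i) := by
  rw [N_eq, smul_mul_assoc, mul_smul_comm, ← smul_sub, isKappa.n_X, smul_neg, smul_smul]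

/-- `[N, Ξ]` is a multiple of `P`, which commutes with `Ξ`; hence `[N, ln Ξ] = [N, Ξ] Ξ⁻¹`. The
factor `h` is cancelled because power series have no `h`-torsion. -/
theorem N_logXi (i : Fin 3) :
    N i * divH logXi - divH logXi * N i = -(cst Complex.I • (P i * XiInv)) := by
  refine h_smul_injective ?_
  rw [smul_sub, ← mul_smul_comm, ← smul_mul_assoc, h_smul_divH_logXi, logXi,
    commutator_eval coeff_zero_Xi_sub_one (y := -((cst Complex.I * h) • P i)) ?_ ?_,
    eval_derivative_log, neg_mul, smul_mul_assoc, smul_neg, smul_smul, mul_comm h]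
  · rw [← N_Xi, mul_sub, sub_mul, mul_one, one_mul]
    abel
  · exact (((show Commute (P i) Xi from isKappa.p_X i).sub_right
      (Commute.one_right _)).smul_left _).neg_left

theorem N_XiInv (i : Fin 3) :
    N i * XiInv - XiInv * N i = (cst Complex.I * h) • (XiInv * (XiInv * P i)) := by
  rw [N_eq, smul_mul_assoc, mul_smul_comm, ← smul_sub, isKappa.n_W, add_sub_cancel_left, smul_smul]

theorem inc_commutator {ι : Type} [Fintype ι] {x y : Poincare} {c : ι → ℂ} {z : ι → Poincare}
    (H : ⁅x, y⁆ = ∑ k, c k • z k) : inc x * inc y - inc y * inc x = ∑ k, cst (c k) • inc (z k) := by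
  rw [inc_lie, H]
  have hsum (s : Finset ι) : inc (∑ k ∈ s, c k • z k) = ∑ k ∈ s, cst (c k) • inc (z k) := by
    classical
    induction s using Finset.induction_on with
    | empty => simp [inc_zero]
    | insert a s ha ih => rw [Finset.sum_insert ha, Finset.sum_insert ha, inc_add, inc_smul, ih]
  exact hsum _

/-- The quadratic relation times `Ξ⁻¹`. With `Ξ⁻² = exp (-2h𝒫₀)` and `𝒫ᵢ = PᵢΞ⁻¹`, its right side is
`h` times the bracketed expression in the deformed relation for `[Nᵢ, 𝒫ⱼ]`. -/
theorem two_h_smul_P0_mul_XiInv :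
    (2 * h) • (P0 * XiInv) = 1 - XiInv * XiInv + h ^ 2 • ∑ i, (P i * XiInv) ^ 2 := by
  have e := congrArg (· * XiInv) isKappa.p0_eq
  simp only [smul_mul_assoc, add_mul, sub_mul, Xi_mul_XiInv] at e
  have e' (i : Fin 3) : (P i * XiInv) ^ 2 = P i ^ 2 * XiInv * XiInv := by
    rw [pow_two, mul_assoc, ← mul_assoc XiInv, ← commute_P_XiInv, pow_two]
    simp only [mul_assoc]
  simp only [e', e, ← Finset.sum_mul]

end Classical

namespace Bicross

open HSeries

theorem freeHom_expFree (c : ℂ) :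
    freeHom (expFree c) = eval (PowerSeries.exp ℂ) (cst c • Classical.logXi) := by
  rw [expFree, map_eval freeHom _ (by rw [mul_comm, mul_smul, coeff_h_smul_zero]), map_smul,
    freeHom_P0, mul_smul, Classical.h_smul_divH_logXi]

theorem freeHom_divH_one_sub_expFree : freeHom (divH (1 - expFree (-2))) + h • ∑ k,
    freeHom (gen (.P k)) ^ 2 = cst 2 • (Classical.P0 * Classical.XiInv) := by
  refine h_smul_injective ?_
  rw [smul_add, ← map_smul, h_smul_divH_one_sub_expFree, map_sub, map_one, freeHom_expFree,
    Classical.eval_exp_neg_two_logXi, smul_smul, smul_smul, ← pow_two h]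
  simp only [freeHom_P]
  rw [← Classical.two_h_smul_P0_mul_XiInv, mul_comm h, cst, map_ofNat]

theorem freeHom_rel (a b : Free) (H : Rel a b) : freeHom a = freeHom b := by
  have hPW {x : UP} (e : x * Classical.Xi = Classical.Xi * x) :
      x * Classical.XiInv = Classical.XiInv * x := Classical.isKappa.commute_W e
  have hMX (i : Fin 3) : Classical.M i * Classical.Xi = Classical.Xi * Classical.M i := by
    rw [Classical.M_eq, smul_mul_assoc, Classical.isKappa.m_X, mul_smul_comm]
  have hPWX (i : Fin 3) : Classical.P i * Classical.XiInv * Classical.Xi =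
      Classical.Xi * (Classical.P i * Classical.XiInv) := by
    rw [mul_assoc, Classical.XiInv_mul_Xi, ← mul_assoc, ← Classical.isKappa.p_X, mul_assoc,
      Classical.Xi_mul_XiInv]
  induction H with
  | M_M i j =>
    rw [Ring.lie_def, map_sub, map_mul, map_mul, map_sum]
    simp only [map_smul, freeHom_M]
    exact Classical.inc_commutator (Poincare.bracket_M_M i j)
  | M_N i j =>
    rw [Ring.lie_def, map_sub, map_mul, map_mul, map_sum]
    simp only [map_smul, freeHom_M, freeHom_N]
    exact Classical.inc_commutator (Poincare.bracket_M_N i j)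
  | N_N i j =>
    rw [Ring.lie_def, map_sub, map_mul, map_mul, map_sum]
    simp only [map_smul, freeHom_M, freeHom_N]
    exact Classical.inc_commutator (Poincare.bracket_N_N i j)
  | P_P i j =>
    rw [Ring.lie_def, map_sub, map_mul, map_mul, map_zero, freeHom_P, freeHom_P, sub_eq_zero]
    have e := (Classical.isPoincare.commute_p i j).eq
    rw [mul_assoc, ← mul_assoc Classical.XiInv, ← hPW (Classical.isKappa.p_X j), mul_assoc,
      ← mul_assoc, e, mul_assoc (Classical.P j), mul_assoc (Classical.P j),
      ← mul_assoc Classical.XiInv, ← hPW (Classical.isKappa.p_X i), mul_assoc]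
  | P_P0 i =>
    rw [Ring.lie_def, map_sub, map_mul, map_mul, map_zero, freeHom_P, freeHom_P0, sub_eq_zero,
      Classical.commute_logXi (hPWX i)]
  | M_P0 i =>
    rw [Ring.lie_def, map_sub, map_mul, map_mul, map_zero, freeHom_M, freeHom_P0, sub_eq_zero,
      Classical.commute_logXi (hMX i)]
  | M_P j k =>
    rw [Ring.lie_def, map_sub, map_mul, map_mul, map_sum]
    simp only [map_smul, freeHom_M, freeHom_P]
    rw [mul_assoc, ← hPW (hMX j), ← mul_assoc, ← mul_assoc, ← sub_mul]
    simp only [← smul_mul_assoc, ← Finset.sum_mul]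
    exact congrArg (· * _) (Classical.inc_commutator (Poincare.bracket_M_P j k))
  | N_P0 j =>
    rw [Ring.lie_def, map_sub, map_mul, map_mul, map_neg, map_smul, freeHom_N, freeHom_P0,
      freeHom_P, Classical.N_logXi]
  | N_P i j =>
    have e1 : Classical.N i * Classical.P j - Classical.P j * Classical.N i =
        cst (-Complex.I * if i = j then 1 else 0) • Classical.P0 := by
      have := Poincare.bracket_N_P i j
      exact (Classical.inc_lie _ _).trans ((congrArg _ this).trans (Classical.inc_smul _ _))
    have e2 := Classical.N_XiInv i
    -- Leibniz rule for `PⱼΞ⁻¹`: the first term gives the `δᵢⱼ` part, a multiple of `P₀Ξ⁻¹`, and the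
    -- second one gives `ih 𝒫ᵢ 𝒫ⱼ`.
    have e3 : Classical.N i * (Classical.P j * Classical.XiInv) -
        Classical.P j * Classical.XiInv * Classical.N i =
          (Classical.N i * Classical.P j - Classical.P j * Classical.N i) * Classical.XiInv +
            Classical.P j * (Classical.N i * Classical.XiInv - Classical.XiInv * Classical.N i) := by
      rw [sub_mul, mul_sub]
      simp only [mul_assoc]
      abel
    rw [Ring.lie_def, map_sub, map_mul, map_mul, map_add, map_neg, map_smul, map_smul, map_add,
      map_smul, map_sum, map_mul]
    simp only [map_pow]
    rw [freeHom_divH_one_sub_expFree, freeHom_N, freeHom_P, freeHom_P, e3, e1, e2]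
    have e4 : Classical.P j * (Classical.XiInv * (Classical.XiInv * Classical.P i)) =
        Classical.P i * Classical.XiInv * (Classical.P j * Classical.XiInv) := by
      rw [← hPW (Classical.isKappa.p_X i), ← mul_assoc Classical.XiInv,
        ← hPW (Classical.isKappa.p_X i), mul_assoc, ← mul_assoc,
        (Classical.isPoincare.commute_p j i).eq, mul_assoc, mul_assoc, hPW (Classical.isKappa.p_X j)]
      congr 1
      rw [← mul_assoc, hPW (Classical.isKappa.p_X j), mul_assoc, hPW (Classical.isKappa.p_X j)]
    rw [mul_smul_comm, e4, smul_mul_assoc, smul_smul, ← map_mul]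
    congr 1
    rw [← neg_smul, ← map_neg]
    congr 2
    ring

/-- The homomorphism to the classical basis. -/
def hom : KP →ₐ[Ch] UP := lift freeHom freeHom_rel

theorem hom_M (i : Fin 3) : hom (M i) = Classical.M i := freeHom_M i

theorem hom_N (i : Fin 3) : hom (N i) = Classical.N i := freeHom_N i

theorem hom_P0 : hom P0 = divH Classical.logXi := freeHom_P0

theorem hom_P (i : Fin 3) : hom (P i) = Classical.P i * Classical.XiInv := freeHom_P i

theorem hom_expNeg : hom expNeg = Classical.XiInv :=
  (freeHom_expFree (-1)).trans Classical.eval_exp_neg_logXi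

end Bicross

/-! ### First-order expansions in `h` -/

namespace HSeries

/-- The first-order expansion of a composite series. -/
theorem eval_h_smul {B : Type} [Ring B] [Algebra ℂ B] (f : PowerSeries ℂ) (b : HSeries B) :
    ∃ y, eval f (h • b) = cst (PowerSeries.coeff 0 f) • 1 +
      h • (cst (PowerSeries.coeff 1 f) • b + h • y) := by
  have h0 := coeff_h_smul_zero b
  refine ⟨b * (b * eval (shift (shift f)) (h • b)), ?_⟩
  rw [eval_step f h0]
  conv_lhs => rw [eval_step (shift f) h0]
  rw [show PowerSeries.coeff 0 (shift f) = PowerSeries.coeff 1 f by simp [shift], mul_add,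
    mul_smul_comm, mul_one, smul_mul_assoc, smul_mul_assoc, mul_smul_comm, smul_add,
    smul_comm h (cst _)]

end HSeries

namespace Classical

open HSeries

theorem exists_Xi_sub_one_eq : ∃ y, Xi - 1 = h • (P0 + h • y) := by
  obtain ⟨y, hy⟩ := eval_h_smul sqrtSeries (-(h • PSq))
  have e : -(h ^ 2 • PSq) = h • -(h • PSq) := by rw [smul_neg, smul_smul, pow_two]
  have h1 : PowerSeries.coeff 0 sqrtSeries = 1 := by simp [sqrtSeries]
  refine ⟨-(cst (PowerSeries.coeff 1 sqrtSeries) • PSq) + y, ?_⟩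
  rw [Xi, root, e, hy, h1, cst, map_one, one_smul]
  simp only [smul_add, smul_neg, smul_comm (cst _) h]
  abel

theorem exists_divH_logXi_eq : ∃ y, divH logXi = P0 + h • y := by
  obtain ⟨y, hy⟩ := exists_Xi_sub_one_eq
  obtain ⟨z, hz⟩ := eval_h_smul (PowerSeries.log ℂ) (P0 + h • y)
  have h0 : PowerSeries.coeff 0 (PowerSeries.log ℂ) = 0 := by simp
  have h1 : PowerSeries.coeff 1 (PowerSeries.log ℂ) = 1 := by simp [PowerSeries.log]
  rw [h0, h1, cst, map_zero, zero_smul, zero_add, cst, map_one, one_smul, ← hy] at hz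
  refine ⟨y + z, ?_⟩
  rw [logXi, hz, divH_h_smul, smul_add]
  abel

theorem exists_XiInv_eq : ∃ y, XiInv = 1 + h • y := exists_eq_one_add coeff_zero_XiInv

end Classical

namespace Bicross

open HSeries

theorem exists_divH_one_sub_expFree_eq :
    ∃ y, divH (1 - expFree (-2)) = cst 2 • gen .P0 + h • y := by
  obtain ⟨y, hy⟩ := eval_h_smul (PowerSeries.exp ℂ) (cst (-2) • gen .P0)
  have h0 : PowerSeries.coeff 0 (PowerSeries.exp ℂ) = 1 := by simp
  have h1 : PowerSeries.coeff 1 (PowerSeries.exp ℂ) = 1 := by simp [PowerSeries.coeff_exp]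
  have hc : cst 1 = 1 := map_one _
  have hn : cst (-2) = -cst 2 := map_neg _ _
  rw [h0, h1, hc, one_smul, one_smul] at hy
  refine ⟨-y, ?_⟩
  rw [expFree, mul_comm, mul_smul, hy, sub_add_cancel_left, ← smul_neg, divH_h_smul, hn]
  simp only [neg_smul, smul_neg]
  abel

/-! ### The map to the classical basis is bijective -/

/-- The reduction modulo `h`. -/
def redProj : Free →ₐ[Ch] Red KP 1 := (red KP 1).comp proj

theorem redProj_h_smul (x : Free) : redProj (h • x) = 0 := by
  have := h_pow_smul_red KP 1 (redProj x)
  rwa [pow_one, ← map_smul] at this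

theorem redProj_eq {a b : Free} (H : Rel a b) : redProj a = redProj b :=
  congrArg (red KP 1) (proj_eq H)

/-- Modulo `h` the deformation disappears: the relations of `𝒦` become those of `io(1,3)`. -/
theorem isPoincare_redProj : IsPoincare (fun i => cst (-Complex.I) • redProj (gen (.M i)))
    (fun i => cst (-Complex.I) • redProj (gen (.N i))) (fun i => redProj (gen (.P i)))
    (redProj (gen .P0)) := by
  have key {x y z : Free} (H : Rel ⁅x, y⁆ z) :
      redProj x * redProj y - redProj y * redProj x = redProj z := by
    rw [← redProj_eq H, Ring.lie_def, map_sub, map_mul, map_mul]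
  refine IsPoincare.of_commutators (fun i j => ?_) (fun i j => ?_) (fun i j => ?_) (fun i j => ?_)
    (fun i => ?_) (fun i => ?_) (fun i j => ?_) (fun i => ?_) fun i j => ?_
  · rw [key (.M_M i j), map_sum]
    simp only [map_smul]
  · rw [key (.M_N i j), map_sum]
    simp only [map_smul]
  · rw [key (.N_N i j), map_sum]
    simp only [map_smul]
  · rw [key (.P_P i j), map_zero]
  · rw [key (.P_P0 i), map_zero]
  · rw [key (.M_P0 i), map_zero]
  · rw [key (.M_P i j), map_sum]
    simp only [map_smul]
  · rw [key (.N_P0 i), map_neg, map_smul]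
  -- `h⁻¹ (1 - exp (-2h𝒫₀))` is `2𝒫₀` modulo `h`, and both quadratic terms carry a factor `h`; the
  -- `2` cancels the `1/2` in the relation.
  · obtain ⟨y, hy⟩ := exists_divH_one_sub_expFree_eq
    rw [key (.N_P i j), hy, mul_comm _ h, mul_smul, add_assoc, ← smul_add, smul_add, map_add,
      redProj_h_smul, add_zero, smul_comm _ h, map_neg, map_add, redProj_h_smul, add_zero,
      smul_smul, ← map_mul, map_smul]
    congr 3
    ring

/-- The inverse of the map to the classical basis, modulo `h`. -/
def invMod : UP →ₐ[Ch] Red KP 1 := isPoincare_redProj.lift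

theorem invMod_h_smul (x : UP) : invMod (h • x) = 0 := by
  have := h_pow_smul_red KP 1 (invMod x)
  rwa [pow_one, ← map_smul] at this

theorem invMod_hom (x : KP) : invMod (hom x) = red KP 1 x := by
  have hI (x : Red KP 1) : cst Complex.I • cst (-Complex.I) • x = x := by
    rw [smul_smul, ← map_mul]
    simp
  suffices e : invMod.comp hom = red KP 1 from DFunLike.congr_fun e x
  -- On generators: modulo `h`, `h⁻¹ ln Ξ` is `P₀` and `Ξ⁻¹` is `1`, so the new momenta reduce to
  -- the old ones.
  refine algHom_ext (fun i => ?_) (fun i => ?_) ?_ fun i => ?_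
  · rw [AlgHom.comp_apply, hom_M, invMod, IsPoincare.lift_M, hI]
    rfl
  · rw [AlgHom.comp_apply, hom_N, invMod, IsPoincare.lift_N, hI]
    rfl
  · obtain ⟨y, hy⟩ := Classical.exists_divH_logXi_eq
    rw [AlgHom.comp_apply, hom_P0, hy, map_add, invMod_h_smul, add_zero, invMod,
      IsPoincare.lift_P0]
    rfl
  · obtain ⟨y, hy⟩ := Classical.exists_XiInv_eq
    rw [AlgHom.comp_apply, hom_P, hy, mul_add, mul_one, mul_smul_comm, map_add, invMod_h_smul,
      add_zero, invMod, IsPoincare.lift_P]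
    rfl

/-- By the left inverse modulo `h`, an element of the kernel is `h y`; then `y` is in the kernel as
well, because `𝒰` has no `h`-torsion. Thus the kernel is infinitely divisible by `h` and vanishes,
`𝒦` being separated. -/
theorem hom_injective : Function.Injective hom := by
  refine (injective_iff_map_eq_zero hom).2 fun x hx => ?_
  refine HSep.eq_zero_of_step (fun x : {x : KP // hom x = 0} => x.1) (fun x => ?_) ⟨x, hx⟩
  have h0 : red KP 1 x.1 = 0 := by rw [← invMod_hom, x.2, map_zero]
  obtain ⟨y, hy⟩ := mem_hIdeal.1 (Ideal.Quotient.eq_zero_iff_mem.1 h0)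
  rw [pow_one] at hy
  have hy0 : hom y = 0 := by
    refine h_smul_injective ?_
    rw [smul_zero, ← map_smul, ← hy, x.2]
  exact ⟨⟨y, hy0⟩, 1, by rw [one_mul, hy]⟩

theorem exists_freeHom_sub (x : UP) : ∃ f y, x = freeHom f + h • y := by
  let S : Subalgebra Ch (Red UP 1) := ((red UP 1).comp freeHom).range
  have hred (y : UP) : red UP 1 (h • y) = 0 := by
    have := h_pow_smul_red UP 1 (red UP 1 y)
    rwa [pow_one, ← map_smul] at this
  have hgen (g : Gen) : red UP 1 (freeHom (gen g)) ∈ S := ⟨gen g, rfl⟩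
  have hM (i : Fin 3) : red UP 1 (Classical.M i) ∈ S := by
    rw [← freeHom_M]; exact hgen _
  have hN (i : Fin 3) : red UP 1 (Classical.N i) ∈ S := by
    rw [← freeHom_N]; exact hgen _
  have hP0 : red UP 1 Classical.P0 ∈ S := by
    obtain ⟨y, hy⟩ := Classical.exists_divH_logXi_eq
    have := hgen .P0
    rwa [freeHom_P0, hy, map_add, hred, add_zero] at this
  have hP (i : Fin 3) : red UP 1 (Classical.P i) ∈ S := by
    obtain ⟨y, hy⟩ := Classical.exists_XiInv_eq
    have := hgen (.P i)
    rwa [freeHom_P, hy, mul_add, mul_one, mul_smul_comm, map_add, hred, add_zero] at this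
  have hC (b : Classical.U) : red UP 1 (C b) ∈ S := by
    have hb : b ∈ Algebra.adjoin ℂ
        (Set.range (UniversalEnvelopingAlgebra.ι ℂ (L := Poincare))) := by
      rw [Classical.adjoin_range_ι]; trivial
    induction hb using Algebra.adjoin_induction with
    | mem x hx =>
      obtain ⟨y, rfl⟩ := hx
      change red UP 1 (Classical.inc y) ∈ S
      rw [Classical.inc_eq]
      simp only [map_add, map_sum, map_smul]
      exact add_mem (add_mem (add_mem (sum_mem fun i _ => S.smul_mem (hM i) _)
        (sum_mem fun i _ => S.smul_mem (hN i) _)) (S.smul_mem hP0 _))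
        (sum_mem fun i _ => S.smul_mem (hP i) _)
    | algebraMap z =>
      rw [← algebraMap_cst, AlgHom.commutes]
      exact S.algebraMap_mem _
    | add x y _ _ hx hy =>
      rw [← CHom_apply] at hx hy ⊢
      rw [map_add, map_add]
      exact add_mem hx hy
    | mul x y _ _ hx hy =>
      rw [← CHom_apply] at hx hy ⊢
      rw [map_mul, map_mul]
      exact mul_mem hx hy
  obtain ⟨f, hf⟩ := hC (coeff 0 x)
  have hf' : red UP 1 (C (coeff 0 x)) = red UP 1 (freeHom f) := hf.symm
  obtain ⟨y, hy⟩ := mem_hIdeal.1 (Ideal.Quotient.eq.1 hf')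
  refine ⟨f, y + divH x, ?_⟩
  rw [smul_add, ← pow_one h, ← hy, pow_one, sub_add_eq_add_sub, ← eq_C_add_h_smul]
  abel

/-- Successive approximation: `x = freeHom f₀ + h x₁`, `x₁ = freeHom f₁ + h x₂`, and so on. The
series `∑ hᵏ fₖ` converges already in the free algebra, and its image is `x` since `𝒰` is separated.
-/
theorem hom_surjective : Function.Surjective hom := by
  intro x
  choose f r hr using exists_freeHom_sub
  let t : ℕ → UP := fun n => r^[n] x
  have ht (m : ℕ) : t m = freeHom (f (t m)) + h • t (m + 1) := by
    rw [show t (m + 1) = r (t m) from Function.iterate_succ_apply' r m x]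
    exact hr _
  refine ⟨proj (hsum fun k => f (t k)), ?_⟩
  change freeHom (hsum fun k => f (t k)) = t 0
  refine HSep.eq_of_sub fun n => ?_
  obtain ⟨y, hy⟩ := hsum_spec (fun k => f (t k)) n
  obtain ⟨z, hz⟩ := sum_of_tails ht n
  refine ⟨freeHom y - z, ?_⟩
  rw [hy, hz]
  simp only [map_add, map_sum, map_smul, smul_sub]
  abel

/-- The isomorphism to the classical basis. -/
def equiv : KP ≃ₐ[Ch] UP := AlgEquiv.ofBijective hom ⟨hom_injective, hom_surjective⟩

theorem equiv_M (i : Fin 3) : equiv (M i) = Classical.M i := hom_M i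

theorem equiv_N (i : Fin 3) : equiv (N i) = Classical.N i := hom_N i

theorem equiv_P0 : equiv P0 = divH Classical.logXi := hom_P0

theorem equiv_P (i : Fin 3) : equiv (P i) = Classical.P i * Classical.XiInv := hom_P i

theorem equiv_expNeg : equiv expNeg = Classical.XiInv := hom_expNeg

/-- Separation of `𝒦` is built into the ideal; completeness is inherited from `𝒰` through the
isomorphism. -/
instance : HComplete KP := .of_linearEquiv equiv.symm.toLinearEquiv

/-! ### The Hopf algebra structure -/

/-- The `κ`-Poincaré algebra in the bicrossproduct basis. -/
def hopf : HopfStructure KP := Classical.hopf.transport equiv (HComplete.isAdicComplete KP)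

theorem isHopfIso : IsHopfIso hopf Classical.hopf equiv :=
  HopfStructure.isHopfIso_transport _ _ _

end Bicross

/-! ### Primitivity of `h⁻¹ ln Ξ` and the coproducts of the new generators -/

namespace Classical

open HSeries

/-- The logarithm of a group-like element is primitive: `Δ(ln Ξ)` and `ln Ξ ⊗ 1 + 1 ⊗ ln Ξ` commute
and have the same exponential `Ξ ⊗ Ξ`, so they are equal by `eval_exp_injective`. -/
theorem comulSeries_divH_logXi :
    comulSeries (divH logXi) = inl U (divH logXi) + inr U (divH logXi) := by
  have h0 (F : UP →ₐ[Ch] HSeries (U ⊗[ℂ] U)) : coeff 0 (F logXi) = 0 := by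
    rw [← h_smul_divH_logXi, map_smul, coeff_h_smul_zero]
  have hlr : Commute (inl U logXi) (inr U logXi) := (inr_mul_inl _ _).symm
  have hXX : Commute Xi logXi :=
    commute_eval coeff_zero_Xi_sub_one ((Commute.refl Xi).sub_right (Commute.one_right Xi)) _
  have hl : Commute (inl U logXi) (inl U Xi * inr U Xi) :=
    Commute.mul_right (hXX.symm.map (inl U)) (inr_mul_inl _ _).symm
  have hr : Commute (inr U logXi) (inl U Xi * inr U Xi) :=
    Commute.mul_right (inr_mul_inl _ _) (hXX.symm.map (inr U))
  have h1 : coeff 0 (comulSeries (Xi - 1)) = 0 := by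
    obtain ⟨y, hy⟩ := exists_eq_h_smul coeff_zero_Xi_sub_one
    rw [hy, map_smul, coeff_h_smul_zero]
  have hc : Commute (comulSeries logXi) (inl U logXi + inr U logXi) := by
    rw [logXi, map_eval comulSeries _ coeff_zero_Xi_sub_one, ← logXi]
    refine (commute_eval h1 ?_ _).symm
    rw [map_sub, comulSeries_Xi, map_one]
    exact (hl.add_left hr).sub_right (Commute.one_right _)
  have e : comulSeries logXi = inl U logXi + inr U logXi := by
    refine eval_exp_injective (h0 _) (by rw [coeff_add, h0, h0, add_zero]) hc ?_
    rw [eval_exp_add (h0 _) (h0 _) hlr, ← map_eval _ _ coeff_zero_logXi,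
      ← map_eval _ _ coeff_zero_logXi, ← map_eval _ _ coeff_zero_logXi, eval_exp_logXi,
      comulSeries_Xi]
  refine h_smul_injective ?_
  rw [smul_add, ← map_smul, ← map_smul, ← map_smul, h_smul_divH_logXi, e]

/-- Formulated for any homomorphism with named images of the generators; used with the inverse of
the isomorphism to read off the coproduct in the bicrossproduct basis. -/
theorem map_comul_N {A : Type} [Ring A] [Algebra Ch A] (G : UP →ₐ[Ch] A) {m' n' p' : Fin 3 → A}
    {w : A} (hM : ∀ i, G (M i) = m' i) (hN : ∀ i, G (N i) = n' i)
    (hP : ∀ i, G (P i * XiInv) = p' i) (hW : G XiInv = w) (i : Fin 3) :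
    CTensor.map G (comul (N i)) = ctmul (n' i) 1 + ctmul w (n' i) -
      h • ∑ j, ∑ k, cst (eps i j k) • ctmul (p' j) (m' k) := by
  rw [CTensor.sum_eps_smul, comul_N, map_sub (CTensor.map G), map_add, map_smul,
    map_sub (CTensor.map G), CTensor.map_ctmul, CTensor.map_ctmul, CTensor.map_ctmul,
    CTensor.map_ctmul, map_one]
  simp only [hM, hN, hP, hW]

theorem comul_divH_logXi :
    comul (divH logXi) = ctmul 1 (divH logXi) + ctmul (divH logXi) 1 := by
  rw [comul, AlgHom.comp_apply, comulSeries_divH_logXi, map_add, toCTensor_inl, toCTensor_inr,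
    add_comm]

theorem counit_divH_logXi : counit (divH logXi) = 0 := by
  have e : counit logXi = 0 := by
    have hx : ∃ y, counit (Xi - 1) = h • y := by
      obtain ⟨y, hy⟩ := exists_eq_h_smul coeff_zero_Xi_sub_one
      exact ⟨counit y, by rw [hy, map_smul]⟩
    rw [logXi, eval_step _ coeff_zero_Xi_sub_one, map_add, map_smul, map_mul, map_sub counit Xi,
      counit_Xi, map_one, sub_self, zero_mul, add_zero]
    simp
  have e' : h * counit (divH logXi) = 0 := by
    rw [← smul_eq_mul, ← map_smul, h_smul_divH_logXi, e]
  exact (mul_eq_zero.1 e').resolve_left PowerSeries.X_ne_zero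

theorem comul_P_mul_XiInv (i : Fin 3) : comul (P i * XiInv) =
    ctmul XiInv (P i * XiInv) + ctmul (P i * XiInv) 1 := by
  refine CTensor.ext fun n => ?_
  rw [← redComul_red, redComul_P_mul_XiInv, map_add, CTensor.level_ctmul, CTensor.level_ctmul,
    map_one, add_comm]

theorem map_comul_M {A : Type} [Ring A] [Algebra Ch A] (G : UP →ₐ[Ch] A) {m' : Fin 3 → A}
    (hM : ∀ i, G (M i) = m' i) (i : Fin 3) :
    CTensor.map G (comul (M i)) = ctmul (m' i) 1 + ctmul 1 (m' i) := by
  rw [comul_M, map_add, CTensor.map_ctmul, CTensor.map_ctmul, map_one, hM]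

theorem map_comul_P_mul_XiInv {A : Type} [Ring A] [Algebra Ch A] (G : UP →ₐ[Ch] A)
    {p' : Fin 3 → A} {w : A} (hP : ∀ i, G (P i * XiInv) = p' i) (hW : G XiInv = w) (i : Fin 3) :
    CTensor.map G (comul (P i * XiInv)) = ctmul w (p' i) + ctmul (p' i) 1 := by
  rw [comul_P_mul_XiInv, map_add, CTensor.map_ctmul, CTensor.map_ctmul, map_one, hP, hW]

theorem map_comul_divH_logXi {A : Type} [Ring A] [Algebra Ch A] (G : UP →ₐ[Ch] A) {p0' : A}
    (hP0 : G (divH logXi) = p0') :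
    CTensor.map G (comul (divH logXi)) = ctmul 1 p0' + ctmul p0' 1 := by
  rw [comul_divH_logXi, map_add, CTensor.map_ctmul, CTensor.map_ctmul, map_one, hP0]

end Classical

namespace Bicross

theorem hopf_comul (x : KP) :
    hopf.comul x = CTensor.map (equiv.symm : UP →ₐ[Ch] KP) (Classical.comul (equiv x)) := rfl

theorem hopf_counit (x : KP) : hopf.counit x = Classical.counit (equiv x) := rfl

theorem equiv_symm_apply {x : KP} {y : UP} (H : equiv x = y) :
    (equiv.symm : UP →ₐ[Ch] KP) y = x := by
  rw [← H]
  exact equiv.symm_apply_apply x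

theorem symm_M (i : Fin 3) : (equiv.symm : UP →ₐ[Ch] KP) (Classical.M i) = M i :=
  equiv_symm_apply (equiv_M i)

theorem symm_N (i : Fin 3) : (equiv.symm : UP →ₐ[Ch] KP) (Classical.N i) = N i :=
  equiv_symm_apply (equiv_N i)

theorem symm_P0 : (equiv.symm : UP →ₐ[Ch] KP) (HSeries.divH Classical.logXi) = P0 :=
  equiv_symm_apply equiv_P0

theorem symm_P (i : Fin 3) :
    (equiv.symm : UP →ₐ[Ch] KP) (Classical.P i * Classical.XiInv) = P i :=
  equiv_symm_apply (equiv_P i)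

theorem symm_XiInv : (equiv.symm : UP →ₐ[Ch] KP) Classical.XiInv = expNeg :=
  equiv_symm_apply equiv_expNeg

theorem isKappaHopf_hopf : IsKappaHopf hopf where
  comul_M i := (hopf_comul (M i)).trans
    ((congrArg (fun x => CTensor.map _ (Classical.comul x)) (equiv_M i)).trans
      (Classical.map_comul_M _ symm_M i))
  comul_N i := (hopf_comul (N i)).trans
    ((congrArg (fun x => CTensor.map _ (Classical.comul x)) (equiv_N i)).trans
      (Classical.map_comul_N _ symm_M symm_N symm_P symm_XiInv i))
  comul_P i := (hopf_comul (P i)).trans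
    ((congrArg (fun x => CTensor.map _ (Classical.comul x)) (equiv_P i)).trans
      (Classical.map_comul_P_mul_XiInv _ symm_P symm_XiInv i))
  comul_P0 := (hopf_comul P0).trans
    ((congrArg (fun x => CTensor.map _ (Classical.comul x)) equiv_P0).trans
      (Classical.map_comul_divH_logXi _ symm_P0))
  counit_M i := by rw [hopf_counit, equiv_M, Classical.counit_M]
  counit_N i := by rw [hopf_counit, equiv_N, Classical.counit_N]
  counit_P i := by rw [hopf_counit, equiv_P, map_mul, Classical.counit_P, zero_mul]
  counit_P0 := by rw [hopf_counit, equiv_P0, Classical.counit_divH_logXi]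

theorem IsKappaHopf.eq {H K : HopfStructure KP} (hH : IsKappaHopf H) (hK : IsKappaHopf K) :
    H = K := by
  refine HopfStructure.ext_of_comul
    (algHom_ext (A := CTensor KP KP) (fun i => ?_) (fun i => ?_) ?_ fun i => ?_)
    (algHom_ext (fun i => ?_) (fun i => ?_) ?_ fun i => ?_)
  · rw [hH.comul_M, hK.comul_M]
  · rw [hH.comul_N, hK.comul_N]
  · rw [hH.comul_P0, hK.comul_P0]
  · rw [hH.comul_P, hK.comul_P]
  · rw [hH.counit_M, hK.counit_M]
  · rw [hH.counit_N, hK.counit_N]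
  · rw [hH.counit_P0, hK.counit_P0]
  · rw [hH.counit_P, hK.counit_P]

end Bicross

end KappaPoincare

end

/-! ### The main theorem -/

theorem mainTheorem4 :
    ∃ (H : KappaPoincare.HopfStructure KappaPoincare.UP)
      (K : KappaPoincare.HopfStructure KappaPoincare.Bicross.KP)
      (Φ : KappaPoincare.Bicross.KP ≃ₐ[KappaPoincare.Ch] KappaPoincare.UP),
      -- the Hopf algebra in the classical basis, determined by its values on the generators
      (KappaPoincare.Classical.IsKappaHopf H ∧
        ∀ H', KappaPoincare.Classical.IsKappaHopf H' → H' = H) ∧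
      -- the Hopf algebra in the bicrossproduct basis
      (KappaPoincare.Bicross.IsKappaHopf K ∧
        ∀ K', KappaPoincare.Bicross.IsKappaHopf K' → K' = K) ∧
      -- the isomorphism
      KappaPoincare.IsHopfIso K H Φ ∧
      (∀ i, Φ (KappaPoincare.Bicross.M i) = KappaPoincare.Classical.M i) ∧
      (∀ i, Φ (KappaPoincare.Bicross.N i) = KappaPoincare.Classical.N i) ∧
      Φ KappaPoincare.Bicross.P0 =
        KappaPoincare.HSeries.divH KappaPoincare.Classical.logXi ∧
      (∀ i, Φ (KappaPoincare.Bicross.P i) =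
        KappaPoincare.Classical.P i * KappaPoincare.Classical.XiInv) ∧
      KappaPoincare.HSeries.eval (PowerSeries.exp ℂ)
        (KappaPoincare.h • Φ KappaPoincare.Bicross.P0) = KappaPoincare.Classical.Xi ∧
      -- `Ξ` is invertible and group-like
      KappaPoincare.Classical.Xi * KappaPoincare.Classical.XiInv = 1 ∧
      KappaPoincare.Classical.XiInv * KappaPoincare.Classical.Xi = 1 ∧
      H.comul KappaPoincare.Classical.Xi =
        KappaPoincare.ctmul KappaPoincare.Classical.Xi KappaPoincare.Classical.Xi ∧
      H.comul KappaPoincare.Classical.XiInv =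
        KappaPoincare.ctmul KappaPoincare.Classical.XiInv KappaPoincare.Classical.XiInv ∧
      H.counit KappaPoincare.Classical.Xi = 1 ∧
      H.counit KappaPoincare.Classical.XiInv = 1 ∧
      H.antipode KappaPoincare.Classical.Xi = KappaPoincare.Classical.XiInv ∧
      -- the square of the antipode
      (∀ x, H.antipode (H.antipode x) =
        KappaPoincare.Classical.Xi ^ 3 * x * KappaPoincare.Classical.XiInv ^ 3) := by
  open KappaPoincare in
  refine ⟨Classical.hopf, Bicross.hopf, Bicross.equiv,
    ⟨Classical.isKappaHopf_hopf, fun _ hH => hH.eq Classical.isKappaHopf_hopf⟩,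
    ⟨Bicross.isKappaHopf_hopf, fun _ hK => hK.eq Bicross.isKappaHopf_hopf⟩, Bicross.isHopfIso,
    Bicross.equiv_M, Bicross.equiv_N, Bicross.equiv_P0, Bicross.equiv_P, ?_,
    Classical.Xi_mul_XiInv, Classical.XiInv_mul_Xi, Classical.comul_Xi, Classical.comul_XiInv,
    Classical.counit_Xi, Classical.counit_XiInv, Classical.antipode_Xi,
    Classical.antipode_antipode⟩
  rw [KappaPoincare.Bicross.equiv_P0, KappaPoincare.Classical.h_smul_divH_logXi,
    KappaPoincare.Classical.eval_exp_logXi]
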